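/- Let $\Gamma$ be a group with a finite generating set $S$, let $|g|$ be the word length of $g\in\Gamma$ with respect to $S\cup S^{-1}$, and $B_S(r)=\{g:|g|\le r\}$. Let $\lambda$ be the left regular representation of $\Gamma$ on $\ell^2(\Gamma)$, and for $q=\sum_g q_g g\in\mathbb C[\Gamma]$ and a representation $\rho$ put $\rho(q)=\sum_g q_g\rho(g)$. **Assumptions.** (RD) $\Gamma$ has the rapid decay property with exponent $C_1>0$: for some finite generating set $S'$ and some constant $c'>0$, $\|\lambda(q)\|_{\rm op}\le c'\,{\rm diam}_{S'}(q)^{C_1}\|q\|_2$ for all $q\in\mathbb C[\Gamma]$, where ${\rm diam}_{S'}(q)$ is the maximum of $1$ and the diameter of the support of $q$ in the Cayley graph of $(\Gamma,S')$, and $\|q\|_2^2=\sum_g|q_g|^2$. (BS) For every $N$ in a set $\mathcal N$ of integers, $\rho_N:\Gamma\to S_N$ is an action of $\Gamma$ on $[N]=\{1,\dots,N\}$, written $g.x=\rho_N(g)(x)$ and identified with permutation matrices, $\rho_N(g)(x,y)=\mathbf 1(x=g.y)$. For some $\alpha>0$, $\beta\in[0,1)$, $C_B>0$, with $r_N=\lceil\alpha\ln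 N\rceil$, and for all $N\in\mathcal N$, $$\bigl|\{x\in[N]:\ g.x=x\text{ for some }g\in B_S(2r_N)\setminus\{e\}\}\bigr|\le C_BN^\beta .$$ (AC) $p\in\mathbb C[\Gamma]$ satisfies $p_{g^{-1}}=\overline{p_g}$ for all $g$, and $I_0$ is a compact interval such that, with $R^z=(\lambda(p)-z)^{-1}$, $\operatorname{Im}R^z=(R^z-(R^z)^*)/(2i)$ and $Q(x,y)=\langle\delta_x,Q\delta_y\rangle$, for some $C_0\ge1$, $$C_0^{-1}\le(\operatorname{Im}R^{E+i\eta})(e,e)\le C_0\qquad(E\in I_0,\ 0<\eta\le1).$$ (M) $I$ is a compact interval of positive length in the interior of $I_0$, and for some $C_1'>2C_1+1$, $\gamma\in(0,1]$, $C_M>0$, $$\sum_{g\in\Gamma}\eta^2|g|^{C_1'}\,|(\operatorname{Im}R^{E+i\eta})(e,g)|^4\le C_M\,\eta^{1+\gamma}\qquad(E\in I,\ 0<\eta\le1).$$ **Notation.** Let $T\subset\Gamma$ be finite. A matrix $K\in M_N(\mathbb C)$ is $T$-local if $K(x,y)=0$ unless $x=g.y$ for some $g\in T$. Put $\langle K\rangle=\sum_{g\in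 T}k_g\,\rho_N(g)$ with $k_g=\frac1N\sum_xK(g.x,x)$. For an orthonormal basis $(\varphi_i)$ of eigenvectors of $\rho_N(p)$ with eigenvalues $(\lambda_i)$, and $J\subset\mathbb R$, let $\Lambda_J=\{i:\lambda_i\in J\}$, and $J_E^\eta=[E-\eta,E+\eta]$. For $\eta>0$ and $C>0$ consider the bounds $$\frac1{|\Lambda_{J^{\eta}_{E_1}}|}\sum_{i\in\Lambda_{J^{\eta}_{E_1}}}\sum_{j\in\Lambda_{J^{\eta}_{E_2}}}\bigl|\langle\varphi_j,K\varphi_i\rangle-\langle\varphi_j,\langle K\rangle\varphi_i\rangle\bigr|^2\le C\,\eta^{\frac{1+\gamma}2}\quad\text{for all }E_1,E_2\in I,$$ $$\frac1{|\Lambda_I|}\sum_{i\in\Lambda_I}\bigl|\langle\varphi_i,K\varphi_i\rangle-\langle\varphi_i,\langle K\rangle\varphi_i\rangle\bigr|^2\le C\,\eta^{\frac{1+\gamma}2},\qquad(\ast)$$ where a left-hand side with an empty $\Lambda_{J^\eta_{E_1}}$ or $\Lambda_I$ is read as $0$. **Theorem.** Assume (RD), (BS), (AC), (M), and let $T\subset\Gamma$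 be finite. 1. Assume in addition that for all $N\in\mathcal N$ and all $q\in\mathbb C[\Gamma]$ supported in $B_S(r_N)$, the restriction of $\rho_N(q)$ to the orthogonal complement of the constant vector satisfies $\|\rho_N(q)_{|1^\perp}\|_{\rm op}\le2\|\lambda(q)\|_{\rm op}$. Then there is $C>0$ such that for all $N\in\mathcal N$, $N\ge3$, all $T$-local $K\in M_N(\mathbb C)$ with $\max_{x,y}|K(x,y)|\le1$, and all orthonormal eigenbases of $\rho_N(p)$, both bounds $(\ast)$ hold with $\eta=\eta_N=C\,\dfrac{\ln\ln N}{\ln N}$. 2. Without this additional assumption, for every $b>0$ there are $C>0$ and subspaces $H_N\subset\mathbb C^N$ such that for all $N\in\mathcal N$, $N\ge3$, one has $\dim H_N\le N/(\ln N)^b$, and both bounds $(\ast)$ hold with $\eta=\eta_N=C\,\dfrac{(\ln\ln N)^2}{\ln N}$ for all orthonormal eigenbases of $\rho_N(p)$ and all $T$-local $K\in M_N(\mathbb C)$ with $\max_{x,y}|K(x,y)|\le1$ such that $(K(g.x,x))_{x\in[N]}\in H_N^\perp$ for all $g\in T$. -/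

import Mathlib

open scoped BigOperators ENNReal

noncomputable section

namespace QuantumMixing

/-! ### Word metric on a finitely generated group -/

section Group

variable {Γ : Type*} [Group Γ]

/-- The word length of `g` with respect to the letters `s` and `s⁻¹`, `s ∈ S`, that is, the distance
from `1` to `g` in the Cayley graph (the infimum is over a nonempty set when `S` generates `Γ`). -/
def wordLength (S : Finset Γ) (g : Γ) : ℕ :=
  sInf {n : ℕ | ∃ l : List Γ, l.length = n ∧ (∀ s ∈ l, s ∈ S ∨ s⁻¹ ∈ S) ∧ l.prod = g}

/-- The maximum between one and the diameter of the support of `p` in the left Cayley graph, whose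
edges join `g` to `s * g` (so that the distance between `g` and `h` is the length of `g * h⁻¹`). -/
def diamSupport (S : Finset Γ) (p : MonoidAlgebra ℂ Γ) : ℕ :=
  max 1 (p.coeff.support.sup fun g => p.coeff.support.sup fun h => wordLength S (g * h⁻¹))

/-- The `ℓ²` norm of the coefficients of an element of the group algebra. -/
def l2Norm (p : MonoidAlgebra ℂ Γ) : ℝ :=
  Real.sqrt (∑ g ∈ p.coeff.support, ‖p.coeff g‖ ^ 2)

/-- `p = p^*`, that is, `p_{g⁻¹}` is the complex conjugate of `p_g` for all `g`. -/
def IsSelfAdj (p : MonoidAlgebra ℂ Γ) : Prop :=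
  ∀ g : Γ, p.coeff g⁻¹ = star (p.coeff g)

/-! ### The left regular representation, and resolvents on `ℓ²(Γ)` -/

variable (Γ) in
/-- The Hilbert space `ℓ²(Γ)`. -/
abbrev Ell2 : Type _ := lp (fun _ : Γ => ℂ) 2

/-- The operator `λ(g)` on `ℓ²(Γ)`: `(λ(g) f)(x) = f(g⁻¹ x)`, so that `λ(g) δ_v = δ_{gv}`. -/
def leftReg (g : Γ) : Ell2 Γ →L[ℂ] Ell2 Γ :=
  LinearMap.mkContinuous
    { toFun := fun f => ⟨fun x => f (g⁻¹ * x), by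
        have h := (memℓp_gen_iff (p := 2) (by simp)).1 (lp.memℓp f)
        exact (memℓp_gen_iff (p := 2) (by simp)).2
          ((Equiv.mulLeft g⁻¹).summable_iff.2 h)⟩
      map_add' := fun _ _ => rfl
      map_smul' := fun _ _ => rfl }
    1 (fun f => by
      rw [one_mul, lp.norm_eq_tsum_rpow (p := 2) (by simp), lp.norm_eq_tsum_rpow (p := 2) (by simp)]
      exact le_of_eq (congrArg (fun t : ℝ => t ^ (1 / (2 : ℝ≥0∞).toReal))
        ((Equiv.mulLeft g⁻¹).tsum_eq fun x => ‖f x‖ ^ (2 : ℝ≥0∞).toReal)))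

/-- The operator `λ(p) = ∑_g p_g λ(g)` on `ℓ²(Γ)`. -/
def leftRegAlg (p : MonoidAlgebra ℂ Γ) : Ell2 Γ →L[ℂ] Ell2 Γ :=
  ∑ g ∈ p.coeff.support, p.coeff g • leftReg g

open Classical in
/-- The matrix coefficient `Q(x, y) = ⟨δ_x, Q δ_y⟩`. -/
def entry (Q : Ell2 Γ →L[ℂ] Ell2 Γ) (x y : Γ) : ℂ :=
  inner ℂ (lp.single 2 x (1 : ℂ) : Ell2 Γ) (Q (lp.single 2 y (1 : ℂ)))

/-- The resolvent `R^z = (λ(p) - z)⁻¹`. -/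
def resolventAt (p : MonoidAlgebra ℂ Γ) (z : ℂ) : Ell2 Γ →L[ℂ] Ell2 Γ :=
  Ring.inverse (leftRegAlg p - z • (1 : Ell2 Γ →L[ℂ] Ell2 Γ))

/-- `Im R^z = (R^z - (R^z)^*) / (2i)`. -/
def imResolvent (p : MonoidAlgebra ℂ Γ) (z : ℂ) : Ell2 Γ →L[ℂ] Ell2 Γ :=
  (2 * Complex.I)⁻¹ • (resolventAt p z - ContinuousLinearMap.adjoint (resolventAt p z))

variable (Γ) in
/-- The rapid decay property with exponent `C₁`. -/
def HasRapidDecay (C₁ : ℝ) : Prop :=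
  0 < C₁ ∧ ∃ S : Finset Γ, Subgroup.closure (S : Set Γ) = ⊤ ∧ ∃ C : ℝ, 0 < C ∧
    ∀ p : MonoidAlgebra ℂ Γ, ‖leftRegAlg p‖ ≤ C * (diamSupport S p : ℝ) ^ C₁ * l2Norm p

/-- Two-sided bound `C₀⁻¹ ≤ Im R^z(e, e) ≤ C₀` above the interval `[c, d]`, for `0 < Im z ≤ 1`
(the entry is real, as `Im R^z` is self-adjoint). -/
def DiagonalBound (p : MonoidAlgebra ℂ Γ) (c d C₀ : ℝ) : Prop :=
  ∀ E ∈ Set.Icc c d, ∀ η : ℝ, 0 < η → η ≤ 1 →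
    C₀⁻¹ ≤ (entry (imResolvent p (E + η * Complex.I)) 1 1).re ∧
      (entry (imResolvent p (E + η * Complex.I)) 1 1).re ≤ C₀

/-- Weighted fourth moment bound
`∑_g η² |g|^{κ} |(Im R^{E + iη})(e, g)|⁴ ≤ C η^{1 + γ}` for `E ∈ [a, b]`, `0 < η ≤ 1`. -/
def FourthMomentBound (S : Finset Γ) (p : MonoidAlgebra ℂ Γ) (a b κ γ C : ℝ) : Prop :=
  ∀ E ∈ Set.Icc a b, ∀ η : ℝ, 0 < η → η ≤ 1 →
    (Summable fun g : Γ =>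
      η ^ 2 * (wordLength S g : ℝ) ^ κ * ‖entry (imResolvent p (E + η * Complex.I)) 1 g‖ ^ 4) ∧
    ∑' g : Γ,
      η ^ 2 * (wordLength S g : ℝ) ^ κ * ‖entry (imResolvent p (E + η * Complex.I)) 1 g‖ ^ 4
        ≤ C * η ^ (1 + γ)

end Group

/-! ### Permutation representations and observables -/

section Finite

variable {Γ : Type*} [Group Γ] {N : ℕ}

/-- The matrix `ρ(p) = ∑_g p_g ρ(g)`, where `ρ(g)(x, y) = 1` if `x = g.y` and `0` otherwise. -/
def permAlg (ρ : Γ →* Equiv.Perm (Fin N)) (p : MonoidAlgebra ℂ Γ) : Matrix (Fin N) (Fin N) ℂ :=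
  ∑ g ∈ p.coeff.support, p.coeff g • Matrix.of fun x y => if x = ρ g y then (1 : ℂ) else 0

open Classical in
/-- The set of points that are fixed by some `g ≠ e` in the ball of radius `2 r`. -/
def bad (S : Finset Γ) (ρ : Γ →* Equiv.Perm (Fin N)) (r : ℕ) : Finset (Fin N) :=
  Finset.univ.filter fun x => ∃ g : Γ, g ≠ 1 ∧ wordLength S g ≤ 2 * r ∧ ρ g x = x

variable (N) in
/-- The orthogonal complement of the constant vector. -/
def onePerp : Submodule ℂ (EuclideanSpace ℂ (Fin N)) :=
  (Submodule.span ℂ {WithLp.toLp 2 fun _ : Fin N => (1 : ℂ)})ᗮ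

/-- The operator norm of the restriction of the matrix `M` to the orthogonal complement of the
constant vector. -/
def normOnePerp (M : Matrix (Fin N) (Fin N) ℂ) : ℝ :=
  ‖(Matrix.toEuclideanCLM (𝕜 := ℂ) M).comp (onePerp N).subtypeL‖

/-- `‖ρ(q)‖ ≤ 2 ‖λ(q)‖`, with `ρ(q)` restricted to the orthogonal complement of the constant
vector, for all `q` supported in the ball of radius `r`. -/
def StrongBound (S : Finset Γ) (ρ : Γ →* Equiv.Perm (Fin N)) (r : ℕ) : Prop :=
  ∀ q : MonoidAlgebra ℂ Γ, (∀ g ∈ q.coeff.support, wordLength S g ≤ r) →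
    normOnePerp (permAlg ρ q) ≤ 2 * ‖leftRegAlg q‖

/-- `K` is `T`-local, and its entries are bounded by one. -/
def IsLocalObservable (ρ : Γ →* Equiv.Perm (Fin N)) (T : Finset Γ)
    (K : Matrix (Fin N) (Fin N) ℂ) : Prop :=
  (∀ x y, (¬ ∃ g ∈ T, x = ρ g y) → K x y = 0) ∧ ∀ x y, ‖K x y‖ ≤ 1

/-- The vector `x ↦ K(g.x, x)`. -/
def kernelVec (ρ : Γ →* Equiv.Perm (Fin N)) (K : Matrix (Fin N) (Fin N) ℂ) (g : Γ) :
    EuclideanSpace ℂ (Fin N) :=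
  WithLp.toLp 2 fun x => K (ρ g x) x

/-- The average `⟨K⟩ = ρ(k)`, where `k = ∑_{g ∈ T} k_g g` and `k_g = N⁻¹ ∑_x K(g.x, x)`. -/
def average (ρ : Γ →* Equiv.Perm (Fin N)) (T : Finset Γ) (K : Matrix (Fin N) (Fin N) ℂ) :
    Matrix (Fin N) (Fin N) ℂ :=
  permAlg ρ (∑ g ∈ T, MonoidAlgebra.single g ((N : ℂ)⁻¹ * ∑ x, K (ρ g x) x))

/-- `φ` is an orthonormal basis of eigenvectors of `A`, with eigenvalues `ev`. -/
def IsEigenbasis (A : Matrix (Fin N) (Fin N) ℂ)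
    (φ : OrthonormalBasis (Fin N) ℂ (EuclideanSpace ℂ (Fin N))) (ev : Fin N → ℝ) : Prop :=
  ∀ i, Matrix.toEuclideanCLM (𝕜 := ℂ) A (φ i) = (ev i : ℂ) • φ i

open Classical in
/-- The set `Λ_J` of indices whose eigenvalue belongs to `J`. -/
def indices (ev : Fin N → ℝ) (J : Set ℝ) : Finset (Fin N) :=
  Finset.univ.filter fun i => ev i ∈ J

/-- `⟨φ_j, K φ_i⟩ - ⟨φ_j, ⟨K⟩ φ_i⟩`. -/
def centeredCoeff (ρ : Γ →* Equiv.Perm (Fin N)) (T : Finset Γ) (K : Matrix (Fin N) (Fin N) ℂ)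
    (φ : OrthonormalBasis (Fin N) ℂ (EuclideanSpace ℂ (Fin N))) (j i : Fin N) : ℂ :=
  inner ℂ (φ j) (Matrix.toEuclideanCLM (𝕜 := ℂ) K (φ i)) -
    inner ℂ (φ j) (Matrix.toEuclideanCLM (𝕜 := ℂ) (average ρ T K) (φ i))

/-- The quantum mixing variance for the spectral windows `J₁` and `J₂`
(equal to `0` if `J₁` contains no eigenvalue). -/
def mixingVariance (ρ : Γ →* Equiv.Perm (Fin N)) (T : Finset Γ) (K : Matrix (Fin N) (Fin N) ℂ)
    (φ : OrthonormalBasis (Fin N) ℂ (EuclideanSpace ℂ (Fin N))) (ev : Fin N → ℝ)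
    (J₁ J₂ : Set ℝ) : ℝ :=
  ((indices ev J₁).card : ℝ)⁻¹ *
    ∑ i ∈ indices ev J₁, ∑ j ∈ indices ev J₂, ‖centeredCoeff ρ T K φ j i‖ ^ 2

/-- The quantum ergodicity variance for the spectral window `I`
(equal to `0` if `I` contains no eigenvalue). -/
def ergodicityVariance (ρ : Γ →* Equiv.Perm (Fin N)) (T : Finset Γ)
    (K : Matrix (Fin N) (Fin N) ℂ) (φ : OrthonormalBasis (Fin N) ℂ (EuclideanSpace ℂ (Fin N)))
    (ev : Fin N → ℝ) (I : Set ℝ) : ℝ :=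
  ((indices ev I).card : ℝ)⁻¹ * ∑ i ∈ indices ev I, ‖centeredCoeff ρ T K φ i i‖ ^ 2

/-- For every orthonormal eigenbasis of `ρ(p)`, the quantum mixing variances of `K` at scale `η`,
at all energies in `[a, b]`, and its quantum ergodicity variance in `[a, b]`, are at most `δ`. -/
def VarianceBounds (ρ : Γ →* Equiv.Perm (Fin N)) (p : MonoidAlgebra ℂ Γ) (a b : ℝ) (T : Finset Γ)
    (K : Matrix (Fin N) (Fin N) ℂ) (η δ : ℝ) : Prop :=
  ∀ (φ : OrthonormalBasis (Fin N) ℂ (EuclideanSpace ℂ (Fin N))) (ev : Fin N → ℝ),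
    IsEigenbasis (permAlg ρ p) φ ev →
    (∀ E₁ ∈ Set.Icc a b, ∀ E₂ ∈ Set.Icc a b,
      mixingVariance ρ T K φ ev (Set.Icc (E₁ - η) (E₁ + η)) (Set.Icc (E₂ - η) (E₂ + η)) ≤ δ) ∧
    ergodicityVariance ρ T K φ ev (Set.Icc a b) ≤ δ

end Finite

end QuantumMixing

end

set_option linter.unusedSectionVars false

noncomputable section

namespace QuantumMixing

/-! ### Word length -/

section WordLength

variable {Γ : Type*} [Group Γ] {S : Finset Γ}

/-! For `g ∈ T` let `a` be the function `x ↦ K(g.x, x)` minus its mean, and `B = ρ(g) diag(a)`. Up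
to an error carried by the few points of `bad`, `K - ⟨K⟩` is the sum of these `B`. It therefore
suffices to bound `∑ |⟨φ_j, B φ_i⟩|²` over two windows of width of order `η` by a constant times `N
η^{(3+γ)/2}`. Indeed a window contains at least a constant times `N η` eigenvalues
(`le_card_indices`), and the quotient is the rate `η^{(1+γ)/2}`.

The indicator of a window is at most five times the Poisson kernel, whose value at `λ(p)` is `η Im
R^{E+iη}`. By `exists_poisson_approx` the kernel may be replaced by a polynomial `h` of degree
`O(n)` lying above it, with an error exponentially small in `η n`, hence smaller than a large power
of `1/n` once `η n` is a large multiple of `log n`. The window sum is then at most `25 tr(B^*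
h₂(ρ(p)) B h₁(ρ(p)))`. Only words of length `O(n)` enter this trace. Away from `bad` such a word
fixes a point only if it is trivial, so the trace reduces to `⟨a, ρ(s) a⟩` with `s = schurTwist g
h₁(p) h₂(p)` (`norm_trace_twisted_sub_le`). The loss, of order `|bad| e^{O(n)}`, is negligible when
`n` is a small multiple of `log N`.

The coefficients of `s` are products of coefficients of `h₁(p)` and `h₂(p)`. Rapid decay, summed
over spheres, bounds `‖λ(s)‖` by a weighted `ℓ²` norm of `s`, hence by weighted `ℓ⁴` norms of the
`h_i(p)`. These are what the fourth moment hypothesis controls, and `‖λ(s)‖ ≤ C η^{(3+γ)/2}` follows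
(`exists_norm_schurTwist_le`).

It remains to pass from `λ(s)` to `ρ(s)`. Under strong convergence this is immediate, because `a` is
orthogonal to the constants. Otherwise the moment method (`exists_submodule_permAlg`) shows that
`‖ρ(s) v‖ ≤ 2θ‖v‖`, where `θ` bounds `‖λ(s)‖`, off a subspace of dimension at most `2N / 4^m`,
provided that words of length `m` times that of `s` are still short. Taking `m` of order `log log N`
makes this dimension a power of `1/log N` times `N`, and forces `n` down to order `log N / log log
N`; this is the additional factor `log log N` in `η`. A net of energies keeps the number of
operators `s` polynomial in `log N`.

`exists_varianceBounds` takes the bound on the quadratic forms as a hypothesis and serves both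
parts. -/

theorem wordLength_le_length (S : Finset Γ) {l : List Γ} (hl : ∀ s ∈ l, s ∈ S ∨ s⁻¹ ∈ S) :
    wordLength S l.prod ≤ l.length :=
  Nat.sInf_le ⟨l, rfl, hl, rfl⟩

theorem exists_list_wordLength (hS : Subgroup.closure (S : Set Γ) = ⊤) (g : Γ) :
    ∃ l : List Γ, l.length = wordLength S g ∧ (∀ s ∈ l, s ∈ S ∨ s⁻¹ ∈ S) ∧ l.prod = g := by
  have hg : g ∈ Subgroup.closure (S : Set Γ) := by rw [hS]; trivial
  rw [← Subgroup.mem_toSubmonoid, Subgroup.closure_toSubmonoid] at hg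
  obtain ⟨l, hl, hlp⟩ := Submonoid.exists_list_of_mem_closure hg
  exact Nat.sInf_mem (s := {n : ℕ | ∃ l : List Γ, l.length = n ∧ (∀ s ∈ l, s ∈ S ∨ s⁻¹ ∈ S) ∧
    l.prod = g}) ⟨l.length, l, rfl, fun s hs => by simpa using hl s hs, hlp⟩

@[simp] theorem wordLength_one (S : Finset Γ) : wordLength S (1 : Γ) = 0 :=
  Nat.le_zero.1 (wordLength_le_length S (l := []) (by simp))

theorem wordLength_mul_le (hS : Subgroup.closure (S : Set Γ) = ⊤) (g h : Γ) :
    wordLength S (g * h) ≤ wordLength S g + wordLength S h := by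
  obtain ⟨l, hl, hl', rfl⟩ := exists_list_wordLength hS g
  obtain ⟨m, hm, hm', rfl⟩ := exists_list_wordLength hS h
  rw [← hl, ← hm, ← List.length_append, ← List.prod_append]
  exact wordLength_le_length S (by
    intro s hs
    rcases List.mem_append.1 hs with h | h
    exacts [hl' s h, hm' s h])

theorem wordLength_inv_le (hS : Subgroup.closure (S : Set Γ) = ⊤) (g : Γ) :
    wordLength S g⁻¹ ≤ wordLength S g := by
  obtain ⟨l, hl, hl', rfl⟩ := exists_list_wordLength hS g
  rw [← hl, List.prod_inv_reverse]
  refine (wordLength_le_length S ?_).trans (by simp)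
  intro s hs
  simp only [List.mem_reverse, List.mem_map] at hs
  obtain ⟨t, ht, rfl⟩ := hs
  simpa [or_comm] using hl' t ht

theorem wordLength_inv (hS : Subgroup.closure (S : Set Γ) = ⊤) (g : Γ) :
    wordLength S g⁻¹ = wordLength S g :=
  le_antisymm (wordLength_inv_le hS g) (by simpa using wordLength_inv_le hS g⁻¹)

theorem one_le_wordLength (hS : Subgroup.closure (S : Set Γ) = ⊤) {g : Γ} (hg : g ≠ 1) :
    1 ≤ wordLength S g := by
  obtain ⟨l, hl, hl', rfl⟩ := exists_list_wordLength hS g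
  rw [← hl, Nat.one_le_iff_ne_zero]
  intro h
  exact hg (by rw [List.length_eq_zero_iff.1 h]; rfl)

theorem wordLength_list_prod_le (hS : Subgroup.closure (S : Set Γ) = ⊤) {L : ℕ} (l : List Γ)
    (hl : ∀ s ∈ l, wordLength S s ≤ L) : wordLength S l.prod ≤ L * l.length := by
  induction l with
  | nil => simp
  | cons a l ih =>
    rw [List.prod_cons, List.length_cons]
    have h1 := wordLength_mul_le hS a l.prod
    have h2 := hl a (by simp)
    have h3 := ih fun s hs => hl s (by simp [hs])
    lia

/-- Rapid decay is given for some generating set, the other hypotheses for `S`; this comparison lets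
all weights be measured with `S`. -/
theorem exists_wordLength_le_mul (hS : Subgroup.closure (S : Set Γ) = ⊤) {S' : Finset Γ}
    (hS' : Subgroup.closure (S' : Set Γ) = ⊤) :
    ∃ L : ℕ, 1 ≤ L ∧ ∀ g : Γ, wordLength S' g ≤ L * wordLength S g := by
  refine ⟨1 + S.sup (wordLength S'), by lia, fun g => ?_⟩
  obtain ⟨l, hl, hl', rfl⟩ := exists_list_wordLength hS g
  rw [← hl]
  refine wordLength_list_prod_le hS' l fun s hs => ?_
  rcases hl' s hs with h | h
  · exact (Finset.le_sup (f := wordLength S') h).trans (by lia)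
  · rw [← wordLength_inv hS']
    exact (Finset.le_sup (f := wordLength S') h).trans (by lia)

end WordLength

/-! ### The group algebra -/

section GroupAlgebra

variable {Γ : Type*} [Group Γ]

/-- The `ℓ¹` norm of the coefficients of an element of the group algebra. -/
def l1Norm (q : MonoidAlgebra ℂ Γ) : ℝ :=
  ∑ g ∈ q.coeff.support, ‖q.coeff g‖

theorem l1Norm_nonneg (q : MonoidAlgebra ℂ Γ) : 0 ≤ l1Norm q :=
  Finset.sum_nonneg fun _ _ => norm_nonneg _

theorem l2Norm_nonneg (q : MonoidAlgebra ℂ Γ) : 0 ≤ l2Norm q := Real.sqrt_nonneg _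

theorem l2Norm_sq (q : MonoidAlgebra ℂ Γ) :
    l2Norm q ^ 2 = ∑ g ∈ q.coeff.support, ‖q.coeff g‖ ^ 2 :=
  Real.sq_sqrt (Finset.sum_nonneg fun _ _ => by positivity)

theorem sum_single_coeff (q : MonoidAlgebra ℂ Γ) :
    ∑ g ∈ q.coeff.support, MonoidAlgebra.single g (q.coeff g) = q := by
  classical
  ext g
  simp only [MonoidAlgebra.coeff_sum, MonoidAlgebra.coeff_single, Finsupp.finsetSum_apply,
    Finsupp.single_apply, Finset.sum_ite_eq', Finsupp.mem_support_iff]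
  by_cases h : q.coeff g = 0 <;> simp [h]

/-- The adjoint `q^* = ∑_g \bar{q_g} g⁻¹`. -/
def adj (q : MonoidAlgebra ℂ Γ) : MonoidAlgebra ℂ Γ :=
  ∑ g ∈ q.coeff.support, MonoidAlgebra.single g⁻¹ (star (q.coeff g))

theorem coeff_adj (q : MonoidAlgebra ℂ Γ) (g : Γ) : (adj q).coeff g = star (q.coeff g⁻¹) := by
  classical
  simp only [adj, MonoidAlgebra.coeff_sum, MonoidAlgebra.coeff_single, Finsupp.finsetSum_apply,
    Finsupp.single_apply, inv_eq_iff_eq_inv, Finset.sum_ite_eq', Finsupp.mem_support_iff]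
  by_cases h : q.coeff g⁻¹ = 0 <;> simp [h]

theorem adj_eq_self {p : MonoidAlgebra ℂ Γ} (hp : IsSelfAdj p) : adj p = p := by
  ext g
  rw [coeff_adj, hp, star_star]

theorem l1Norm_le_sqrt_card_mul (q : MonoidAlgebra ℂ Γ) {k : ℕ} (hk : q.coeff.support.card ≤ k) :
    l1Norm q ≤ Real.sqrt k * l2Norm q := by
  rw [l1Norm, l2Norm, ← Real.sqrt_mul (by positivity)]
  refine Real.le_sqrt_of_sq_le ((sq_sum_le_card_mul_sum_sq).trans ?_)
  gcongr

end GroupAlgebra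

/-! ### The left regular representation -/

section LeftRegular

variable {Γ : Type*} [Group Γ]

theorem leftReg_apply (g : Γ) (f : Ell2 Γ) (x : Γ) : leftReg g f x = f (g⁻¹ * x) := rfl

theorem norm_leftReg_le (g : Γ) : ‖leftReg g‖ ≤ 1 :=
  LinearMap.mkContinuous_norm_le _ zero_le_one _

variable (Γ) in
/-- The left regular representation as a homomorphism. -/
def leftRegHom : Γ →* (Ell2 Γ →L[ℂ] Ell2 Γ) where
  toFun := leftReg
  map_one' := by
    ext f x
    simp [leftReg_apply]
  map_mul' g h := by
    ext f x
    simp [leftReg_apply, mul_assoc]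

variable (Γ) in
/-- The left regular representation of the group algebra. -/
def leftRegAlgHom : MonoidAlgebra ℂ Γ →ₐ[ℂ] (Ell2 Γ →L[ℂ] Ell2 Γ) :=
  MonoidAlgebra.lift ℂ _ Γ (leftRegHom Γ)

theorem leftRegAlgHom_apply (q : MonoidAlgebra ℂ Γ) : leftRegAlgHom Γ q = leftRegAlg q := by
  rw [leftRegAlgHom, MonoidAlgebra.lift_apply]
  rfl

theorem leftRegAlgHom_single (g : Γ) (z : ℂ) :
    leftRegAlgHom Γ (MonoidAlgebra.single g z) = z • leftReg g := by
  rw [leftRegAlgHom, MonoidAlgebra.lift_single]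
  rfl

theorem norm_leftRegAlg_le (q : MonoidAlgebra ℂ Γ) : ‖leftRegAlg q‖ ≤ l1Norm q := by
  refine (norm_sum_le _ _).trans (Finset.sum_le_sum fun g _ => ?_)
  rw [norm_smul]
  exact mul_le_of_le_one_right (norm_nonneg _) (norm_leftReg_le g)

theorem adjoint_leftReg (g : Γ) : ContinuousLinearMap.adjoint (leftReg g) = leftReg g⁻¹ := by
  symm
  rw [ContinuousLinearMap.eq_adjoint_iff]
  intro f h
  rw [lp.inner_eq_tsum, lp.inner_eq_tsum, ← (Equiv.mulLeft g⁻¹).tsum_eq]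
  refine tsum_congr fun x => ?_
  simp [leftReg_apply]

theorem leftRegAlg_adj (q : MonoidAlgebra ℂ Γ) :
    leftRegAlg (adj q) = ContinuousLinearMap.adjoint (leftRegAlg q) := by
  rw [← leftRegAlgHom_apply, adj, map_sum, leftRegAlg, map_sum]
  refine Finset.sum_congr rfl fun g _ => ?_
  rw [leftRegAlgHom_single, map_smulₛₗ, adjoint_leftReg]
  rfl

theorem isSelfAdjoint_leftRegAlg {p : MonoidAlgebra ℂ Γ} (hp : IsSelfAdj p) :
    IsSelfAdjoint (leftRegAlg p) := by
  rw [ContinuousLinearMap.isSelfAdjoint_iff', ← leftRegAlg_adj, adj_eq_self hp]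

open Classical in
/-- The basis vector `δ_x`. -/
def delta (x : Γ) : Ell2 Γ := lp.single 2 x (1 : ℂ)

theorem norm_delta (x : Γ) : ‖delta x‖ = 1 := by
  simp [delta]

open Classical in
theorem delta_apply (x y : Γ) : delta x y = if y = x then 1 else 0 := by
  rw [delta, lp.single_apply, Pi.single_apply]

theorem entry_eq (Q : Ell2 Γ →L[ℂ] Ell2 Γ) (x y : Γ) : entry Q x y = Q (delta y) x := by
  classical
  rw [entry, lp.inner_single_left]
  simp [delta]

theorem leftReg_delta_one (g : Γ) : leftReg g (delta 1) = delta g := by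
  ext x
  rw [leftReg_apply, delta_apply, delta_apply]
  by_cases h : x = g
  · rw [if_pos h, if_pos (inv_mul_eq_one.2 h.symm)]
  · rw [if_neg h, if_neg fun h' => h (inv_mul_eq_one.1 h').symm]

theorem leftRegAlg_delta_one (q : MonoidAlgebra ℂ Γ) (g : Γ) :
    leftRegAlg q (delta 1) g = q.coeff g := by
  classical
  have : leftRegAlg q (delta 1) = ∑ h ∈ q.coeff.support, q.coeff h • delta h := by
    simp [leftRegAlg, leftReg_delta_one]
  rw [this, lp.coeFn_sum, Finset.sum_apply]
  simp only [lp.coeFn_smul, Pi.smul_apply, delta_apply, smul_eq_mul, mul_ite, mul_one, mul_zero,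
    Finset.sum_ite_eq, Finsupp.mem_support_iff]
  by_cases h : q.coeff g = 0 <;> simp [h]

theorem sum_norm_sq_le (f : Ell2 Γ) (s : Finset Γ) : ∑ g ∈ s, ‖f g‖ ^ 2 ≤ ‖f‖ ^ 2 := by
  have := lp.sum_rpow_le_norm_rpow (p := 2) (by simp) f s
  simpa using this

/-- The coordinates of `λ(q) δ_1`, the image of a unit vector, are the coefficients of `q`. -/
theorem l2Norm_le_norm_leftRegAlg (q : MonoidAlgebra ℂ Γ) : l2Norm q ≤ ‖leftRegAlg q‖ := by
  refine Real.sqrt_le_iff.2 ⟨norm_nonneg _, ?_⟩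
  have h := sum_norm_sq_le (leftRegAlg q (delta 1)) q.coeff.support
  simp only [leftRegAlg_delta_one] at h
  refine h.trans ?_
  gcongr
  simpa [norm_delta] using (leftRegAlg q).le_opNorm (delta 1)

theorem norm_coeff_le_norm_leftRegAlg (q : MonoidAlgebra ℂ Γ) (g : Γ) :
    ‖q.coeff g‖ ≤ ‖leftRegAlg q‖ := by
  rw [← leftRegAlg_delta_one]
  refine (lp.norm_apply_le_norm (by simp) _ g).trans ?_
  simpa [norm_delta] using (leftRegAlg q).le_opNorm (delta 1)

end LeftRegular

/-! ### Polynomial approximation of the Poisson kernel -/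

section Approximation

open Polynomial

/-- The Poisson kernel `η Im (x - E - iη)⁻¹`. -/
def poisson (E η x : ℝ) : ℝ := η ^ 2 / ((x - E) ^ 2 + η ^ 2)

theorem poisson_nonneg (E η x : ℝ) : 0 ≤ poisson E η x := by
  unfold poisson; positivity

theorem poisson_le_one {η : ℝ} (hη : 0 < η) (E x : ℝ) : poisson E η x ≤ 1 := by
  unfold poisson
  rw [div_le_one (by positivity)]
  nlinarith [sq_nonneg (x - E)]

/-- Since `T_n(cosh t) = cosh(n t)`, it is enough that `arcosh(1 + 2δ²) ≥ δ`. This holds because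
`exp(arcosh x) = x + √(x² - 1)`, which here is at least `1 + 2δ + 2δ²`, while `e^δ ≤ 1 + δ + δ²`. -/
theorem exp_le_two_mul_eval_T {δ : ℝ} (h0 : 0 < δ) (h1 : δ ≤ 1) (n : ℕ) :
    Real.exp (δ * n) ≤ 2 * (Chebyshev.T ℝ n).eval (1 + 2 * δ ^ 2) := by
  have hx : (1 : ℝ) ≤ 1 + 2 * δ ^ 2 := by nlinarith
  rw [← Real.cosh_arcosh hx, Chebyshev.T_real_cosh, Real.cosh_eq]
  have h2 : Real.exp δ ≤ Real.exp (Real.arcosh (1 + 2 * δ ^ 2)) := by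
    rw [Real.exp_arcosh hx]
    have h3 : 2 * δ ≤ √((1 + 2 * δ ^ 2) ^ 2 - 1) := by
      apply Real.le_sqrt_of_sq_le
      nlinarith [sq_nonneg (δ ^ 2)]
    have h4 := Real.abs_exp_sub_one_sub_id_le (x := δ) (by rwa [abs_of_pos h0])
    have h5 := (abs_le.1 h4).2
    nlinarith
  have h6 : Real.exp (δ * n) ≤ Real.exp (n * Real.arcosh (1 + 2 * δ ^ 2)) := by
    rw [mul_comm δ, Real.exp_le_exp]
    exact mul_le_mul_of_nonneg_left (Real.exp_le_exp.1 h2) (by positivity)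
  have h7 := Real.exp_pos (-((n : ℝ) * Real.arcosh (1 + 2 * δ ^ 2)))
  push_cast
  linarith

/-- In the variable `u = (x - E)² / M²` the kernel is `δ² / (u + δ²)`, with its pole at `u = -δ²`.
The factor `1 - T_n(1 - 2u) / T_n(1 + 2δ²)` cancels this pole and is exponentially close to `1` on
`[0, 1]`. -/
theorem exists_poisson_approx {M η : ℝ} (hη : 0 < η) (hηM : η ≤ M) (E : ℝ) (n : ℕ) :
    ∃ h : ℝ[X], h.natDegree ≤ 2 * n ∧ ∀ x, |x - E| ≤ M →
      poisson E η x ≤ h.eval x ∧ h.eval x ≤ poisson E η x + 4 * Real.exp (-(η / M * n)) := by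
  have hM : 0 < M := hη.trans_le hηM
  set δ : ℝ := η / M with hδ
  have hδ0 : 0 < δ := by positivity
  have hδ1 : δ ≤ 1 := by rw [hδ, div_le_one hM]; exact hηM
  set τ : ℝ := (Chebyshev.T ℝ n).eval (1 + 2 * δ ^ 2) with hτ
  have hτe : Real.exp (δ * n) ≤ 2 * τ := exp_le_two_mul_eval_T hδ0 hδ1 n
  have hτ1 : 1 ≤ τ := Chebyshev.one_le_eval_T_real n (by nlinarith)
  set r : ℝ[X] := C τ - (Chebyshev.T ℝ n).comp (1 - C 2 * X) with hr
  have hdvd : X - C (-δ ^ 2) ∣ r := by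
    rw [dvd_iff_isRoot, IsRoot, hr]
    simp only [eval_sub, eval_C, eval_comp, eval_one, eval_mul, eval_X]
    rw [hτ]
    ring_nf
  obtain ⟨s, hs⟩ := hdvd
  have hlin : (1 - C 2 * X : ℝ[X]).natDegree ≤ 1 := by compute_degree
  have hrdeg : r.natDegree ≤ n := by
    refine (natDegree_sub_le _ _).trans (max_le (by simp) ?_)
    rw [natDegree_comp, Chebyshev.natDegree_T]
    simpa using Nat.mul_le_mul_left n hlin
  have hsdeg : s.natDegree ≤ n := by
    by_cases hs0 : s = 0
    · simp [hs0]
    · rw [hs, natDegree_mul (X_sub_C_ne_zero _) hs0, natDegree_X_sub_C] at hrdeg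
      lia
  -- Writing `f` for the kernel and `t = T_n(1 - 2u)`, the value is `f + τ⁻¹ (1 - t f)`. The added
  -- constant `τ⁻¹` makes the correction nonnegative, as `|t| ≤ 1` and `0 ≤ f ≤ 1`.
  refine ⟨C (δ ^ 2 / τ) * s.comp (C (M ^ 2)⁻¹ * (X - C E) ^ 2) + C τ⁻¹, ?_, fun x hx => ?_⟩
  · have hquad : (C (M ^ 2)⁻¹ * (X - C E) ^ 2 : ℝ[X]).natDegree ≤ 2 := by compute_degree
    refine (natDegree_add_C).le.trans ((natDegree_C_mul_le _ _).trans ?_)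
    rw [natDegree_comp, mul_comm]
    exact Nat.mul_le_mul hquad hsdeg
  · set u : ℝ := (M ^ 2)⁻¹ * (x - E) ^ 2 with hu
    have hu0 : 0 ≤ u := by positivity
    have hu1 : u ≤ 1 := by
      rw [hu, inv_mul_le_iff₀ (by positivity), mul_one]
      exact sq_le_sq' (by linarith [(abs_le.1 hx).1]) (abs_le.1 hx).2
    have heval : (u + δ ^ 2) * s.eval u = τ - (Chebyshev.T ℝ n).eval (1 - 2 * u) := by
      have := congrArg (eval u) hs
      simp only [hr, eval_sub, eval_C, eval_comp, eval_one, eval_mul, eval_X] at this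
      rw [this]; ring
    have hf : poisson E η x = δ ^ 2 / (u + δ ^ 2) := by
      rw [poisson, hδ, hu]
      field_simp
    have hT := abs_le.1 (Chebyshev.abs_eval_T_real_le_one n (x := 1 - 2 * u)
      (abs_le.2 ⟨by linarith, by linarith⟩))
    set t := (Chebyshev.T ℝ n).eval (1 - 2 * u)
    have hval : eval x (C (δ ^ 2 / τ) * s.comp (C (M ^ 2)⁻¹ * (X - C E) ^ 2) + C τ⁻¹) =
        poisson E η x + τ⁻¹ * (1 - t * poisson E η x) := by
      simp only [eval_add, eval_mul, eval_C, eval_comp, eval_pow, eval_sub, eval_X]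
      rw [← hu, hf]
      have : s.eval u = (τ - t) / (u + δ ^ 2) := by
        rw [eq_div_iff (by positivity), ← heval, mul_comm]
      rw [this]
      field_simp
      ring
    have hf0 := poisson_nonneg E η x
    have hf1 := poisson_le_one hη E x
    rw [hval]
    have hτi : 0 < τ⁻¹ := by positivity
    have hτ2 : τ⁻¹ ≤ 2 * Real.exp (-(δ * n)) := by
      rw [Real.exp_neg, inv_le_iff_one_le_mul₀ (by positivity)]
      field_simp
      linarith
    have h1 : 0 ≤ 1 - t * poisson E η x := by nlinarith
    have h2 : 1 - t * poisson E η x ≤ 2 := by nlinarith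
    constructor
    · nlinarith
    · nlinarith

end Approximation

/-! ### The resolvent and the functional calculus -/

section Resolvent

variable {Γ : Type*} [Group Γ]

theorem ringInverse_eq_of_mul_eq_one {R : Type*} [Ring R] {a b : R} (h : a * b = 1)
    (h' : b * a = 1) : Ring.inverse a = b :=
  Ring.inverse_unit ⟨a, b, h, h'⟩

theorem continuous_poisson (E : ℝ) {η : ℝ} (hη : 0 < η) : Continuous (poisson E η) := by
  unfold poisson
  refine Continuous.div (by fun_prop) (by fun_prop) fun x => by positivity

/-- With `G = ((A - E)² + η²)⁻¹` and `w` the conjugate of `z`, the inverse of `A - z` is `(A - w) G`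
and its adjoint is `(A - z) G`; their difference is `(z - w) G = 2iη G`. -/
theorem smul_im_inverse_eq_cfc {H : Type*} [NormedAddCommGroup H] [InnerProductSpace ℂ H]
    [CompleteSpace H] {A : H →L[ℂ] H} (hsa : IsSelfAdjoint A) (E : ℝ) {η : ℝ} (hη : 0 < η) :
    (η : ℂ) • (2 * Complex.I)⁻¹ • (Ring.inverse (A - (E + η * Complex.I : ℂ) • (1 : H →L[ℂ] H)) -
      ContinuousLinearMap.adjoint
        (Ring.inverse (A - (E + η * Complex.I : ℂ) • (1 : H →L[ℂ] H)))) =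
      cfc (poisson E η) A := by
  set z : ℂ := E + η * Complex.I with hz
  set w : ℂ := E - η * Complex.I with hw
  set k : ℝ → ℝ := fun x => ((x - E) ^ 2 + η ^ 2)⁻¹ with hk
  have hkc : Continuous k := by
    refine Continuous.inv₀ (by fun_prop) fun x => by positivity
  set G := cfc k A with hG
  have hGsa : star G = G := (cfc_predicate k A : IsSelfAdjoint G).star_eq
  have hcomm : A * G = G * A := by
    have := (cfc_commute_cfc (fun x : ℝ => x) k A).eq
    rwa [cfc_id' ℝ A] at this
  have hmul : ∀ u v : ℂ, (A - u • 1) * (A - v • 1) = A * A - (u + v) • A + (u * v) • 1 := by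
    intro u v
    simp only [sub_mul, mul_sub, smul_mul_assoc, one_mul, mul_smul_comm, mul_one]
    module
  have hquad : cfc (fun x : ℝ => (x - E) ^ 2 + η ^ 2) A = (A - z • 1) * (A - w • 1) := by
    have h1 : (fun x : ℝ => (x - E) ^ 2 + η ^ 2) =
        ((Polynomial.X - Polynomial.C E) ^ 2 + Polynomial.C (η ^ 2)).eval := by
      funext x; simp
    rw [h1, cfc_polynomial _ A, hmul]
    have h2 : z + w = ((2 * E : ℝ) : ℂ) := by rw [hz, hw]; push_cast; ring
    have h3 : z * w = ((E ^ 2 + η ^ 2 : ℝ) : ℂ) := by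
      rw [hz, hw]; push_cast; ring_nf; rw [Complex.I_sq]; ring
    rw [h2, h3, Complex.coe_smul, Complex.coe_smul]
    simp only [map_add, map_pow, map_sub, Polynomial.aeval_X, Polynomial.aeval_C,
      Algebra.algebraMap_eq_smul_one]
    simp only [pow_two, sub_mul, mul_sub, smul_mul_assoc, one_mul, mul_smul_comm, mul_one]
    module
  have h1 : (A - z • 1) * (A - w • 1) * G = 1 := by
    rw [← hquad, hG, ← cfc_mul (fun x : ℝ => (x - E) ^ 2 + η ^ 2) k A (by fun_prop) hkc.continuousOn]
    rw [← cfc_one ℝ A]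
    refine cfc_congr fun x _ => ?_
    simp only [hk]
    rw [mul_inv_cancel₀ (by positivity)]
    rfl
  have hGc : ∀ v : ℂ, (A - v • 1) * G = G * (A - v • 1) := fun v => by
    rw [sub_mul, mul_sub, hcomm]; simp
  have hzw : (A - z • 1) * (A - w • 1) = (A - w • 1) * (A - z • 1) := by
    rw [hmul, hmul, add_comm z, mul_comm z]
  have hR : Ring.inverse (A - z • 1) = (A - w • 1) * G := by
    refine ringInverse_eq_of_mul_eq_one (by rw [← mul_assoc]; exact h1) ?_
    rw [mul_assoc, ← hGc z, ← mul_assoc, ← hzw, h1]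
  have hstar : ContinuousLinearMap.adjoint (Ring.inverse (A - z • 1)) = (A - z • 1) * G := by
    rw [← ContinuousLinearMap.star_eq_adjoint, hR, star_mul, hGsa, star_sub, hsa.star_eq,
      star_smul, star_one, hGc]
    congr 3
    simp [hw, hz]
  rw [hstar, hR, ← sub_mul, sub_sub_sub_cancel_left, ← sub_smul]
  have h2 : cfc (poisson E η) A = ((η : ℂ) * η) • G := by
    have : poisson E η = fun x => η ^ 2 * k x := by
      funext x; simp only [poisson, hk, div_eq_mul_inv]
    rw [this, cfc_const_mul (η ^ 2) k A hkc.continuousOn, ← Complex.coe_smul, pow_two,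
      Complex.ofReal_mul]
  rw [h2, smul_mul_assoc, one_mul, smul_smul, smul_smul]
  congr 1
  rw [hz, hw]
  field_simp
  ring

theorem norm_aeval_sub_im_inverse_le {H : Type*} [NormedAddCommGroup H] [InnerProductSpace ℂ H]
    [CompleteSpace H] {A : H →L[ℂ] H} (hsa : IsSelfAdjoint A) {M E η ε : ℝ} (hM : ‖A‖ ≤ M)
    (hη : 0 < η) (hε : 0 ≤ ε) {h : Polynomial ℝ}
    (hh : ∀ x, |x| ≤ M → |h.eval x - poisson E η x| ≤ ε) :
    ‖Polynomial.aeval A h - (η : ℂ) • (2 * Complex.I)⁻¹ •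
      (Ring.inverse (A - (E + η * Complex.I : ℂ) • (1 : H →L[ℂ] H)) -
      ContinuousLinearMap.adjoint
        (Ring.inverse (A - (E + η * Complex.I : ℂ) • (1 : H →L[ℂ] H))))‖ ≤ ε := by
  rw [smul_im_inverse_eq_cfc hsa E hη, ← cfc_polynomial h A,
    ← cfc_sub _ _ A (h.continuous.continuousOn) (continuous_poisson E hη).continuousOn]
  exact norm_cfc_le hε fun x hx => hh x ((IsometricContinuousFunctionalCalculus.norm_spectrum_le A hx hsa).trans hM)

theorem norm_aeval_le {H : Type*} [NormedAddCommGroup H] [InnerProductSpace ℂ H]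
    [CompleteSpace H] {A : H →L[ℂ] H} (hsa : IsSelfAdjoint A) {M ε : ℝ} (hM : ‖A‖ ≤ M)
    (hε : 0 ≤ ε) {h : Polynomial ℝ} (hh : ∀ x, |x| ≤ M → |h.eval x| ≤ ε) :
    ‖Polynomial.aeval A h‖ ≤ ε := by
  rw [← cfc_polynomial h A]
  exact norm_cfc_le hε fun x hx => hh x ((IsometricContinuousFunctionalCalculus.norm_spectrum_le A hx hsa).trans hM)

variable (Γ) in
/-- The value `h(p)` of a real polynomial `h` at an element `p` of the group algebra. -/
def polyAlg (p : MonoidAlgebra ℂ Γ) (h : Polynomial ℝ) : MonoidAlgebra ℂ Γ := Polynomial.aeval p h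

theorem leftRegAlg_polyAlg (p : MonoidAlgebra ℂ Γ) (h : Polynomial ℝ) :
    leftRegAlg (polyAlg Γ p h) = Polynomial.aeval (leftRegAlg p) h := by
  rw [← leftRegAlgHom_apply, ← leftRegAlgHom_apply, polyAlg]
  exact ((Polynomial.aeval_algHom_apply ((leftRegAlgHom Γ).restrictScalars ℝ) p h)).symm

theorem norm_leftRegAlg_polyAlg_sub_le {p : MonoidAlgebra ℂ Γ} (hp : IsSelfAdj p) {E η ε : ℝ}
    (hη : 0 < η) (hε : 0 ≤ ε) {h : Polynomial ℝ}
    (hh : ∀ x, |x| ≤ l1Norm p → |h.eval x - poisson E η x| ≤ ε) :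
    ‖leftRegAlg (polyAlg Γ p h) - (η : ℂ) • imResolvent p (E + η * Complex.I)‖ ≤ ε := by
  rw [leftRegAlg_polyAlg]
  exact norm_aeval_sub_im_inverse_le (isSelfAdjoint_leftRegAlg hp) (norm_leftRegAlg_le p) hη hε hh

theorem norm_leftRegAlg_polyAlg_le {p : MonoidAlgebra ℂ Γ} (hp : IsSelfAdj p) {ε : ℝ}
    (hε : 0 ≤ ε) {h : Polynomial ℝ} (hh : ∀ x, |x| ≤ l1Norm p → |h.eval x| ≤ ε) :
    ‖leftRegAlg (polyAlg Γ p h)‖ ≤ ε := by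
  rw [leftRegAlg_polyAlg]
  exact norm_aeval_le (isSelfAdjoint_leftRegAlg hp) (norm_leftRegAlg_le p) hε hh

theorem norm_entry_imResolvent_comm (p : MonoidAlgebra ℂ Γ) (z : ℂ) (x y : Γ) :
    ‖entry (imResolvent p z) x y‖ = ‖entry (imResolvent p z) y x‖ := by
  have h : ContinuousLinearMap.adjoint (imResolvent p z) = imResolvent p z := by
    rw [imResolvent, map_smulₛₗ, map_sub, ContinuousLinearMap.adjoint_adjoint]
    rw [← neg_sub, smul_neg, ← neg_smul]
    congr 1
    simp [Complex.conj_ofNat]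
  rw [entry, entry, ← ContinuousLinearMap.adjoint_inner_left, h, norm_inner_symm]

end Resolvent

/-! ### Supports of polynomials in the group algebra -/

section Support

variable {Γ : Type*} [Group Γ]

open scoped Pointwise

/-- Adjoining `1` to the support of `p` makes the powers of this set increase, so that its `n`-th
power contains the supports of all monomials of degree at most `n`. -/
theorem exists_support_polyAlg (S : Finset Γ) (hS : Subgroup.closure (S : Set Γ) = ⊤)
    (p : MonoidAlgebra ℂ Γ) :
    ∃ L B : ℕ, 1 ≤ L ∧ 1 ≤ B ∧ ∀ (n : ℕ) (h : Polynomial ℝ), h.natDegree ≤ n →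
      (polyAlg Γ p h).coeff.support.card ≤ B ^ n ∧
      ∀ g ∈ (polyAlg Γ p h).coeff.support, wordLength S g ≤ L * n := by
  classical
  set s : Finset Γ := insert 1 p.coeff.support with hs
  have h1s : (1 : Γ) ∈ s := by simp [hs]
  have hpow : ∀ n, (p ^ n).coeff.support ⊆ s ^ n := by
    intro n
    induction n with
    | zero =>
      rw [pow_zero, pow_zero, MonoidAlgebra.one_def, MonoidAlgebra.coeff_single]
      exact Finsupp.support_single_subset
    | succ n ih =>
      rw [pow_succ, pow_succ]
      refine (MonoidAlgebra.support_coeff_mul_subset _ _).trans (Finset.mul_subset_mul ih ?_)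
      exact Finset.subset_insert _ _
  have hpoly : ∀ (n : ℕ) (h : Polynomial ℝ), h.natDegree ≤ n →
      (polyAlg Γ p h).coeff.support ⊆ s ^ n := by
    intro n h hn
    rw [polyAlg, Polynomial.aeval_eq_sum_range, MonoidAlgebra.coeff_sum]
    refine (Finsupp.support_finsetSum).trans ?_
    intro g hg
    obtain ⟨k, hk, hg⟩ := Finset.mem_biUnion.1 hg
    have hkn : k ≤ n := by
      have := Finset.mem_range.1 hk
      lia
    refine Finset.pow_subset_pow_right h1s hkn (hpow k ?_)
    rw [Finsupp.mem_support_iff] at hg ⊢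
    intro h0
    apply hg
    rw [MonoidAlgebra.coeff_smul_apply, h0, smul_zero]
  have hlen : ∀ n, ∀ g ∈ s ^ n, wordLength S g ≤ (1 + s.sup (wordLength S)) * n := by
    intro n
    induction n with
    | zero => intro g hg; simp at hg; simp [hg]
    | succ n ih =>
      intro g hg
      rw [pow_succ] at hg
      obtain ⟨a, ha, b, hb, rfl⟩ := Finset.mem_mul.1 hg
      have h1 := wordLength_mul_le hS a b
      have h2 := ih a ha
      have h3 : wordLength S b ≤ s.sup (wordLength S) := Finset.le_sup hb
      rw [mul_add]
      lia
  refine ⟨1 + s.sup (wordLength S), s.card, by lia, Finset.card_pos.2 ⟨1, h1s⟩,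
    fun n h hn => ⟨?_, fun g hg => hlen n g (hpoly n h hn hg)⟩⟩
  exact (Finset.card_le_card (hpoly n h hn)).trans Finset.card_pow_le

end Support

/-! ### Rapid decay for weighted norms -/

section RapidDecay

variable {Γ : Type*} [Group Γ]

/-- Split `q` into its restrictions `q_k` to spheres. Rapid decay costs `(1 + k)^{C₁}` on each, and
Cauchy–Schwarz over `k` applies because `(1 + k)^{C₁ - κ/2}` is square summable exactly when `κ > 2
C₁ + 1`. -/
theorem exists_norm_leftRegAlg_le_weighted {S : Finset Γ}
    (hS : Subgroup.closure (S : Set Γ) = ⊤) {C₁ κ : ℝ} (hRD : HasRapidDecay Γ C₁)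
    (hκ : 2 * C₁ + 1 < κ) :
    ∃ C : ℝ, 0 < C ∧ ∀ q : MonoidAlgebra ℂ Γ, ‖leftRegAlg q‖ ≤
      C * √(∑ g ∈ q.coeff.support, (1 + wordLength S g : ℝ) ^ κ * ‖q.coeff g‖ ^ 2) := by
  classical
  obtain ⟨hC₁, S', hS', c, hc, hRD⟩ := hRD
  obtain ⟨L, hL, hlen⟩ := exists_wordLength_le_mul hS hS'
  have hsum : Summable fun k : ℕ => ((1 + k : ℝ) ^ (C₁ - κ / 2)) ^ 2 := by
    have h1 : Summable fun k : ℕ => ((k : ℝ)) ^ (2 * C₁ - κ) :=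
      Real.summable_nat_rpow.2 (by linarith)
    refine ((summable_nat_add_iff 1).2 h1).congr fun k => ?_
    rw [← Real.rpow_natCast, ← Real.rpow_mul (by positivity)]
    push_cast
    ring_nf
  set Z := ∑' k : ℕ, ((1 + k : ℝ) ^ (C₁ - κ / 2)) ^ 2 with hZ
  refine ⟨c * (2 * L : ℝ) ^ C₁ * √Z + 1, by positivity, fun q => ?_⟩
  set f : ℕ → Finset Γ := fun k => q.coeff.support.filter fun g => wordLength S g = k with hf
  set qk : ℕ → MonoidAlgebra ℂ Γ := fun k => ∑ g ∈ f k, MonoidAlgebra.single g (q.coeff g)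
    with hqk
  set R := q.coeff.support.sup (wordLength S) + 1 with hR
  have hmaps : ∀ g ∈ q.coeff.support, wordLength S g ∈ Finset.range R := fun g hg => by
    rw [Finset.mem_range, hR, Nat.lt_succ_iff]
    exact Finset.le_sup hg
  have hq : q = ∑ k ∈ Finset.range R, qk k := by
    conv_lhs => rw [← sum_single_coeff q]
    exact (Finset.sum_fiberwise_of_maps_to hmaps _).symm
  have hcoeff : ∀ k g, (qk k).coeff g = if g ∈ f k then q.coeff g else 0 := by
    intro k g
    simp [hqk, MonoidAlgebra.coeff_sum, Finsupp.finsetSum_apply, Finsupp.single_apply]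
  have hsupp : ∀ k, (qk k).coeff.support = f k := by
    intro k
    ext g
    rw [Finsupp.mem_support_iff, hcoeff]
    by_cases h : g ∈ f k
    · have : q.coeff g ≠ 0 := by
        have := (Finset.mem_filter.1 h).1
        exact Finsupp.mem_support_iff.1 this
      simp [h, this]
    · simp [h]
  have hl2 : ∀ k, l2Norm (qk k) ^ 2 = ∑ g ∈ f k, ‖q.coeff g‖ ^ 2 := by
    intro k
    rw [l2Norm_sq, hsupp]
    exact Finset.sum_congr rfl fun g hg => by rw [hcoeff, if_pos hg]
  have hdiam : ∀ k, diamSupport S' (qk k) ≤ 2 * L * (1 + k) := by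
    intro k
    rw [diamSupport, hsupp]
    refine max_le (by nlinarith) (Finset.sup_le fun g hg => Finset.sup_le fun h hh => ?_)
    have h1 := hlen (g * h⁻¹)
    have h2 := wordLength_mul_le hS g h⁻¹
    rw [wordLength_inv hS, (Finset.mem_filter.1 hg).2, (Finset.mem_filter.1 hh).2] at h2
    refine h1.trans ((Nat.mul_le_mul_left L h2).trans ?_)
    nlinarith
  have hnorm : ∀ k, ‖leftRegAlg (qk k)‖ ≤ c * (2 * L : ℝ) ^ C₁ *
      ((1 + k : ℝ) ^ (C₁ - κ / 2) * ((1 + k : ℝ) ^ (κ / 2) * l2Norm (qk k))) := by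
    intro k
    refine (hRD (qk k)).trans (le_of_le_of_eq (b := c * (2 * L * (1 + k) : ℝ) ^ C₁ *
      l2Norm (qk k)) ?_ ?_)
    · have : (diamSupport S' (qk k) : ℝ) ≤ 2 * L * (1 + k) := by exact_mod_cast hdiam k
      have := l2Norm_nonneg (qk k)
      gcongr
    · rw [Real.mul_rpow (by positivity) (by positivity), ← mul_assoc ((1 + k : ℝ) ^ _),
        ← Real.rpow_add (by positivity)]
      ring_nf
  have h1 : ‖leftRegAlg q‖ ≤ c * (2 * L : ℝ) ^ C₁ * ∑ k ∈ Finset.range R,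
      (1 + k : ℝ) ^ (C₁ - κ / 2) * ((1 + k : ℝ) ^ (κ / 2) * l2Norm (qk k)) := by
    conv_lhs => rw [hq, ← leftRegAlgHom_apply, map_sum]
    rw [Finset.mul_sum]
    refine (norm_sum_le _ _).trans (Finset.sum_le_sum fun k _ => ?_)
    rw [leftRegAlgHom_apply]
    exact hnorm k
  have h2 : ∑ k ∈ Finset.range R, ((1 + k : ℝ) ^ (κ / 2) * l2Norm (qk k)) ^ 2 =
      ∑ g ∈ q.coeff.support, (1 + wordLength S g : ℝ) ^ κ * ‖q.coeff g‖ ^ 2 := by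
    rw [← Finset.sum_fiberwise_of_maps_to hmaps]
    refine Finset.sum_congr rfl fun k _ => ?_
    rw [mul_pow, hl2, Finset.mul_sum]
    refine Finset.sum_congr rfl fun g hg => ?_
    rw [(Finset.mem_filter.1 hg).2, ← Real.rpow_natCast, ← Real.rpow_mul (by positivity)]
    push_cast
    ring_nf
  refine h1.trans ?_
  have h3 := Real.sum_mul_le_sqrt_mul_sqrt (Finset.range R)
    (fun k : ℕ => (1 + k : ℝ) ^ (C₁ - κ / 2))
    (fun k : ℕ => (1 + k : ℝ) ^ (κ / 2) * l2Norm (qk k))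
  rw [h2] at h3
  have h4 : √(∑ k ∈ Finset.range R, ((1 + k : ℝ) ^ (C₁ - κ / 2)) ^ 2) ≤ √Z :=
    Real.sqrt_le_sqrt (hsum.sum_le_tsum _ fun _ _ => by positivity)
  set W := √(∑ g ∈ q.coeff.support, (1 + wordLength S g : ℝ) ^ κ * ‖q.coeff g‖ ^ 2)
  have hW : 0 ≤ W := Real.sqrt_nonneg _
  calc _ ≤ c * (2 * L : ℝ) ^ C₁ * (√Z * W) := by
        gcongr
        exact h3.trans (by gcongr)
    _ ≤ _ := by nlinarith

end RapidDecay

/-! ### Polynomial approximants of the Poisson kernel of `p` -/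

section Approximants

variable {Γ : Type*} [Group Γ]

theorem adjoint_imResolvent (p : MonoidAlgebra ℂ Γ) (z : ℂ) :
    ContinuousLinearMap.adjoint (imResolvent p z) = imResolvent p z := by
  rw [imResolvent, map_smulₛₗ, map_sub, ContinuousLinearMap.adjoint_adjoint,
    ← neg_sub, smul_neg, ← neg_smul]
  congr 1
  simp [Complex.conj_ofNat]

theorem entry_imResolvent_self_im (p : MonoidAlgebra ℂ Γ) (z : ℂ) (x : Γ) :
    (entry (imResolvent p z) x x).im = 0 := by
  rw [← Complex.conj_eq_iff_im, entry, inner_conj_symm, ← ContinuousLinearMap.adjoint_inner_right,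
    adjoint_imResolvent]

theorem norm_entry_imResolvent_self (p : MonoidAlgebra ℂ Γ) (z : ℂ) (x : Γ) :
    ‖entry (imResolvent p z) x x‖ = |(entry (imResolvent p z) x x).re| := by
  conv_lhs => rw [← Complex.re_add_im (entry (imResolvent p z) x x), entry_imResolvent_self_im]
  simp

theorem sub_smul_apply_delta_one (q : MonoidAlgebra ℂ Γ) (z : ℂ) (Q : Ell2 Γ →L[ℂ] Ell2 Γ)
    (g : Γ) : (leftRegAlg q - z • Q) (delta 1) g = q.coeff g - z * entry Q g 1 := by
  rw [← leftRegAlg_delta_one, entry_eq]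
  rfl

theorem add_pow_four_le (a b : ℝ) : (a + b) ^ 4 ≤ 8 * (a ^ 4 + b ^ 4) := by
  nlinarith [sq_nonneg (a - b), sq_nonneg (a + b), sq_nonneg (a ^ 2 - b ^ 2),
    sq_nonneg (a * (a - b)), sq_nonneg (b * (a - b)), mul_nonneg (sq_nonneg (a - b))
      (sq_nonneg (a + b)), sq_nonneg ((a - b) ^ 2)]

/-- The coefficients of `q` are those of `η Im R` plus the coordinates of a vector of norm at most
`ε`. The former contribute `η² · η^{1+γ}` by the fourth moment hypothesis; for the latter the weight
is bounded crudely by its value at the radius `R` of the support. -/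
theorem sum_weighted_pow_four_le {S : Finset Γ} (hS : Subgroup.closure (S : Set Γ) = ⊤)
    {p : MonoidAlgebra ℂ Γ} {c d C₀ a₁ a₂ κ γ CM : ℝ} (hκ : 0 < κ) (hC₀ : 1 ≤ C₀)
    (hAC : DiagonalBound p c d C₀) (hca : c < a₁) (had : a₂ < d) (hγ₁ : γ ≤ 1) (hCM : 0 < CM)
    (hmom : FourthMomentBound S p a₁ a₂ κ γ CM) {E η ε R : ℝ} (hE : E ∈ Set.Icc a₁ a₂)
    (hη : 0 < η) (hη₁ : η ≤ 1) (hR : (1 + R) ^ κ * ε ^ 4 ≤ η ^ 4) {q : MonoidAlgebra ℂ Γ}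
    (hq : ‖leftRegAlg q - (η : ℂ) • imResolvent p (E + η * Complex.I)‖ ≤ ε)
    (hsupp : ∀ g ∈ q.coeff.support, (wordLength S g : ℝ) ≤ R) :
    ∑ g ∈ q.coeff.support, (1 + wordLength S g : ℝ) ^ κ * ‖q.coeff g‖ ^ 4 ≤
      8 * (C₀ ^ 4 + 2 ^ κ * CM + 1) * η ^ (3 + γ) := by
  classical
  set Q := imResolvent p (E + η * Complex.I) with hQ
  set D := leftRegAlg q - (η : ℂ) • Q with hD
  set d : Γ → ℝ := fun g => ‖D (delta 1) g‖ with hd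
  have hε : 0 ≤ ε := (norm_nonneg _).trans hq
  have hDn : ‖D (delta 1)‖ ≤ ε := by
    have := D.le_opNorm (delta 1)
    rw [norm_delta, mul_one] at this
    exact this.trans hq
  have hd2 : ∀ s : Finset Γ, ∑ g ∈ s, d g ^ 2 ≤ ε ^ 2 := fun s =>
    (sum_norm_sq_le _ s).trans (by gcongr)
  have hdε : ∀ g, d g ≤ ε := fun g => (lp.norm_apply_le_norm (by simp) _ g).trans hDn
  have hcoeff : ∀ g, ‖q.coeff g‖ ≤ η * ‖entry Q 1 g‖ + d g := by
    intro g
    have h1 : q.coeff g = (η : ℂ) * entry Q g 1 + D (delta 1) g := by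
      rw [hD, sub_smul_apply_delta_one]
      ring
    rw [h1, norm_entry_imResolvent_comm]
    refine (norm_add_le _ _).trans ?_
    rw [norm_mul, Complex.norm_real, Real.norm_of_nonneg hη.le]
  have hE' : E ∈ Set.Icc c _ := ⟨hca.le.trans hE.1, hE.2.trans had.le⟩
  have h11 := hAC E hE' η hη hη₁
  rw [← hQ] at h11
  have he1 : ‖entry Q 1 1‖ ≤ C₀ := by
    rw [hQ, norm_entry_imResolvent_self, ← hQ, abs_of_nonneg]
    · exact h11.2
    · exact le_trans (by positivity) h11.1
  obtain ⟨hsumm, hle⟩ := hmom E hE η hη hη₁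
  rw [← hQ] at hsumm hle
  have hpt : ∀ g ∈ q.coeff.support, (1 + wordLength S g : ℝ) ^ κ * ‖q.coeff g‖ ^ 4 ≤
      8 * ((if g = 1 then η ^ 4 * C₀ ^ 4 else 0) +
        2 ^ κ * η ^ 2 * (η ^ 2 * (wordLength S g : ℝ) ^ κ * ‖entry Q 1 g‖ ^ 4) +
        (1 + R) ^ κ * ε ^ 2 * d g ^ 2) := by
    intro g hg
    have h1 : ‖q.coeff g‖ ^ 4 ≤ 8 * ((η * ‖entry Q 1 g‖) ^ 4 + d g ^ 4) :=
      (pow_le_pow_left₀ (norm_nonneg _) (hcoeff g) 4).trans (add_pow_four_le _ _)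
    have hR0 : 0 ≤ R := le_trans (by positivity) (hsupp g hg)
    have h2 : (1 + wordLength S g : ℝ) ^ κ ≤ (1 + R) ^ κ := by
      have := hsupp g hg
      gcongr
    have h3 : d g ^ 4 ≤ ε ^ 2 * d g ^ 2 := by
      have : d g ^ 2 ≤ ε ^ 2 := pow_le_pow_left₀ (norm_nonneg _) (hdε g) 2
      nlinarith [sq_nonneg (d g)]
    have h4 : (1 + wordLength S g : ℝ) ^ κ * d g ^ 4 ≤ (1 + R) ^ κ * (ε ^ 2 * d g ^ 2) := by
      gcongr
    -- The identity is set apart: the weight `|g|^κ` of the hypothesis vanishes there, and the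
    -- diagonal bound takes over. Elsewhere `1 + |g| ≤ 2|g|`.
    have h5 : (1 + wordLength S g : ℝ) ^ κ * (η * ‖entry Q 1 g‖) ^ 4 ≤
        (if g = 1 then η ^ 4 * C₀ ^ 4 else 0) +
        2 ^ κ * η ^ 2 * (η ^ 2 * (wordLength S g : ℝ) ^ κ * ‖entry Q 1 g‖ ^ 4) := by
      split_ifs with h
      · subst h
        have : (0 : ℝ) ^ κ = 0 := Real.zero_rpow hκ.ne'
        simp only [wordLength_one, Nat.cast_zero, add_zero, Real.one_rpow, one_mul, this, mul_zero,
          zero_mul, mul_pow]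
        gcongr
      · have h6 : (1 : ℝ) ≤ wordLength S g := by exact_mod_cast one_le_wordLength hS h
        have h7 : (1 + wordLength S g : ℝ) ^ κ ≤ 2 ^ κ * (wordLength S g : ℝ) ^ κ := by
          rw [← Real.mul_rpow (by norm_num) (by positivity)]
          gcongr
          linarith
        calc _ ≤ 2 ^ κ * (wordLength S g : ℝ) ^ κ * (η * ‖entry Q 1 g‖) ^ 4 := by gcongr
          _ = _ := by ring
    calc _ ≤ (1 + wordLength S g : ℝ) ^ κ * (8 * ((η * ‖entry Q 1 g‖) ^ 4 + d g ^ 4)) := by gcongr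
      _ = 8 * ((1 + wordLength S g : ℝ) ^ κ * (η * ‖entry Q 1 g‖) ^ 4 +
          (1 + wordLength S g : ℝ) ^ κ * d g ^ 4) := by ring
      _ ≤ _ := by linarith
  refine (Finset.sum_le_sum hpt).trans ?_
  rw [← Finset.mul_sum, Finset.sum_add_distrib, Finset.sum_add_distrib, ← Finset.mul_sum,
    ← Finset.mul_sum]
  have hη4 : η ^ 4 ≤ η ^ (3 + γ) := by
    rw [← Real.rpow_natCast]
    exact Real.rpow_le_rpow_of_exponent_ge hη hη₁ (by norm_num; linarith)
  have hs1 : ∑ g ∈ q.coeff.support, (if g = 1 then η ^ 4 * C₀ ^ 4 else 0) ≤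
      C₀ ^ 4 * η ^ (3 + γ) := by
    rw [Finset.sum_ite_eq']
    split_ifs
    · rw [mul_comm]; gcongr
    · positivity
  have hs2 : ∑ g ∈ q.coeff.support, η ^ 2 * (wordLength S g : ℝ) ^ κ * ‖entry Q 1 g‖ ^ 4 ≤
      CM * η ^ (1 + γ) :=
    (hsumm.sum_le_tsum _ fun _ _ => by positivity).trans hle
  have hs3 : 2 ^ κ * η ^ 2 * (CM * η ^ (1 + γ)) = 2 ^ κ * CM * η ^ (3 + γ) := by
    rw [show 3 + γ = (2 : ℕ) + (1 + γ) by push_cast; ring,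
      Real.rpow_add hη _ (1 + γ), Real.rpow_natCast]
    ring
  have hRnn : q.coeff.support.Nonempty → 0 ≤ R := fun ⟨g, hg⟩ =>
    le_trans (by positivity) (hsupp g hg)
  have hs4 : (1 + R) ^ κ * ε ^ 2 * ∑ g ∈ q.coeff.support, d g ^ 2 ≤ η ^ (3 + γ) := by
    rcases q.coeff.support.eq_empty_or_nonempty with h | h
    · rw [h, Finset.sum_empty, mul_zero]; positivity
    · have hR0 := hRnn h
      calc _ ≤ (1 + R) ^ κ * ε ^ 2 * ε ^ 2 := by gcongr; exact hd2 _
        _ = (1 + R) ^ κ * ε ^ 4 := by ring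
        _ ≤ _ := hR.trans hη4
  have hs5 : 2 ^ κ * η ^ 2 * ∑ g ∈ q.coeff.support,
      η ^ 2 * (wordLength S g : ℝ) ^ κ * ‖entry Q 1 g‖ ^ 4 ≤ 2 ^ κ * CM * η ^ (3 + γ) := by
    rw [← hs3]; gcongr
  linarith

/-- `h` is a polynomial approximation of degree `O(n)` of the Poisson kernel at energy `E` and
scale `η`, up to an error `θ η`, and the coefficients of `h(p)` obey the bounds
inherited from `η Im R^{E + iη}`. -/
structure IsApproximant (S : Finset Γ) (p : MonoidAlgebra ℂ Γ) (L B n : ℕ)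
    (C₀ κ γ CW θ E η : ℝ) (h : Polynomial ℝ) : Prop where
  poisson_le : ∀ x, |x| ≤ l1Norm p → poisson E η x ≤ h.eval x
  le_poisson : ∀ x, |x| ≤ l1Norm p → h.eval x ≤ poisson E η x + θ * η
  card_support : (polyAlg Γ p h).coeff.support.card ≤ B ^ n
  wordLength_le : ∀ g ∈ (polyAlg Γ p h).coeff.support, wordLength S g ≤ L * n
  norm_le : ‖leftRegAlg (polyAlg Γ p h)‖ ≤ 1 + θ
  moment : ∑ g ∈ (polyAlg Γ p h).coeff.support,
    (1 + wordLength S g : ℝ) ^ κ * ‖(polyAlg Γ p h).coeff g‖ ^ 4 ≤ CW * η ^ (3 + γ)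
  le_coeff_one : (C₀⁻¹ - θ) * η ≤ ((polyAlg Γ p h).coeff 1).re
  coeff_one_le : ((polyAlg Γ p h).coeff 1).re ≤ (C₀ + θ) * η

/-- Three of the factors `ε` are bounded by `4 n^{-2}`; the fourth keeps its `n^{-κ}`, which cancels
the weight. A spare factor `n` absorbs the constants. -/
theorem weight_mul_pow_four_le {κ Λ n ε η : ℝ} (hκ : 0 < κ) (hΛ : 1 ≤ Λ) (hn : 1 ≤ n)
    (hΛn : (2 * Λ) ^ κ * 256 ≤ n) (hε0 : 0 ≤ ε) (hε : ε ≤ 4 * n ^ (-(κ + 2)))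
    (hη : 1 / n ≤ η) : (1 + Λ * n) ^ κ * ε ^ 4 ≤ η ^ 4 := by
  have hn0 : 0 < n := by linarith
  have h1 : (1 + Λ * n) ^ κ ≤ (2 * Λ) ^ κ * n ^ κ := by
    rw [← Real.mul_rpow (by positivity) hn0.le]
    gcongr
    nlinarith
  have h6 : (1 / n : ℝ) ≤ 1 := by rw [div_le_one hn0]; exact hn
  have h7 : n ^ (-κ) ≤ 1 := Real.rpow_le_one_of_one_le_of_nonpos hn (by linarith)
  have h8 : n ^ (-(κ + 2)) = n ^ (-κ) * (1 / n) ^ 2 := by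
    rw [show -(κ + 2) = -κ + -2 by ring, Real.rpow_add hn0, Real.rpow_neg hn0.le 2, Real.rpow_two]
    field_simp
  rw [h8] at hε
  have hnκ : n ^ κ * n ^ (-κ) = 1 := by
    rw [← Real.rpow_add hn0]; simp
  have h3 : ε ^ 3 ≤ 64 * (1 / n) ^ 6 := by
    calc ε ^ 3 ≤ (4 * (1 * (1 / n) ^ 2)) ^ 3 := by
          gcongr
          exact hε.trans (by gcongr)
      _ = _ := by ring
  have h2 : ε ^ 4 ≤ 256 * n ^ (-κ) * (1 / n) ^ 5 := by
    calc ε ^ 4 = ε ^ 3 * ε := by ring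
      _ ≤ (64 * (1 / n) ^ 6) * (4 * (n ^ (-κ) * (1 / n) ^ 2)) := by gcongr
      _ = 256 * n ^ (-κ) * ((1 / n) ^ 5 * (1 / n) ^ 3) := by ring
      _ ≤ _ := by
        gcongr
        exact mul_le_of_le_one_right (by positivity) (pow_le_one₀ (by positivity) h6)
  calc (1 + Λ * n) ^ κ * ε ^ 4
      ≤ ((2 * Λ) ^ κ * n ^ κ) * (256 * n ^ (-κ) * (1 / n) ^ 5) := by gcongr
    _ = ((2 * Λ) ^ κ * 256) * (n ^ κ * n ^ (-κ)) * (1 / n) ^ 5 := by ring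
    _ ≤ n * 1 * (1 / n) ^ 5 := by
      rw [hnκ]; gcongr
    _ = (1 / n) ^ 4 := by field_simp
    _ ≤ η ^ 4 := by gcongr

theorem exists_isApproximant {S : Finset Γ} (hS : Subgroup.closure (S : Set Γ) = ⊤)
    {p : MonoidAlgebra ℂ Γ} (hp : IsSelfAdj p) {c d C₀ a₁ a₂ κ γ CM : ℝ} (hκ : 0 < κ)
    (hC₀ : 1 ≤ C₀)
    (hAC : DiagonalBound p c d C₀) (hca : c < a₁) (had : a₂ < d) (hγ₁ : γ ≤ 1) (hCM : 0 < CM)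
    (hmom : FourthMomentBound S p a₁ a₂ κ γ CM) {θ : ℝ} (hθ : 0 < θ) :
    ∃ L B n₀ : ℕ, ∃ A CW : ℝ, 1 ≤ L ∧ 1 ≤ B ∧ 3 ≤ n₀ ∧ 1 ≤ A ∧ 0 < CW ∧
      ∀ n : ℕ, n₀ ≤ n → ∀ η : ℝ, η ≤ 1 → A * Real.log n ≤ η * n → ∀ E ∈ Set.Icc a₁ a₂,
        ∃ h, IsApproximant S p L B n C₀ κ γ CW θ E η h := by
  obtain ⟨L, B, hL, hB, hsupp⟩ := exists_support_polyAlg S hS p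
  -- The radius of an interval about any `E ∈ [a₁, a₂]` containing `[-‖p‖₁, ‖p‖₁]`, where all the
  -- spectra lie; the summand `1` ensures `η ≤ M`.
  set M : ℝ := l1Norm p + |a₁| + |a₂| + 1 with hM
  have hM1 : 1 ≤ M := by
    have := l1Norm_nonneg p
    have := abs_nonneg a₁
    have := abs_nonneg a₂
    linarith
  -- The first summand yields `ε ≤ θ η`, the second is the requirement of `weight_mul_pow_four_le`.
  obtain ⟨n₁, hn₁⟩ := exists_nat_ge (4 / θ + (2 * (L * 2 : ℕ) : ℝ) ^ κ * 256)
  -- The approximants have degree `2n`, whence `L * 2` and `B ^ 2`; with `A = M (κ + 2)` the error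
  -- `4 e^{-ηn/M}` is at most `4 n^{-(κ+2)}`.
  refine ⟨L * 2, B ^ 2, max 3 n₁, M * (κ + 2), 8 * (C₀ ^ 4 + 2 ^ κ * CM + 1), by lia,
    Nat.one_le_pow _ _ hB, le_max_left _ _, by nlinarith, by positivity, ?_⟩
  intro n hn η hη1 hA E hE
  have hn3 : (3 : ℝ) ≤ n := by exact_mod_cast (le_max_left _ _).trans hn
  have hn1 : (n₁ : ℝ) ≤ n := by exact_mod_cast (le_max_right _ _).trans hn
  have hn0 : (0 : ℝ) < n := by linarith
  have hlog : 1 ≤ Real.log n := by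
    rw [Real.le_log_iff_exp_le hn0]
    exact Real.exp_one_lt_d9.le.trans (by linarith)
  have hηn : (1 : ℝ) / n ≤ η := by
    rw [div_le_iff₀ hn0]
    refine le_trans ?_ hA
    nlinarith [mul_le_mul hM1 (by linarith : (1 : ℝ) ≤ κ + 2) (by norm_num) (by linarith)]
  have hη : 0 < η := lt_of_lt_of_le (by positivity) hηn
  obtain ⟨h, hdeg, hh⟩ := exists_poisson_approx hη (hη1.trans hM1) E n
  set ε : ℝ := 4 * Real.exp (-(η / M * n)) with hε
  have hε0 : 0 ≤ ε := by positivity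
  have hεn : ε ≤ 4 * (n : ℝ) ^ (-(κ + 2)) := by
    rw [hε, Real.rpow_def_of_pos hn0]
    gcongr
    rw [mul_neg, neg_le_neg_iff, div_mul_eq_mul_div, le_div_iff₀ (by linarith)]
    linarith
  have hn1θ : 4 / θ ≤ n := le_trans (le_add_of_nonneg_right (by positivity)) (hn₁.trans hn1)
  have hn1L : (2 * (L * 2 : ℕ) : ℝ) ^ κ * 256 ≤ n :=
    le_trans (le_add_of_nonneg_left (by positivity)) (hn₁.trans hn1)
  have hn1' : (1 : ℝ) ≤ n := by linarith
  have hpow : (n : ℝ) ^ (-(κ + 2)) ≤ (n : ℝ) ^ (-2 : ℝ) :=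
    Real.rpow_le_rpow_of_exponent_le hn1' (by linarith)
  have hpow2 : (n : ℝ) ^ (-2 : ℝ) = (1 / n) * (1 / n) := by
    rw [Real.rpow_neg hn0.le, Real.rpow_two]
    field_simp
  have hεθ : ε ≤ θ * η := by
    rw [div_le_iff₀ hθ] at hn1θ
    calc ε ≤ 4 * ((1 / n) * (1 / n)) := by linarith
      _ = (4 / n) * (1 / n) := by ring
      _ ≤ θ * η := by
        gcongr
        rw [div_le_iff₀ hn0]; linarith
  have hx : ∀ x, |x| ≤ l1Norm p → |x - E| ≤ M := by
    intro x hx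
    have h1 := abs_sub x E
    have h2 : |E| ≤ |a₁| + |a₂| := by
      rcases abs_cases E with h | h <;> rcases abs_cases a₁ with h' | h' <;>
        rcases abs_cases a₂ with h'' | h'' <;> linarith [hE.1, hE.2]
    linarith
  have hle : ∀ x, |x| ≤ l1Norm p → h.eval x ≤ poisson E η x + ε := fun x hx' => (hh x (hx x hx')).2
  have hge : ∀ x, |x| ≤ l1Norm p → poisson E η x ≤ h.eval x := fun x hx' => (hh x (hx x hx')).1
  have hdiff : ‖leftRegAlg (polyAlg Γ p h) - (η : ℂ) • imResolvent p (E + η * Complex.I)‖ ≤ ε :=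
    norm_leftRegAlg_polyAlg_sub_le hp hη hε0 fun x hx' => by
      rw [abs_le]; constructor <;> linarith [hle x hx', hge x hx']
  have hword : ∀ g ∈ (polyAlg Γ p h).coeff.support, wordLength S g ≤ L * 2 * n := fun g hg => by
    rw [mul_assoc]; exact (hsupp _ h hdeg).2 g hg
  have hone : ((polyAlg Γ p h).coeff 1).re -
      η * (entry (imResolvent p (E + η * Complex.I)) 1 1).re ∈ Set.Icc (-ε) ε := by
    have h1 : (polyAlg Γ p h).coeff 1 - η * entry (imResolvent p (E + η * Complex.I)) 1 1 =
        (leftRegAlg (polyAlg Γ p h) - (η : ℂ) • imResolvent p (E + η * Complex.I)) (delta 1) 1 := by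
      rw [sub_smul_apply_delta_one]
    have h2 : ‖(polyAlg Γ p h).coeff 1 - η * entry (imResolvent p (E + η * Complex.I)) 1 1‖
        ≤ ε := by
      rw [h1]
      refine (lp.norm_apply_le_norm (by simp) _ _).trans ?_
      refine (ContinuousLinearMap.le_opNorm _ _).trans ?_
      rwa [norm_delta, mul_one]
    have h3 := (Complex.abs_re_le_norm _).trans h2
    rw [Complex.sub_re, Complex.re_ofReal_mul] at h3
    exact abs_le.1 h3
  have hE' : E ∈ Set.Icc c d := ⟨hca.le.trans hE.1, hE.2.trans had.le⟩
  have h11 := hAC E hE' η hη hη1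
  refine ⟨h, hge, fun x hx' => (hle x hx').trans (by linarith), ?_, hword, ?_, ?_, ?_, ?_⟩
  · rw [← pow_mul]; exact (hsupp _ h hdeg).1
  · refine norm_leftRegAlg_polyAlg_le hp (by linarith) fun x hx' => ?_
    have h1 := poisson_nonneg E η x
    have h2 := poisson_le_one hη E x
    have h3 : θ * η ≤ θ := by nlinarith
    rw [abs_le]; constructor <;> linarith [hle x hx', hge x hx']
  · refine sum_weighted_pow_four_le hS hκ hC₀ hAC hca had hγ₁ hCM hmom hE hη hη1 ?_ hdiff
      (R := (L * 2 * n : ℕ)) (fun g hg => by exact_mod_cast hword g hg)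
    have hL' : (1 : ℝ) ≤ (L * 2 : ℕ) := by exact_mod_cast (by lia : 1 ≤ L * 2)
    rw [Nat.cast_mul]
    exact weight_mul_pow_four_le hκ hL' hn1' hn1L hε0 hεn hηn
  · have := hone.1
    nlinarith [mul_le_mul_of_nonneg_left h11.1 hη.le]
  · have := hone.2
    nlinarith [mul_le_mul_of_nonneg_left h11.2 hη.le]

end Approximants

/-! ### Twisted pointwise products in the group algebra -/

section SchurProduct

variable {Γ : Type*} [Group Γ]

/-- The element with coefficients `k ↦ (q₁)_{k⁻¹} (q₂)_{g k g⁻¹}`. -/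
def schurTwist (g : Γ) (q₁ q₂ : MonoidAlgebra ℂ Γ) : MonoidAlgebra ℂ Γ :=
  ∑ k ∈ q₁.coeff.support, MonoidAlgebra.single k⁻¹ (q₁.coeff k * q₂.coeff (g * k⁻¹ * g⁻¹))

theorem coeff_schurTwist (g : Γ) (q₁ q₂ : MonoidAlgebra ℂ Γ) (k : Γ) :
    (schurTwist g q₁ q₂).coeff k = q₁.coeff k⁻¹ * q₂.coeff (g * k * g⁻¹) := by
  classical
  simp only [schurTwist, MonoidAlgebra.coeff_sum, MonoidAlgebra.coeff_single,
    Finsupp.finsetSum_apply, Finsupp.single_apply, inv_eq_iff_eq_inv, Finset.sum_ite_eq',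
    Finsupp.mem_support_iff]
  by_cases h : q₁.coeff k⁻¹ = 0 <;> simp [h]

theorem sum_comp_le_sum_support (q : MonoidAlgebra ℂ Γ) {e : Γ → Γ} (he : Function.Injective e)
    {F : Γ → ℝ} (hF : ∀ g, 0 ≤ F g) (hF' : ∀ g, q.coeff g = 0 → F g = 0) (s : Finset Γ) :
    ∑ k ∈ s, F (e k) ≤ ∑ g ∈ q.coeff.support, F g := by
  classical
  rw [← Finset.sum_image (s := s) (g := e) (f := F) he.injOn]
  rw [← Finset.sum_filter_add_sum_filter_not (s.image e) (fun g => q.coeff g = 0)]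
  rw [Finset.sum_eq_zero fun g hg => hF' g (Finset.mem_filter.1 hg).2, zero_add]
  refine Finset.sum_le_sum_of_subset_of_nonneg (fun g hg => ?_) fun g _ _ => hF g
  exact Finsupp.mem_support_iff.2 (Finset.mem_filter.1 hg).2

theorem conj_injective (g : Γ) : Function.Injective fun k : Γ => g * k * g⁻¹ := fun a b h => by
  simpa using h

/-- Cauchy–Schwarz gives a bound free of the size of the supports; the moment method raises it to
the power `2m`. -/
theorem l1Norm_schurTwist_le (g : Γ) (q₁ q₂ : MonoidAlgebra ℂ Γ) :
    l1Norm (schurTwist g q₁ q₂) ≤ l2Norm q₁ * l2Norm q₂ := by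
  set s := (schurTwist g q₁ q₂).coeff.support
  have h1 : l1Norm (schurTwist g q₁ q₂) = ∑ k ∈ s, ‖q₁.coeff k⁻¹‖ * ‖q₂.coeff (g * k * g⁻¹)‖ :=
    Finset.sum_congr rfl fun k _ => by rw [coeff_schurTwist, norm_mul]
  rw [h1, l2Norm, l2Norm]
  refine (Real.sum_mul_le_sqrt_mul_sqrt s _ _).trans ?_
  gcongr
  · exact sum_comp_le_sum_support q₁ inv_injective (F := fun k => ‖q₁.coeff k‖ ^ 2)
      (fun _ => by positivity) (fun _ h => by simp [h]) s
  · exact sum_comp_le_sum_support q₂ (conj_injective g) (F := fun k => ‖q₂.coeff k‖ ^ 2)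
      (fun _ => by positivity) (fun _ h => by simp [h]) s

theorem wordLength_le_of_mem_support_schurTwist {S : Finset Γ}
    (hS : Subgroup.closure (S : Set Γ) = ⊤) {g : Γ} {q₁ q₂ : MonoidAlgebra ℂ Γ} {R : ℕ}
    (h₁ : ∀ k ∈ q₁.coeff.support, wordLength S k ≤ R) :
    ∀ k ∈ (schurTwist g q₁ q₂).coeff.support, wordLength S k ≤ R := by
  intro k hk
  rw [Finsupp.mem_support_iff, coeff_schurTwist] at hk
  rw [← wordLength_inv hS]
  exact h₁ _ (Finsupp.mem_support_iff.2 (left_ne_zero_of_mul hk))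

/-- The inequality `x² y² ≤ x⁴ + y⁴` separates the two factors. Inversion preserves the weight, and
conjugation by `g` changes `1 + |k|` by a factor at most `1 + 2|g|`. -/
theorem sum_weighted_sq_schurTwist_le {S : Finset Γ} (hS : Subgroup.closure (S : Set Γ) = ⊤)
    (g : Γ) (q₁ q₂ : MonoidAlgebra ℂ Γ) {κ : ℝ} (hκ : 0 < κ) :
    ∑ k ∈ (schurTwist g q₁ q₂).coeff.support,
      (1 + wordLength S k : ℝ) ^ κ * ‖(schurTwist g q₁ q₂).coeff k‖ ^ 2 ≤
    ∑ k ∈ q₁.coeff.support, (1 + wordLength S k : ℝ) ^ κ * ‖q₁.coeff k‖ ^ 4 +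
    (1 + 2 * wordLength S g : ℝ) ^ κ *
      ∑ k ∈ q₂.coeff.support, (1 + wordLength S k : ℝ) ^ κ * ‖q₂.coeff k‖ ^ 4 := by
  set s := (schurTwist g q₁ q₂).coeff.support
  have hF₁ := sum_comp_le_sum_support q₁ inv_injective
    (F := fun k => (1 + wordLength S k : ℝ) ^ κ * ‖q₁.coeff k‖ ^ 4)
      (fun _ => by positivity) (fun _ h => by simp [h]) s
  have hF₂ := sum_comp_le_sum_support q₂ (conj_injective g)
    (F := fun k => (1 + wordLength S k : ℝ) ^ κ * ‖q₂.coeff k‖ ^ 4)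
      (fun _ => by positivity) (fun _ h => by simp [h]) s
  refine le_trans ?_ (add_le_add hF₁ (mul_le_mul_of_nonneg_left hF₂ (by positivity)))
  rw [Finset.mul_sum, ← Finset.sum_add_distrib]
  refine Finset.sum_le_sum fun k _ => ?_
  rw [coeff_schurTwist, norm_mul, mul_pow, wordLength_inv hS]
  set x := ‖q₁.coeff k⁻¹‖
  set y := ‖q₂.coeff (g * k * g⁻¹)‖
  have h1 : (1 + wordLength S k : ℝ) ^ κ ≤ (1 + 2 * wordLength S g : ℝ) ^ κ *
      (1 + wordLength S (g * k * g⁻¹) : ℝ) ^ κ := by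
    rw [← Real.mul_rpow (by positivity) (by positivity)]
    gcongr
    have h2 : wordLength S k ≤ 2 * wordLength S g + wordLength S (g * k * g⁻¹) := by
      have h3 := wordLength_mul_le hS (g⁻¹ * (g * k * g⁻¹)) g
      have h4 := wordLength_mul_le hS g⁻¹ (g * k * g⁻¹)
      rw [wordLength_inv hS] at h4
      rw [show g⁻¹ * (g * k * g⁻¹) * g = k by group] at h3
      lia
    have h5 : (wordLength S k : ℝ) ≤ 2 * wordLength S g + wordLength S (g * k * g⁻¹) := by
      exact_mod_cast h2
    nlinarith [mul_nonneg (Nat.cast_nonneg (α := ℝ) (wordLength S g))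
      (Nat.cast_nonneg (α := ℝ) (wordLength S (g * k * g⁻¹)))]
  have h2 : x ^ 2 * y ^ 2 ≤ x ^ 4 + y ^ 4 := by
    nlinarith [sq_nonneg (x ^ 2 - y ^ 2), sq_nonneg (x ^ 2), sq_nonneg (y ^ 2)]
  calc _ ≤ (1 + wordLength S k : ℝ) ^ κ * (x ^ 4 + y ^ 4) := by gcongr
    _ = (1 + wordLength S k : ℝ) ^ κ * x ^ 4 + (1 + wordLength S k : ℝ) ^ κ * y ^ 4 := by ring
    _ ≤ (1 + wordLength S k : ℝ) ^ κ * x ^ 4 + ((1 + 2 * wordLength S g : ℝ) ^ κ *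
      (1 + wordLength S (g * k * g⁻¹) : ℝ) ^ κ) * y ^ 4 := by gcongr
    _ = _ := by ring

end SchurProduct

/-! ### Matrices and orthonormal bases -/

section Spectral

open scoped Matrix

variable {N : ℕ}

theorem sum_inner_eq_trace (φ : OrthonormalBasis (Fin N) ℂ (EuclideanSpace ℂ (Fin N)))
    (M : Matrix (Fin N) (Fin N) ℂ) :
    ∑ i, inner ℂ (φ i) (Matrix.toEuclideanCLM (𝕜 := ℂ) M (φ i)) = M.trace := by
  have h1 := LinearMap.trace_eq_sum_inner
    (Matrix.toEuclideanCLM (𝕜 := ℂ) M : EuclideanSpace ℂ (Fin N) →ₗ[ℂ] _) φ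
  have h2 := LinearMap.trace_eq_sum_inner
    (Matrix.toEuclideanCLM (𝕜 := ℂ) M : EuclideanSpace ℂ (Fin N) →ₗ[ℂ] _)
    (EuclideanSpace.basisFun (Fin N) ℂ)
  rw [h1] at h2
  refine Eq.trans h2 (Finset.sum_congr rfl fun x _ => ?_)
  simp [EuclideanSpace.inner_single_left]

theorem inner_toEuclideanCLM_conjTranspose (M : Matrix (Fin N) (Fin N) ℂ)
    (v w : EuclideanSpace ℂ (Fin N)) :
    inner ℂ v (Matrix.toEuclideanCLM (𝕜 := ℂ) Mᴴ w) =
      inner ℂ (Matrix.toEuclideanCLM (𝕜 := ℂ) M v) w := by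
  rw [← Matrix.star_eq_conjTranspose, map_star, ContinuousLinearMap.star_eq_adjoint,
    ContinuousLinearMap.adjoint_inner_right]

theorem toEuclideanCLM_mul_apply (M M' : Matrix (Fin N) (Fin N) ℂ)
    (v : EuclideanSpace ℂ (Fin N)) : Matrix.toEuclideanCLM (𝕜 := ℂ) (M * M') v =
      Matrix.toEuclideanCLM (𝕜 := ℂ) M (Matrix.toEuclideanCLM (𝕜 := ℂ) M' v) := by
  rw [map_mul]; rfl

/-- The trace is computed in the common eigenbasis, with `B φ_i` expanded in the same basis. -/
theorem sum_eigenvalues_mul_norm_inner_sq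
    (φ : OrthonormalBasis (Fin N) ℂ (EuclideanSpace ℂ (Fin N)))
    {M₁ M₂ : Matrix (Fin N) (Fin N) ℂ} {e₁ e₂ : Fin N → ℝ}
    (h₁ : ∀ i, Matrix.toEuclideanCLM (𝕜 := ℂ) M₁ (φ i) = (e₁ i : ℂ) • φ i)
    (h₂ : ∀ i, Matrix.toEuclideanCLM (𝕜 := ℂ) M₂ (φ i) = (e₂ i : ℂ) • φ i)
    (B : Matrix (Fin N) (Fin N) ℂ) :
    ((∑ i, ∑ j, e₁ i * (e₂ j *
      ‖inner ℂ (φ j) (Matrix.toEuclideanCLM (𝕜 := ℂ) B (φ i))‖ ^ 2) : ℝ) : ℂ) =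
      (Bᴴ * M₂ * B * M₁).trace := by
  rw [← sum_inner_eq_trace φ]
  push_cast
  refine Finset.sum_congr rfl fun i _ => ?_
  rw [toEuclideanCLM_mul_apply, toEuclideanCLM_mul_apply, toEuclideanCLM_mul_apply, h₁, map_smul,
    map_smul, map_smul, inner_smul_right, inner_toEuclideanCLM_conjTranspose, ← Finset.mul_sum]
  congr 1
  set w := Matrix.toEuclideanCLM (𝕜 := ℂ) B (φ i)
  rw [← φ.sum_inner_mul_inner]
  refine Finset.sum_congr rfl fun j _ => ?_
  have h3 : inner ℂ (φ j) (Matrix.toEuclideanCLM (𝕜 := ℂ) M₂ w) = (e₂ j : ℂ) * inner ℂ (φ j) w := by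
    conv_lhs => rw [← φ.sum_repr' w, map_sum, inner_sum]
    rw [Finset.sum_eq_single j]
    · rw [map_smul, h₂, inner_smul_right, inner_smul_right, orthonormal_iff_ite.1 φ.orthonormal,
        if_pos rfl]
      ring
    · intro k _ hk
      rw [map_smul, h₂, inner_smul_right, inner_smul_right, orthonormal_iff_ite.1 φ.orthonormal,
        if_neg hk.symm]
      ring
    · simp
  rw [h3, ← inner_conj_symm w (φ j), mul_left_comm, ← Complex.normSq_eq_conj_mul_self,
    Complex.normSq_eq_norm_sq]
  push_cast
  rfl

theorem sum_norm_inner_sq_eq (φ : OrthonormalBasis (Fin N) ℂ (EuclideanSpace ℂ (Fin N)))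
    (B : Matrix (Fin N) (Fin N) ℂ) :
    ∑ i, ∑ j, ‖inner ℂ (φ j) (Matrix.toEuclideanCLM (𝕜 := ℂ) B (φ i))‖ ^ 2 =
      ∑ y, ∑ x, ‖B x y‖ ^ 2 := by
  have h := sum_eigenvalues_mul_norm_inner_sq φ (M₁ := 1) (M₂ := 1) (e₁ := fun _ => 1)
    (e₂ := fun _ => 1) (by simp) (by simp) B
  rw [← Complex.ofReal_inj]
  simp only [one_mul, mul_one] at h
  rw [h, Matrix.trace]
  push_cast
  refine Finset.sum_congr rfl fun y _ => ?_
  rw [Matrix.diag_apply, Matrix.mul_apply]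
  refine Finset.sum_congr rfl fun x _ => ?_
  rw [Matrix.conjTranspose_apply, RCLike.star_def, ← Complex.normSq_eq_conj_mul_self,
    Complex.normSq_eq_norm_sq]
  push_cast
  rfl

end Spectral

/-! ### Permutation representations -/

section Permutation

open scoped Matrix

variable {Γ : Type*} [Group Γ] {N : ℕ}

/-- The permutation matrix of `ρ g`. -/
def permMat (ρ : Γ →* Equiv.Perm (Fin N)) (g : Γ) : Matrix (Fin N) (Fin N) ℂ :=
  Matrix.of fun x y => if x = ρ g y then (1 : ℂ) else 0

theorem permMat_apply (ρ : Γ →* Equiv.Perm (Fin N)) (g : Γ) (x y : Fin N) :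
    permMat ρ g x y = if x = ρ g y then (1 : ℂ) else 0 := rfl

theorem permMat_mulVec (ρ : Γ →* Equiv.Perm (Fin N)) (g : Γ) (v : Fin N → ℂ) (x : Fin N) :
    (permMat ρ g *ᵥ v) x = v (ρ g⁻¹ x) := by
  have : ∀ y, x = ρ g y ↔ y = ρ g⁻¹ x := fun y => by
    rw [map_inv, Equiv.Perm.eq_inv_iff_eq, eq_comm]
  simp [Matrix.mulVec, dotProduct, permMat_apply, this]

/-- The permutation matrices, as a homomorphism. -/
def permHom (ρ : Γ →* Equiv.Perm (Fin N)) : Γ →* Matrix (Fin N) (Fin N) ℂ where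
  toFun := permMat ρ
  map_one' := by
    ext x y
    simp [permMat_apply, Matrix.one_apply]
  map_mul' g h := by
    ext x y
    simp [permMat_apply, Matrix.mul_apply]

/-- The permutation representation of the group algebra. -/
def permAlgHom (ρ : Γ →* Equiv.Perm (Fin N)) :
    MonoidAlgebra ℂ Γ →ₐ[ℂ] Matrix (Fin N) (Fin N) ℂ :=
  MonoidAlgebra.lift ℂ _ Γ (permHom ρ)

theorem permAlgHom_apply (ρ : Γ →* Equiv.Perm (Fin N)) (q : MonoidAlgebra ℂ Γ) :
    permAlgHom ρ q = permAlg ρ q := by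
  rw [permAlgHom, MonoidAlgebra.lift_apply]
  rfl

theorem permAlgHom_single (ρ : Γ →* Equiv.Perm (Fin N)) (g : Γ) (z : ℂ) :
    permAlgHom ρ (MonoidAlgebra.single g z) = z • permMat ρ g := by
  rw [permAlgHom, MonoidAlgebra.lift_single]
  rfl

theorem permAlg_mul (ρ : Γ →* Equiv.Perm (Fin N)) (q q' : MonoidAlgebra ℂ Γ) :
    permAlg ρ (q * q') = permAlg ρ q * permAlg ρ q' := by
  simp only [← permAlgHom_apply, map_mul]

theorem permAlg_pow (ρ : Γ →* Equiv.Perm (Fin N)) (q : MonoidAlgebra ℂ Γ) (m : ℕ) :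
    permAlg ρ (q ^ m) = permAlg ρ q ^ m := by
  simp only [← permAlgHom_apply, map_pow]

theorem permMat_conjTranspose (ρ : Γ →* Equiv.Perm (Fin N)) (g : Γ) :
    (permMat ρ g)ᴴ = permMat ρ g⁻¹ := by
  ext x y
  have h : x = ρ g⁻¹ y ↔ y = ρ g x := by
    rw [map_inv, Equiv.Perm.eq_inv_iff_eq, eq_comm]
  rw [Matrix.conjTranspose_apply, permMat_apply, permMat_apply]
  simp only [h]
  split_ifs <;> simp

theorem permAlg_adj (ρ : Γ →* Equiv.Perm (Fin N)) (q : MonoidAlgebra ℂ Γ) :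
    permAlg ρ (adj q) = (permAlg ρ q)ᴴ := by
  rw [← permAlgHom_apply, adj, map_sum, permAlg, Matrix.conjTranspose_sum]
  refine Finset.sum_congr rfl fun g _ => ?_
  rw [permAlgHom_single, Matrix.conjTranspose_smul, ← permMat_conjTranspose]
  rfl

theorem permAlg_apply (ρ : Γ →* Equiv.Perm (Fin N)) (q : MonoidAlgebra ℂ Γ) (x y : Fin N) :
    permAlg ρ q x y = ∑ g ∈ q.coeff.support, q.coeff g * if x = ρ g y then (1 : ℂ) else 0 := by
  simp [permAlg, Matrix.sum_apply]

theorem norm_toEuclideanCLM_permMat (ρ : Γ →* Equiv.Perm (Fin N)) (g : Γ)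
    (v : EuclideanSpace ℂ (Fin N)) :
    ‖Matrix.toEuclideanCLM (𝕜 := ℂ) (permMat ρ g) v‖ = ‖v‖ := by
  rw [EuclideanSpace.norm_eq, EuclideanSpace.norm_eq]
  congr 1
  rw [← Equiv.sum_comp (ρ g⁻¹) fun x => ‖v x‖ ^ 2]
  refine Finset.sum_congr rfl fun x _ => ?_
  change ‖(permMat ρ g *ᵥ v.ofLp) x‖ ^ 2 = _
  rw [permMat_mulVec]

theorem norm_toEuclideanCLM_permAlg_le (ρ : Γ →* Equiv.Perm (Fin N)) (q : MonoidAlgebra ℂ Γ) :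
    ‖Matrix.toEuclideanCLM (𝕜 := ℂ) (permAlg ρ q)‖ ≤ l1Norm q := by
  rw [permAlg, map_sum]
  refine (norm_sum_le _ _).trans (Finset.sum_le_sum fun g _ => ?_)
  rw [map_smul, norm_smul]
  refine mul_le_of_le_one_right (norm_nonneg _) ?_
  refine ContinuousLinearMap.opNorm_le_bound _ zero_le_one fun v => ?_
  rw [one_mul]
  exact (norm_toEuclideanCLM_permMat ρ g v).le

theorem abs_eigenvalue_le {ρ : Γ →* Equiv.Perm (Fin N)} {p : MonoidAlgebra ℂ Γ}
    {φ : OrthonormalBasis (Fin N) ℂ (EuclideanSpace ℂ (Fin N))} {ev : Fin N → ℝ}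
    (hφ : IsEigenbasis (permAlg ρ p) φ ev) (i : Fin N) : |ev i| ≤ l1Norm p := by
  have h1 := (Matrix.toEuclideanCLM (𝕜 := ℂ) (permAlg ρ p)).le_opNorm (φ i)
  rw [hφ i, norm_smul, φ.norm_eq_one, mul_one, mul_one, Complex.norm_real] at h1
  exact h1.trans (norm_toEuclideanCLM_permAlg_le ρ p)

theorem toEuclideanCLM_permAlg_polyAlg {ρ : Γ →* Equiv.Perm (Fin N)} {p : MonoidAlgebra ℂ Γ}
    {φ : OrthonormalBasis (Fin N) ℂ (EuclideanSpace ℂ (Fin N))} {ev : Fin N → ℝ}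
    (hφ : IsEigenbasis (permAlg ρ p) φ ev) (h : Polynomial ℝ) (i : Fin N) :
    Matrix.toEuclideanCLM (𝕜 := ℂ) (permAlg ρ (polyAlg Γ p h)) (φ i) =
      ((h.eval (ev i) : ℝ) : ℂ) • φ i := by
  simp only [polyAlg]
  induction h using Polynomial.induction_on with
  | C a =>
    rw [Polynomial.aeval_C, Polynomial.eval_C, Algebra.algebraMap_eq_smul_one, ← Complex.coe_smul,
      ← permAlgHom_apply, map_smul, map_one, map_smul, map_one]
    rfl
  | add f g hf hg =>
    rw [map_add, ← permAlgHom_apply, map_add, map_add, Polynomial.eval_add, Complex.ofReal_add,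
      add_smul, ← hf, ← hg, permAlgHom_apply, permAlgHom_apply]
    rfl
  | monomial n a ih =>
    rw [pow_succ, ← mul_assoc, map_mul, permAlg_mul, toEuclideanCLM_mul_apply, Polynomial.aeval_X,
      hφ, map_smul, ih, smul_smul, Polynomial.eval_mul (p := Polynomial.C a * Polynomial.X ^ n),
      Polynomial.eval_X, Complex.ofReal_mul, mul_comm]

theorem mem_bad {S : Finset Γ} {ρ : Γ →* Equiv.Perm (Fin N)} {r : ℕ} {x : Fin N} {g : Γ}
    (hg : g ≠ 1) (hr : wordLength S g ≤ 2 * r) (hx : ρ g x = x) : x ∈ bad S ρ r := by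
  classical
  exact Finset.mem_filter.2 ⟨Finset.mem_univ _, g, hg, hr, hx⟩

-- A nontrivial `g` of length at most `2r` fixes only points of `bad`, by definition; elsewhere,
-- fixing `x` and being trivial are the same condition.
open Classical in
theorem norm_ite_fixed_sub_ite_one_le {S : Finset Γ} {ρ : Γ →* Equiv.Perm (Fin N)} {r : ℕ}
    {g : Γ} (hr : wordLength S g ≤ 2 * r) (x : Fin N) :
    ‖(if ρ g x = x then (1 : ℂ) else 0) - if g = 1 then 1 else 0‖ ≤
      if x ∈ bad S ρ r then 1 else 0 := by
  by_cases hg : g = 1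
  · subst hg
    simp only [map_one, Equiv.Perm.one_apply, if_true, sub_self, norm_zero]
    split_ifs <;> norm_num
  · by_cases hx : ρ g x = x
    · rw [if_pos hx, if_neg hg, if_pos (mem_bad hg hr hx)]
      simp
    · rw [if_neg hx, if_neg hg, sub_self, norm_zero]
      split_ifs <;> norm_num

theorem sum_coeff_mul_ite (q : MonoidAlgebra ℂ Γ) (g : Γ) [DecidablePred fun h : Γ => h = g] :
    ∑ h ∈ q.coeff.support, q.coeff h * (if h = g then (1 : ℂ) else 0) = q.coeff g := by
  classical
  by_cases hg : g ∈ q.coeff.support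
  · rw [Finset.sum_eq_single g (fun h _ hh => by simp [hh]) (fun h => absurd hg h)]
    simp
  · rw [Finset.sum_eq_zero]
    · exact (Finsupp.notMem_support_iff.1 hg).symm
    · intro h hh
      rw [if_neg fun h' => hg (by rwa [h'] at hh), mul_zero]

/-- A diagonal entry of `ρ(q)` collects the words that fix the point, which off `bad` leaves only
the identity: the normalized trace is close to the canonical trace `q ↦ q_e`. -/
theorem norm_trace_permAlg_sub_le {S : Finset Γ} (ρ : Γ →* Equiv.Perm (Fin N)) {r : ℕ}
    {q : MonoidAlgebra ℂ Γ} (hq : ∀ g ∈ q.coeff.support, wordLength S g ≤ 2 * r) :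
    ‖(permAlg ρ q).trace - N * q.coeff 1‖ ≤ (bad S ρ r).card * l1Norm q := by
  classical
  have h1 : (permAlg ρ q).trace - N * q.coeff 1 = ∑ x : Fin N, ∑ g ∈ q.coeff.support,
      q.coeff g * ((if ρ g x = x then (1 : ℂ) else 0) - if g = 1 then 1 else 0) := by
    simp only [mul_sub, Finset.sum_sub_distrib, sum_coeff_mul_ite]
    rw [Finset.sum_const, Finset.card_univ, Fintype.card_fin, nsmul_eq_mul]
    congr 1
    refine Finset.sum_congr rfl fun x _ => ?_
    rw [Matrix.diag_apply, permAlg_apply]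
    exact Finset.sum_congr rfl fun g _ => by simp only [eq_comm]
  rw [h1]
  calc _ ≤ ∑ x : Fin N, ∑ g ∈ q.coeff.support,
        ‖q.coeff g‖ * (if x ∈ bad S ρ r then 1 else 0) := by
        refine (norm_sum_le _ _).trans (Finset.sum_le_sum fun x _ => ?_)
        refine (norm_sum_le _ _).trans (Finset.sum_le_sum fun g hg => ?_)
        rw [norm_mul]
        gcongr
        exact norm_ite_fixed_sub_ite_one_le (hq g hg) x
    _ = _ := by
        simp only [← Finset.sum_mul]
        rw [← Finset.mul_sum, Finset.sum_ite_mem, Finset.univ_inter, Finset.sum_const,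
          nsmul_eq_mul, mul_one, mul_comm]
        rfl

theorem trace_twisted_eq (ρ : Γ →* Equiv.Perm (Fin N)) (g : Γ) (a : Fin N → ℂ)
    (M₁ M₂ : Matrix (Fin N) (Fin N) ℂ) :
    ((permMat ρ g * Matrix.diagonal a)ᴴ * M₂ * (permMat ρ g * Matrix.diagonal a) * M₁).trace =
      ∑ x, ∑ y, star (a x) * M₂ (ρ g x) (ρ g y) * a y * M₁ y x := by
  have hB : ∀ x y, (permMat ρ g * Matrix.diagonal a) x y = if x = ρ g y then a y else 0 := by
    intro x y
    rw [Matrix.mul_diagonal, permMat_apply, ite_mul, one_mul, zero_mul]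
  rw [Matrix.trace]
  refine Finset.sum_congr rfl fun x _ => ?_
  rw [Matrix.diag_apply, Matrix.mul_apply]
  refine Finset.sum_congr rfl fun y _ => ?_
  congr 1
  simp only [Matrix.mul_apply (N := permMat ρ g * Matrix.diagonal a), Matrix.mul_apply (N := M₂),
    Matrix.conjTranspose_apply, hB, apply_ite star, star_zero, ite_mul, mul_ite, zero_mul,
    mul_zero, Finset.sum_ite_eq', Finset.mem_univ, if_true]

theorem dotProduct_permAlg_schurTwist (ρ : Γ →* Equiv.Perm (Fin N)) (g : Γ) (a : Fin N → ℂ)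
    (q₁ q₂ : MonoidAlgebra ℂ Γ) :
    star a ⬝ᵥ (permAlg ρ (schurTwist g q₁ q₂) *ᵥ a) = ∑ k ∈ q₁.coeff.support,
      q₁.coeff k * q₂.coeff (g * k⁻¹ * g⁻¹) * ∑ x, star (a x) * a (ρ k x) := by
  rw [← permAlgHom_apply, schurTwist, map_sum, Matrix.sum_mulVec, dotProduct_sum]
  refine Finset.sum_congr rfl fun k _ => ?_
  rw [permAlgHom_single, Matrix.smul_mulVec, dotProduct_smul, smul_eq_mul]
  congr 1
  refine Finset.sum_congr rfl fun x _ => ?_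
  rw [permMat_mulVec, inv_inv]
  rfl

/-- Expanding, the pair `(k, h)` contributes at `x` when `g⁻¹hgk` fixes `x`. Off `bad` this forces
`h = g k⁻¹ g⁻¹`, and the double sum over `Γ` collapses to the coefficients of `schurTwist`. -/
theorem norm_trace_twisted_sub_le {S : Finset Γ} (hS : Subgroup.closure (S : Set Γ) = ⊤)
    (ρ : Γ →* Equiv.Perm (Fin N)) {r : ℕ} (g : Γ) {a : Fin N → ℂ} {α : ℝ}
    (ha : ∀ x, ‖a x‖ ≤ α) {q₁ q₂ : MonoidAlgebra ℂ Γ}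
    (hq : ∀ k ∈ q₁.coeff.support, ∀ h ∈ q₂.coeff.support,
      2 * wordLength S g + wordLength S h + wordLength S k ≤ 2 * r) :
    ‖((permMat ρ g * Matrix.diagonal a)ᴴ * permAlg ρ q₂ * (permMat ρ g * Matrix.diagonal a) *
      permAlg ρ q₁).trace - star a ⬝ᵥ (permAlg ρ (schurTwist g q₁ q₂) *ᵥ a)‖ ≤
      (bad S ρ r).card * (α ^ 2 * (l1Norm q₁ * l1Norm q₂)) := by
  classical
  have h1 : ((permMat ρ g * Matrix.diagonal a)ᴴ * permAlg ρ q₂ *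
      (permMat ρ g * Matrix.diagonal a) * permAlg ρ q₁).trace = ∑ k ∈ q₁.coeff.support,
      ∑ h ∈ q₂.coeff.support, ∑ x, q₁.coeff k * q₂.coeff h * (star (a x) * a (ρ k x)) *
        (if ρ (g⁻¹ * h * g * k) x = x then (1 : ℂ) else 0) := by
    rw [trace_twisted_eq]
    have h2 : ∀ x, ∑ y, star (a x) * permAlg ρ q₂ (ρ g x) (ρ g y) * a y * permAlg ρ q₁ y x =
        ∑ k ∈ q₁.coeff.support, ∑ h ∈ q₂.coeff.support,
          q₁.coeff k * q₂.coeff h * (star (a x) * a (ρ k x)) *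
          (if ρ (g⁻¹ * h * g * k) x = x then (1 : ℂ) else 0) := by
      intro x
      simp only [permAlg_apply ρ q₁, Finset.mul_sum]
      rw [Finset.sum_comm]
      refine Finset.sum_congr rfl fun k _ => ?_
      rw [Finset.sum_eq_single (ρ k x) (fun y _ hy => by simp [hy]) (by simp), if_pos rfl, mul_one,
        permAlg_apply, Finset.mul_sum, Finset.sum_mul, Finset.sum_mul]
      refine Finset.sum_congr rfl fun h _ => ?_
      have h3 : ρ (g⁻¹ * h * g * k) x = x ↔ ρ g x = ρ h (ρ g (ρ k x)) := by
        simp only [map_mul, map_inv, Equiv.Perm.mul_apply]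
        rw [Equiv.Perm.inv_eq_iff_eq, eq_comm]
      simp only [h3]
      ring
    simp only [h2]
    rw [Finset.sum_comm]
    exact Finset.sum_congr rfl fun k _ => Finset.sum_comm
  -- This is the sum of `h1` with "fixes `x`" replaced by "equals `1`", so the difference can be
  -- bounded term by term.
  have h4 : star a ⬝ᵥ (permAlg ρ (schurTwist g q₁ q₂) *ᵥ a) = ∑ k ∈ q₁.coeff.support,
      ∑ h ∈ q₂.coeff.support, ∑ x, q₁.coeff k * q₂.coeff h * (star (a x) * a (ρ k x)) *
        (if g⁻¹ * h * g * k = 1 then (1 : ℂ) else 0) := by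
    rw [dotProduct_permAlg_schurTwist]
    refine Finset.sum_congr rfl fun k _ => ?_
    rw [← sum_coeff_mul_ite q₂ (g * k⁻¹ * g⁻¹), mul_assoc, Finset.sum_mul,
      Finset.mul_sum]
    refine Finset.sum_congr rfl fun h _ => ?_
    rw [← mul_assoc, Finset.mul_sum]
    refine Finset.sum_congr rfl fun x _ => ?_
    have h5 : g⁻¹ * h * g * k = 1 ↔ h = g * k⁻¹ * g⁻¹ := by
      constructor
      · intro h6
        have : h = g * (g⁻¹ * h * g * k) * k⁻¹ * g⁻¹ := by group
        rw [this, h6]; group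
      · rintro rfl; group
    simp only [h5]
    ring
  rw [h1, h4, ← Finset.sum_sub_distrib]
  simp only [← Finset.sum_sub_distrib, ← mul_sub]
  calc _ ≤ ∑ k ∈ q₁.coeff.support, ∑ h ∈ q₂.coeff.support, ∑ x,
        ‖q₁.coeff k‖ * ‖q₂.coeff h‖ * α ^ 2 * (if x ∈ bad S ρ r then 1 else 0) := by
        refine (norm_sum_le _ _).trans (Finset.sum_le_sum fun k hk => ?_)
        refine (norm_sum_le _ _).trans (Finset.sum_le_sum fun h hh => ?_)
        refine (norm_sum_le _ _).trans (Finset.sum_le_sum fun x _ => ?_)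
        rw [norm_mul, norm_mul, norm_mul, norm_mul, norm_star, pow_two]
        have hα : 0 ≤ α := (norm_nonneg _).trans (ha x)
        gcongr
        · exact ha x
        · exact ha _
        · refine norm_ite_fixed_sub_ite_one_le (le_trans ?_ (hq k hk h hh)) x
          have h6 := wordLength_mul_le hS (g⁻¹ * h * g) k
          have h7 := wordLength_mul_le hS (g⁻¹ * h) g
          have h8 := wordLength_mul_le hS g⁻¹ h
          rw [wordLength_inv hS] at h8
          lia
    _ = _ := by
        simp only [← Finset.mul_sum]
        rw [Finset.sum_ite_mem, Finset.univ_inter, Finset.sum_const, nsmul_eq_mul, mul_one]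
        simp only [← Finset.sum_mul, ← Finset.mul_sum]
        rw [l1Norm, l1Norm]
        ring

end Permutation

/-! ### Spectral windows of permutation representations -/

section Windows

open scoped Matrix

variable {Γ : Type*} [Group Γ] {N : ℕ}

theorem mem_indices {ev : Fin N → ℝ} {J : Set ℝ} {i : Fin N} : i ∈ indices ev J ↔ ev i ∈ J := by
  classical
  simp [indices]

/-- Outside the window the narrow kernel has only its tail `η² / (Λ² (x - E)²)`, of the same shape
as the tail at scale `η`, with a gain of `Λ⁻²`. -/
theorem poisson_le_indicator_add {Λ η : ℝ} (hη : 0 < η) (hΛ : 0 < Λ) (E x : ℝ) :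
    poisson E (η / Λ) x ≤ (Set.Icc (E - η) (E + η)).indicator 1 x +
      2 / Λ ^ 2 * poisson E η x := by
  by_cases hx : x ∈ Set.Icc (E - η) (E + η)
  · rw [Set.indicator_of_mem hx]
    have h1 := poisson_le_one (div_pos hη hΛ) E x
    have h2 : 0 ≤ 2 / Λ ^ 2 * poisson E η x := mul_nonneg (by positivity) (poisson_nonneg _ _ _)
    simp only [Pi.one_apply]
    linarith
  · rw [Set.indicator_of_notMem hx, zero_add]
    have hd : η ^ 2 ≤ (x - E) ^ 2 := by
      rw [Set.mem_Icc, not_and_or, not_le, not_le] at hx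
      rcases hx with hx | hx <;> nlinarith
    have hpos : 0 < (x - E) ^ 2 := lt_of_lt_of_le (by positivity) hd
    rw [poisson, poisson, div_mul_div_comm, div_le_div_iff₀ (by positivity) (by positivity),
      div_pow]
    have h3 : η ^ 2 / Λ ^ 2 * (Λ ^ 2 * ((x - E) ^ 2 + η ^ 2)) = η ^ 2 * ((x - E) ^ 2 + η ^ 2) := by
      field_simp
    rw [h3]
    have h4 : 0 ≤ 2 * η ^ 2 * (η ^ 2 / Λ ^ 2) := by positivity
    nlinarith [sq_nonneg η]

theorem one_le_five_mul_poisson {η E x : ℝ} (hη : 0 < η)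
    (hx : x ∈ Set.Icc (E - 2 * η) (E + 2 * η)) : 1 ≤ 5 * poisson E η x := by
  rw [poisson, mul_div_assoc', le_div_iff₀ (by positivity)]
  nlinarith [hx.1, hx.2]

variable {S : Finset Γ} {p : MonoidAlgebra ℂ Γ} {L B n : ℕ} {C₀ κ γ CW θ : ℝ}

theorem IsApproximant.l1Norm_le {E η : ℝ} {h : Polynomial ℝ}
    (H : IsApproximant S p L B n C₀ κ γ CW θ E η h) (hθ : θ ≤ 1) :
    l1Norm (polyAlg Γ p h) ≤ √((B ^ n : ℕ) : ℝ) * 2 := by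
  refine (l1Norm_le_sqrt_card_mul _ H.card_support).trans ?_
  gcongr
  exact (l2Norm_le_norm_leftRegAlg _).trans (H.norm_le.trans (by linarith))

theorem sqrt_natCast_pow_le (hB : 1 ≤ B) : √((B ^ n : ℕ) : ℝ) ≤ (B : ℝ) ^ n := by
  have h1 : (1 : ℝ) ≤ (B : ℝ) ^ n := one_le_pow₀ (by exact_mod_cast hB)
  push_cast
  rw [Real.sqrt_le_left (by positivity)]
  nlinarith

theorem abs_sum_eval_sub_le {E η : ℝ} {h : Polynomial ℝ}
    (H : IsApproximant S p L B n C₀ κ γ CW θ E η h) (hθ : θ ≤ 1) (hB : 1 ≤ B)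
    {ρ : Γ →* Equiv.Perm (Fin N)}
    {φ : OrthonormalBasis (Fin N) ℂ (EuclideanSpace ℂ (Fin N))} {ev : Fin N → ℝ}
    (hφ : IsEigenbasis (permAlg ρ p) φ ev) {r : ℕ} (hr : L * n ≤ 2 * r) :
    |∑ i, h.eval (ev i) - N * ((polyAlg Γ p h).coeff 1).re| ≤
      (bad S ρ r).card * (2 * (B : ℝ) ^ n) := by
  have h1 := norm_trace_permAlg_sub_le (S := S) ρ (r := r) (q := polyAlg Γ p h)
    fun g hg => (H.wordLength_le g hg).trans hr
  have h2 : (permAlg ρ (polyAlg Γ p h)).trace = ((∑ i, h.eval (ev i) : ℝ) : ℂ) := by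
    rw [← sum_inner_eq_trace φ]
    push_cast
    refine Finset.sum_congr rfl fun i _ => ?_
    rw [toEuclideanCLM_permAlg_polyAlg hφ, inner_smul_right,
      orthonormal_iff_ite.1 φ.orthonormal, if_pos rfl, mul_one]
  have h3 := (Complex.abs_re_le_norm _).trans h1
  rw [h2, Complex.sub_re, Complex.ofReal_re, ← Complex.ofReal_natCast,
    Complex.re_ofReal_mul] at h3
  refine h3.trans ?_
  gcongr
  refine (H.l1Norm_le hθ).trans ?_
  linarith [sqrt_natCast_pow_le (n := n) hB]

/-- Traces give the sums of both kernels over the eigenvalues. The kernel at scale `η/Λ` has mass at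
least about `N η / (Λ C₀)`, and the part outside the window is at most about `2 Λ⁻² N C₀ η`. With `Λ
= 8 C₀²` the latter is a quarter of the former. -/
theorem le_card_indices (hC₀ : 1 ≤ C₀) (hB : 1 ≤ B) {E η : ℝ} (hη : 0 < η)
    {h h' : Polynomial ℝ} (H : IsApproximant S p L B n C₀ κ γ CW (1 / (16 * C₀)) E η h)
    (H' : IsApproximant S p L B n C₀ κ γ CW (1 / (16 * C₀)) E (η / (8 * C₀ ^ 2)) h')
    {ρ : Γ →* Equiv.Perm (Fin N)}
    {φ : OrthonormalBasis (Fin N) ℂ (EuclideanSpace ℂ (Fin N))} {ev : Fin N → ℝ}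
    (hφ : IsEigenbasis (permAlg ρ p) φ ev) {r : ℕ} (hr : L * n ≤ 2 * r)
    (hbad : (bad S ρ r).card * (2 * (B : ℝ) ^ n) ≤
      N * (1 / (16 * C₀) * (η / (8 * C₀ ^ 2)))) :
    N * (η / (16 * C₀ ^ 3)) ≤ (indices ev (Set.Icc (E - η) (E + η))).card := by
  set θ : ℝ := 1 / (16 * C₀) with hθ
  have hθ1 : θ ≤ 1 := by
    rw [hθ, div_le_one (by positivity)]
    linarith
  set η' : ℝ := η / (8 * C₀ ^ 2) with hη'
  have hη'0 : 0 < η' := by positivity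
  have hN : (0 : ℝ) ≤ N := by positivity
  have h1 := (abs_le.1 (abs_sum_eval_sub_le H hθ1 hB hφ hr)).2
  have h2 := (abs_le.1 (abs_sum_eval_sub_le H' hθ1 hB hφ hr)).1
  have h3 : ∀ i, h'.eval (ev i) ≤ (Set.Icc (E - η) (E + η)).indicator 1 (ev i) +
      2 / (8 * C₀ ^ 2) ^ 2 * h.eval (ev i) + θ * η' := by
    intro i
    have h4 := H'.le_poisson _ (abs_eigenvalue_le hφ i)
    have h5 := H.poisson_le _ (abs_eigenvalue_le hφ i)
    have h6 := poisson_le_indicator_add hη (by positivity : 0 < 8 * C₀ ^ 2) E (ev i)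
    have h7 : 2 / (8 * C₀ ^ 2) ^ 2 * poisson E η (ev i) ≤
        2 / (8 * C₀ ^ 2) ^ 2 * h.eval (ev i) := by gcongr
    linarith
  have h4 := Finset.sum_le_sum fun i (_ : i ∈ Finset.univ) => h3 i
  rw [Finset.sum_add_distrib, Finset.sum_add_distrib, ← Finset.mul_sum, Finset.sum_const,
    Finset.card_univ, Fintype.card_fin, nsmul_eq_mul] at h4
  have h5 : ∑ i, (Set.Icc (E - η) (E + η)).indicator (1 : ℝ → ℝ) (ev i) =
      (indices ev (Set.Icc (E - η) (E + η))).card := by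
    classical
    simp only [Set.indicator_apply, Pi.one_apply, indices]
    rw [Finset.sum_boole]
    congr
  rw [h5] at h4
  have h6 : ∑ i, h.eval (ev i) ≤ N * ((C₀ + θ) * η + θ * η') := by
    have := mul_le_mul_of_nonneg_left H.coeff_one_le hN
    linarith
  have h7 : N * ((C₀⁻¹ - θ) * η' - θ * η') ≤ ∑ i, h'.eval (ev i) := by
    have := mul_le_mul_of_nonneg_left H'.le_coeff_one hN
    linarith
  have h8 : 2 / (8 * C₀ ^ 2) ^ 2 * ∑ i, h.eval (ev i) ≤
      2 / (8 * C₀ ^ 2) ^ 2 * (N * ((C₀ + θ) * η + θ * η')) := by gcongr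
  -- In units of `N η / C₀³`: the mass `1/8` pays for the claimed `1/16`, the tail `1/32`, and the
  -- errors due to `θ`.
  have h9 : N * (η / (16 * C₀ ^ 3)) + N * (θ * η') + 2 / (8 * C₀ ^ 2) ^ 2 *
      (N * ((C₀ + θ) * η + θ * η')) ≤ N * ((C₀⁻¹ - θ) * η' - θ * η') := by
    have e1 : (C₀⁻¹ - θ) * η' - θ * η' - η / (16 * C₀ ^ 3) - θ * η' - 2 / (8 * C₀ ^ 2) ^ 2 *
      ((C₀ + θ) * η + θ * η') = η / (C₀ ^ 3) *
        (1 / 8 - 1 / 128 - 1 / 128 - 1 / 16 - 1 / 128 - 1 / 32 - 1 / (512 * C₀ ^ 2) -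
          1 / (4096 * C₀ ^ 4)) := by
      rw [hθ, hη']
      field_simp
      ring
    have e2 : 1 / (512 * C₀ ^ 2) ≤ 1 / 512 := by
      apply one_div_le_one_div_of_le (by norm_num)
      nlinarith
    have e3 : 1 / (4096 * C₀ ^ 4) ≤ 1 / 4096 := by
      apply one_div_le_one_div_of_le (by norm_num)
      have := one_le_pow₀ hC₀ (n := 4)
      linarith
    have e4 : 0 ≤ η / (C₀ ^ 3) *
        (1 / 8 - 1 / 128 - 1 / 128 - 1 / 16 - 1 / 128 - 1 / 32 - 1 / (512 * C₀ ^ 2) -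
          1 / (4096 * C₀ ^ 4)) := by
      apply mul_nonneg (by positivity)
      linarith
    rw [← e1] at e4
    nlinarith [mul_nonneg hN e4]
  linarith

/-- On a doubled window the Poisson kernel is at least `1/5`, and the approximants lie above it;
this gives `25 = 5²`. Their nonnegativity allows the sums to be extended to all eigenvalues, where
they form a trace. -/
theorem sum_window_le (hS : Subgroup.closure (S : Set Γ) = ⊤) (hθ0 : 0 ≤ θ) (hθ : θ ≤ 1)
    {E₁ E₂ η : ℝ} (hη : 0 < η) {h₁ h₂ : Polynomial ℝ}
    (H₁ : IsApproximant S p L B n C₀ κ γ CW θ E₁ η h₁)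
    (H₂ : IsApproximant S p L B n C₀ κ γ CW θ E₂ η h₂)
    {ρ : Γ →* Equiv.Perm (Fin N)}
    {φ : OrthonormalBasis (Fin N) ℂ (EuclideanSpace ℂ (Fin N))} {ev : Fin N → ℝ}
    (hφ : IsEigenbasis (permAlg ρ p) φ ev) {r : ℕ} {g : Γ} (hr : wordLength S g + L * n ≤ r)
    {a : Fin N → ℂ} (ha : ∀ x, ‖a x‖ ≤ 2) :
    ∑ i ∈ indices ev (Set.Icc (E₁ - 2 * η) (E₁ + 2 * η)),
      ∑ j ∈ indices ev (Set.Icc (E₂ - 2 * η) (E₂ + 2 * η)),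
        ‖inner ℂ (φ j) (Matrix.toEuclideanCLM (𝕜 := ℂ)
          (permMat ρ g * Matrix.diagonal a) (φ i))‖ ^ 2 ≤
      25 * (‖star a ⬝ᵥ
        (permAlg ρ (schurTwist g (polyAlg Γ p h₁) (polyAlg Γ p h₂)) *ᵥ a)‖ +
        16 * ((bad S ρ r).card * (B : ℝ) ^ n)) := by
  set Bm := permMat ρ g * Matrix.diagonal a with hBm
  set c : Fin N → Fin N → ℝ := fun i j =>
    ‖inner ℂ (φ j) (Matrix.toEuclideanCLM (𝕜 := ℂ) Bm (φ i))‖ ^ 2 with hc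
  have hc0 : ∀ i j, 0 ≤ c i j := fun i j => by positivity
  have h1 := sum_eigenvalues_mul_norm_inner_sq φ
    (toEuclideanCLM_permAlg_polyAlg hφ h₁) (toEuclideanCLM_permAlg_polyAlg hφ h₂) Bm
  have hp₁ : ∀ i, 0 ≤ h₁.eval (ev i) := fun i =>
    (poisson_nonneg _ _ _).trans (H₁.poisson_le _ (abs_eigenvalue_le hφ i))
  have hp₂ : ∀ i, 0 ≤ h₂.eval (ev i) := fun i =>
    (poisson_nonneg _ _ _).trans (H₂.poisson_le _ (abs_eigenvalue_le hφ i))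
  have hterm : ∀ i j, 0 ≤ h₁.eval (ev i) * (h₂.eval (ev j) * c i j) := fun i j =>
    mul_nonneg (hp₁ i) (mul_nonneg (hp₂ j) (hc0 i j))
  have h2 : ∑ i ∈ indices ev (Set.Icc (E₁ - 2 * η) (E₁ + 2 * η)),
      ∑ j ∈ indices ev (Set.Icc (E₂ - 2 * η) (E₂ + 2 * η)), c i j ≤
      25 * ∑ i, ∑ j, h₁.eval (ev i) * (h₂.eval (ev j) * c i j) := by
    calc _ ≤ ∑ i ∈ indices ev (Set.Icc (E₁ - 2 * η) (E₁ + 2 * η)),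
          ∑ j ∈ indices ev (Set.Icc (E₂ - 2 * η) (E₂ + 2 * η)),
            25 * (h₁.eval (ev i) * (h₂.eval (ev j) * c i j)) := by
          refine Finset.sum_le_sum fun i hi => Finset.sum_le_sum fun j hj => ?_
          have e1 := one_le_five_mul_poisson hη (mem_indices.1 hi)
          have e2 := one_le_five_mul_poisson hη (mem_indices.1 hj)
          have e3 := H₁.poisson_le _ (abs_eigenvalue_le hφ i)
          have e4 := H₂.poisson_le _ (abs_eigenvalue_le hφ j)
          have e5 : 1 ≤ (5 * h₁.eval (ev i)) * (5 * h₂.eval (ev j)) :=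
            one_le_mul_of_one_le_of_one_le (by linarith) (by linarith)
          calc c i j = 1 * c i j := (one_mul _).symm
            _ ≤ (5 * h₁.eval (ev i)) * (5 * h₂.eval (ev j)) * c i j := by
              gcongr
            _ = _ := by ring
      _ ≤ ∑ i ∈ indices ev (Set.Icc (E₁ - 2 * η) (E₁ + 2 * η)),
          ∑ j, 25 * (h₁.eval (ev i) * (h₂.eval (ev j) * c i j)) := by
          refine Finset.sum_le_sum fun i _ => ?_
          exact Finset.sum_le_sum_of_subset_of_nonneg (Finset.subset_univ _)
            fun j _ _ => mul_nonneg (by norm_num) (hterm i j)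
      _ ≤ ∑ i, ∑ j, 25 * (h₁.eval (ev i) * (h₂.eval (ev j) * c i j)) :=
          Finset.sum_le_sum_of_subset_of_nonneg (Finset.subset_univ _)
            fun i _ _ => Finset.sum_nonneg fun j _ => mul_nonneg (by norm_num) (hterm i j)
      _ = _ := by simp only [Finset.mul_sum]
  refine h2.trans ?_
  gcongr
  have h3 := norm_trace_twisted_sub_le hS ρ (r := r) g ha (q₁ := polyAlg Γ p h₁)
    (q₂ := polyAlg Γ p h₂) fun k hk h hh => by
      have := H₁.wordLength_le k hk
      have := H₂.wordLength_le h hh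
      lia
  rw [← hBm, ← h1] at h3
  -- Each `ℓ¹` norm loses only the square root of the size of its support.
  have h4 : l1Norm (polyAlg Γ p h₁) * l1Norm (polyAlg Γ p h₂) ≤ 4 * (B : ℝ) ^ n := by
    have e1 : √((B ^ n : ℕ) : ℝ) * √((B ^ n : ℕ) : ℝ) = (B : ℝ) ^ n := by
      rw [Real.mul_self_sqrt (by positivity)]; push_cast; rfl
    calc _ ≤ (√((B ^ n : ℕ) : ℝ) * 2) * (√((B ^ n : ℕ) : ℝ) * 2) := by
          gcongr
          · exact l1Norm_nonneg _
          · exact H₁.l1Norm_le hθ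
          · exact H₂.l1Norm_le hθ
      _ = 4 * (√((B ^ n : ℕ) : ℝ) * √((B ^ n : ℕ) : ℝ)) := by ring
      _ = _ := by rw [e1]
  have h5 : (bad S ρ r).card * ((2 : ℝ) ^ 2 * (l1Norm (polyAlg Γ p h₁) *
      l1Norm (polyAlg Γ p h₂))) ≤ 16 * ((bad S ρ r).card * (B : ℝ) ^ n) := by
    calc _ ≤ (bad S ρ r).card * ((2 : ℝ) ^ 2 * (4 * (B : ℝ) ^ n)) := by gcongr
      _ = _ := by ring
  have h6 := (norm_le_norm_add_norm_sub' _ _).trans (add_le_add le_rfl (h3.trans h5))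
  rw [Complex.norm_real] at h6
  exact (le_abs_self _).trans h6

theorem exists_norm_schurTwist_le (hS : Subgroup.closure (S : Set Γ) = ⊤) {C₁ : ℝ}
    (hRD : HasRapidDecay Γ C₁) (hκ : 2 * C₁ + 1 < κ) (hCW : 0 < CW) (T : Finset Γ) :
    ∃ C : ℝ, 0 < C ∧ ∀ (L B n : ℕ) (E₁ E₂ η : ℝ) (h₁ h₂ : Polynomial ℝ), 0 < η →
      IsApproximant S p L B n C₀ κ γ CW θ E₁ η h₁ → IsApproximant S p L B n C₀ κ γ CW θ E₂ η h₂ →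
      ∀ g ∈ T, ‖leftRegAlg (schurTwist g (polyAlg Γ p h₁) (polyAlg Γ p h₂))‖ ≤
        C * η ^ ((3 + γ) / 2) := by
  have hκ0 : 0 < κ := by have := hRD.1; linarith
  obtain ⟨C, hC, hC'⟩ := exists_norm_leftRegAlg_le_weighted hS hRD hκ
  set LT : ℕ := T.sup (wordLength S) with hLT
  refine ⟨C * √(CW + (1 + 2 * LT : ℝ) ^ κ * CW), by positivity, ?_⟩
  intro L B n E₁ E₂ η h₁ h₂ hη H₁ H₂ g hg
  refine (hC' _).trans ?_
  rw [mul_assoc]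
  gcongr
  have hgT : (wordLength S g : ℝ) ≤ LT := by exact_mod_cast Finset.le_sup hg
  have h1 := (sum_weighted_sq_schurTwist_le hS g (polyAlg Γ p h₁) (polyAlg Γ p h₂) hκ0).trans
    (add_le_add H₁.moment (mul_le_mul_of_nonneg_left H₂.moment (by positivity)))
  have h2 : CW * η ^ (3 + γ) + (1 + 2 * wordLength S g : ℝ) ^ κ * (CW * η ^ (3 + γ)) ≤
      (CW + (1 + 2 * LT : ℝ) ^ κ * CW) * (η ^ ((3 + γ) / 2)) ^ 2 := by
    rw [← Real.rpow_natCast, ← Real.rpow_mul hη.le]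
    rw [show (3 + γ) / 2 * ((2 : ℕ) : ℝ) = 3 + γ by push_cast; ring]
    have : (1 + 2 * wordLength S g : ℝ) ^ κ * (CW * η ^ (3 + γ)) ≤
        (1 + 2 * LT : ℝ) ^ κ * (CW * η ^ (3 + γ)) := by gcongr
    linarith
  calc _ ≤ √((CW + (1 + 2 * LT : ℝ) ^ κ * CW) * (η ^ ((3 + γ) / 2)) ^ 2) :=
        Real.sqrt_le_sqrt (h1.trans h2)
    _ = _ := by
      rw [Real.sqrt_mul (by positivity), Real.sqrt_sq (by positivity)]

end Windows

/-! ### Decomposition of local observables -/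

section Observables

open scoped Matrix

variable {Γ : Type*} [Group Γ] {N : ℕ}

/-- The function `x ↦ K(g.x, x)`, minus its average. -/
def centeredVec (ρ : Γ →* Equiv.Perm (Fin N)) (K : Matrix (Fin N) (Fin N) ℂ) (g : Γ) :
    Fin N → ℂ :=
  fun x => K (ρ g x) x - (N : ℂ)⁻¹ * ∑ y, K (ρ g y) y

/-- The difference between `K` and `∑_{g ∈ T} ρ(g) k_g`, where `k_g(x) = K(g.x, x)`. -/
def localError (ρ : Γ →* Equiv.Perm (Fin N)) (T : Finset Γ) (K : Matrix (Fin N) (Fin N) ℂ) :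
    Matrix (Fin N) (Fin N) ℂ :=
  K - ∑ g ∈ T, permMat ρ g * Matrix.diagonal fun x => K (ρ g x) x

theorem average_eq (ρ : Γ →* Equiv.Perm (Fin N)) (T : Finset Γ) (K : Matrix (Fin N) (Fin N) ℂ) :
    average ρ T K = ∑ g ∈ T, ((N : ℂ)⁻¹ * ∑ x, K (ρ g x) x) • permMat ρ g := by
  rw [average, ← permAlgHom_apply, map_sum]
  exact Finset.sum_congr rfl fun g _ => permAlgHom_single _ _ _

theorem sub_average_eq (ρ : Γ →* Equiv.Perm (Fin N)) (T : Finset Γ)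
    (K : Matrix (Fin N) (Fin N) ℂ) : K - average ρ T K =
      localError ρ T K + ∑ g ∈ T, permMat ρ g * Matrix.diagonal (centeredVec ρ K g) := by
  have h : ∀ g, permMat ρ g * Matrix.diagonal (centeredVec ρ K g) =
      (permMat ρ g * Matrix.diagonal fun x => K (ρ g x) x) -
        ((N : ℂ)⁻¹ * ∑ x, K (ρ g x) x) • permMat ρ g := by
    intro g
    ext x y
    simp only [Matrix.mul_diagonal, Matrix.sub_apply, Matrix.smul_apply, centeredVec, smul_eq_mul]
    ring
  simp only [h, Finset.sum_sub_distrib, average_eq, localError]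
  abel

theorem norm_average_coeff_le {ρ : Γ →* Equiv.Perm (Fin N)} {K : Matrix (Fin N) (Fin N) ℂ}
    (hK : ∀ x y, ‖K x y‖ ≤ 1) (g : Γ) : ‖(N : ℂ)⁻¹ * ∑ x, K (ρ g x) x‖ ≤ 1 := by
  rw [norm_mul, norm_inv, Complex.norm_natCast]
  have h1 : ‖∑ x, K (ρ g x) x‖ ≤ N := by
    refine (norm_sum_le _ _).trans ((Finset.sum_le_sum fun x _ => hK _ x).trans ?_)
    simp
  rcases Nat.eq_zero_or_pos N with rfl | hN
  · simp
  · rw [inv_mul_le_iff₀ (by exact_mod_cast hN), mul_one]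
    exact h1

theorem norm_centeredVec_le {ρ : Γ →* Equiv.Perm (Fin N)} {K : Matrix (Fin N) (Fin N) ℂ}
    (hK : ∀ x y, ‖K x y‖ ≤ 1) (g : Γ) (x : Fin N) : ‖centeredVec ρ K g x‖ ≤ 2 := by
  refine (norm_sub_le _ _).trans ?_
  linarith [hK (ρ g x) x, norm_average_coeff_le (ρ := ρ) hK g]

/-- The error at `(x, y)` is `K(x, y)` times one minus the number of `g ∈ T` with `x = g.y`. It
vanishes unless two elements of `T` send `y` to the same point. -/
theorem sum_norm_localError_sq_le {S : Finset Γ} (hS : Subgroup.closure (S : Set Γ) = ⊤)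
    {ρ : Γ →* Equiv.Perm (Fin N)} {T : Finset Γ} {K : Matrix (Fin N) (Fin N) ℂ}
    (hK : IsLocalObservable ρ T K) {r : ℕ} (hr : ∀ g ∈ T, wordLength S g ≤ r) :
    ∑ y, ∑ x, ‖localError ρ T K x y‖ ^ 2 ≤ (bad S ρ r).card * (T.card : ℝ) ^ 3 := by
  classical
  have hentry : ∀ x y, localError ρ T K x y =
      K x y * (1 - ((T.filter fun g => x = ρ g y).card : ℂ)) := by
    intro x y
    rw [localError, Matrix.sub_apply, Matrix.sum_apply, mul_sub, mul_one, ← nsmul_eq_mul',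
      ← Finset.sum_const, Finset.sum_filter]
    congr 1
    refine Finset.sum_congr rfl fun g _ => ?_
    rw [Matrix.mul_diagonal, permMat_apply]
    split_ifs with h
    · rw [h, one_mul]
    · rw [zero_mul]
  have hle : ∀ x y, ‖localError ρ T K x y‖ ^ 2 ≤
      (if y ∈ bad S ρ r then 1 else 0) *
        ((T.card : ℝ) ^ 2 * ((T.filter fun g => x = ρ g y).card : ℝ)) := by
    intro x y
    rw [hentry]
    set k := (T.filter fun g => x = ρ g y).card with hk
    have hkT : k ≤ T.card := Finset.card_filter_le _ _
    rcases Nat.eq_zero_or_pos k with h0 | hpos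
    · have : K x y = 0 := by
        refine hK.1 x y fun ⟨g, hg, hx⟩ => ?_
        rw [hk, Finset.card_eq_zero] at h0
        exact Finset.notMem_empty g (h0 ▸ Finset.mem_filter.2 ⟨hg, hx⟩)
      rw [this, zero_mul, norm_zero, zero_pow two_ne_zero]
      positivity
    · rcases Nat.lt_or_ge 1 k with h1 | h1
      -- If `g.y = h.y` with `g ≠ h` in `T`, then `h⁻¹g` is nontrivial, fixes `y`, and has length at
      -- most `2r`.
      · have hbad : y ∈ bad S ρ r := by
          obtain ⟨g, hg, h, hh, hne⟩ := Finset.one_lt_card.1 h1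
          rw [Finset.mem_filter] at hg hh
          refine mem_bad (g := h⁻¹ * g) (fun he => hne (inv_mul_eq_one.1 he).symm) ?_ ?_
          · have e1 := wordLength_mul_le hS h⁻¹ g
            rw [wordLength_inv hS] at e1
            have e2 := hr g hg.1
            have e3 := hr h hh.1
            lia
          · rw [map_mul, Equiv.Perm.mul_apply, ← hg.2, map_inv, Equiv.Perm.inv_eq_iff_eq]
            exact hh.2
        rw [if_pos hbad, one_mul, norm_mul, mul_pow]
        have e1 : ‖K x y‖ ^ 2 ≤ 1 := pow_le_one₀ (norm_nonneg _) (hK.2 x y)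
        have e2 : ‖1 - (k : ℂ)‖ ≤ T.card := by
          have : (1 : ℂ) - k = -(((k - 1 : ℕ) : ℕ) : ℂ) := by
            push_cast [hpos]; ring
          rw [this, norm_neg, Complex.norm_natCast]
          exact_mod_cast (by lia : k - 1 ≤ T.card)
        have e3 : (1 : ℝ) ≤ k := by exact_mod_cast hpos
        calc ‖K x y‖ ^ 2 * ‖1 - (k : ℂ)‖ ^ 2 ≤ 1 * (T.card : ℝ) ^ 2 := by gcongr
          _ ≤ _ := by nlinarith [sq_nonneg (T.card : ℝ)]
      · have : k = 1 := by lia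
        rw [this]
        simp only [Nat.cast_one, sub_self, mul_zero, norm_zero, ne_eq, OfNat.ofNat_ne_zero,
          not_false_eq_true, zero_pow]
        positivity
  have hcount : ∀ y, ∑ x, ((T.filter fun g => x = ρ g y).card : ℝ) = T.card := by
    intro y
    have := Finset.card_eq_sum_card_fiberwise (s := T) (t := Finset.univ) (f := fun g => ρ g y)
      (fun _ _ => by simp)
    rw [this]
    push_cast
    exact Finset.sum_congr rfl fun x _ => by simp only [eq_comm]
  calc _ ≤ ∑ y, ∑ x, (if y ∈ bad S ρ r then (1 : ℝ) else 0) *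
        ((T.card : ℝ) ^ 2 * ((T.filter fun g => x = ρ g y).card : ℝ)) :=
        Finset.sum_le_sum fun y _ => Finset.sum_le_sum fun x _ => hle x y
    _ = _ := by
        simp only [← Finset.mul_sum, hcount]
        rw [← Finset.sum_mul, Finset.sum_ite_mem, Finset.univ_inter, Finset.sum_const,
          nsmul_eq_mul, mul_one]
        ring

theorem centeredCoeff_eq (ρ : Γ →* Equiv.Perm (Fin N)) (T : Finset Γ)
    (K : Matrix (Fin N) (Fin N) ℂ)
    (φ : OrthonormalBasis (Fin N) ℂ (EuclideanSpace ℂ (Fin N))) (j i : Fin N) :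
    centeredCoeff ρ T K φ j i =
      inner ℂ (φ j) (Matrix.toEuclideanCLM (𝕜 := ℂ) (localError ρ T K) (φ i)) +
      ∑ g ∈ T, inner ℂ (φ j) (Matrix.toEuclideanCLM (𝕜 := ℂ)
        (permMat ρ g * Matrix.diagonal (centeredVec ρ K g)) (φ i)) := by
  rw [centeredCoeff, ← inner_sub_right, ← inner_sum, ← inner_add_right]
  congr 1
  have h := congrArg (fun M => Matrix.toEuclideanCLM (𝕜 := ℂ) M (φ i)) (sub_average_eq ρ T K)
  simp only [map_sub, map_add, map_sum] at h
  simpa using h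

theorem sum_norm_centeredCoeff_sq_le {S : Finset Γ} (hS : Subgroup.closure (S : Set Γ) = ⊤)
    {ρ : Γ →* Equiv.Perm (Fin N)} {T : Finset Γ} {K : Matrix (Fin N) (Fin N) ℂ}
    (hK : IsLocalObservable ρ T K) {r : ℕ} (hr : ∀ g ∈ T, wordLength S g ≤ r)
    (φ : OrthonormalBasis (Fin N) ℂ (EuclideanSpace ℂ (Fin N))) (I₁ I₂ : Finset (Fin N)) :
    ∑ i ∈ I₁, ∑ j ∈ I₂, ‖centeredCoeff ρ T K φ j i‖ ^ 2 ≤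
      2 * ((bad S ρ r).card * (T.card : ℝ) ^ 3) +
      2 * T.card * ∑ g ∈ T, ∑ i ∈ I₁, ∑ j ∈ I₂, ‖inner ℂ (φ j) (Matrix.toEuclideanCLM (𝕜 := ℂ)
        (permMat ρ g * Matrix.diagonal (centeredVec ρ K g)) (φ i))‖ ^ 2 := by
  set e : Fin N → Fin N → ℂ := fun i j =>
    inner ℂ (φ j) (Matrix.toEuclideanCLM (𝕜 := ℂ) (localError ρ T K) (φ i)) with he
  set b : Γ → Fin N → Fin N → ℂ := fun g i j =>
    inner ℂ (φ j) (Matrix.toEuclideanCLM (𝕜 := ℂ)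
        (permMat ρ g * Matrix.diagonal (centeredVec ρ K g)) (φ i)) with hb
  have h1 : ∀ i j, ‖centeredCoeff ρ T K φ j i‖ ^ 2 ≤
      2 * ‖e i j‖ ^ 2 + 2 * T.card * ∑ g ∈ T, ‖b g i j‖ ^ 2 := by
    intro i j
    rw [centeredCoeff_eq]
    have h2 : ‖e i j + ∑ g ∈ T, b g i j‖ ≤ ‖e i j‖ + ∑ g ∈ T, ‖b g i j‖ :=
      (norm_add_le _ _).trans (add_le_add le_rfl (norm_sum_le _ _))
    have h3 : (∑ g ∈ T, ‖b g i j‖) ^ 2 ≤ T.card * ∑ g ∈ T, ‖b g i j‖ ^ 2 :=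
      sq_sum_le_card_mul_sum_sq
    have h4 := pow_le_pow_left₀ (norm_nonneg _) h2 2
    have h5 := sq_nonneg (‖e i j‖ - ∑ g ∈ T, ‖b g i j‖)
    change ‖e i j + ∑ g ∈ T, b g i j‖ ^ 2 ≤ _
    nlinarith
  have h6 : ∑ i ∈ I₁, ∑ j ∈ I₂, ‖e i j‖ ^ 2 ≤ (bad S ρ r).card * (T.card : ℝ) ^ 3 := by
    refine le_trans ?_ (sum_norm_localError_sq_le hS hK hr)
    rw [← sum_norm_inner_sq_eq φ]
    refine (Finset.sum_le_sum fun i _ => Finset.sum_le_sum_of_subset_of_nonneg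
      (Finset.subset_univ I₂) fun j _ _ => by positivity).trans ?_
    exact Finset.sum_le_sum_of_subset_of_nonneg (Finset.subset_univ _)
      fun i _ _ => Finset.sum_nonneg fun j _ => by positivity
  refine (Finset.sum_le_sum fun i _ => Finset.sum_le_sum fun j _ => h1 i j).trans ?_
  have h7 : ∑ i ∈ I₁, ∑ j ∈ I₂, ∑ g ∈ T, ‖b g i j‖ ^ 2 =
      ∑ g ∈ T, ∑ i ∈ I₁, ∑ j ∈ I₂, ‖b g i j‖ ^ 2 := by
    rw [Finset.sum_comm' (t' := T) (s' := fun _ => I₁) (by simp [and_comm])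
      |> fun h => (Finset.sum_congr rfl fun i _ => Finset.sum_comm).trans h]
  simp only [Finset.sum_add_distrib, ← Finset.mul_sum]
  rw [h7]
  linarith

/-! ### Bounds on the norm of observables -/

theorem norm_toEuclideanCLM_local_le {ρ : Γ →* Equiv.Perm (Fin N)} {T : Finset Γ}
    {K : Matrix (Fin N) (Fin N) ℂ} (hK : IsLocalObservable ρ T K)
    (v : EuclideanSpace ℂ (Fin N)) :
    ‖Matrix.toEuclideanCLM (𝕜 := ℂ) K v‖ ≤ T.card * ‖v‖ := by
  classical
  have h1 : ∀ x, ‖(K *ᵥ v.ofLp) x‖ ≤ ∑ g ∈ T, ‖v (ρ g⁻¹ x)‖ := by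
    intro x
    calc ‖(K *ᵥ v.ofLp) x‖ ≤ ∑ y, ‖K x y * v y‖ :=
          norm_sum_le Finset.univ fun y => K x y * v y
      _ ≤ ∑ y, ∑ g ∈ T, if y = ρ g⁻¹ x then ‖v y‖ else 0 := by
        refine Finset.sum_le_sum fun y _ => ?_
        by_cases hy : ∃ g ∈ T, x = ρ g y
        · obtain ⟨g, hg, hx⟩ := hy
          have : y = ρ g⁻¹ x := by rw [map_inv, Equiv.Perm.eq_inv_iff_eq, hx]
          refine le_trans ?_ (Finset.single_le_sum (f := fun g => if y = ρ g⁻¹ x then ‖v y‖ else 0)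
            (fun g _ => by positivity) hg)
          rw [if_pos this, norm_mul]
          exact mul_le_of_le_one_left (norm_nonneg _) (hK.2 x y)
        · rw [hK.1 x y hy, zero_mul, norm_zero]
          exact Finset.sum_nonneg fun g _ => by positivity
      _ = _ := by
        rw [Finset.sum_comm]
        exact Finset.sum_congr rfl fun g _ => by simp
  have h2 : ‖Matrix.toEuclideanCLM (𝕜 := ℂ) K v‖ ^ 2 ≤ (T.card * ‖v‖) ^ 2 := by
    rw [EuclideanSpace.norm_sq_eq, mul_pow, EuclideanSpace.norm_sq_eq]
    calc _ ≤ ∑ x, T.card * ∑ g ∈ T, ‖v (ρ g⁻¹ x)‖ ^ 2 := by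
          refine Finset.sum_le_sum fun x _ => ?_
          exact (pow_le_pow_left₀ (norm_nonneg _) (h1 x) 2).trans sq_sum_le_card_mul_sum_sq
      _ = T.card * ∑ g ∈ T, ∑ x, ‖v (ρ g⁻¹ x)‖ ^ 2 := by
          rw [← Finset.mul_sum, Finset.sum_comm]
      _ = T.card * ∑ g ∈ T, ∑ x, ‖v x‖ ^ 2 := by
          congr 1
          exact Finset.sum_congr rfl fun g _ => Equiv.sum_comp (ρ g⁻¹) fun x => ‖v x‖ ^ 2
      _ = _ := by
          rw [Finset.sum_const, nsmul_eq_mul]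
          ring
  exact le_of_sq_le_sq h2 (by positivity)

/-- By Parseval the sum is `‖(K - ⟨K⟩) φ_i‖²`. This trivial bound handles the `N` for which `η` is
not small. -/
theorem sum_norm_centeredCoeff_sq_le_card {ρ : Γ →* Equiv.Perm (Fin N)} {T : Finset Γ}
    {K : Matrix (Fin N) (Fin N) ℂ} (hK : IsLocalObservable ρ T K)
    (φ : OrthonormalBasis (Fin N) ℂ (EuclideanSpace ℂ (Fin N))) (i : Fin N) :
    ∑ j, ‖centeredCoeff ρ T K φ j i‖ ^ 2 ≤ (2 * T.card : ℝ) ^ 2 := by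
  simp only [centeredCoeff, ← inner_sub_right]
  rw [φ.sum_sq_norm_inner_right]
  refine pow_le_pow_left₀ (norm_nonneg _) ?_ 2
  refine (norm_sub_le _ _).trans ?_
  have h1 := norm_toEuclideanCLM_local_le hK (φ i)
  rw [φ.norm_eq_one, mul_one] at h1
  have h2 : ‖Matrix.toEuclideanCLM (𝕜 := ℂ) (average ρ T K) (φ i)‖ ≤ T.card := by
    rw [average_eq, map_sum]
    simp only [map_smul, FunLike.coe_sum, Finset.sum_apply, FunLike.coe_smul, Pi.smul_apply]
    refine (norm_sum_le _ _).trans ((Finset.sum_le_sum fun g _ => ?_).trans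
      (le_of_eq (Finset.sum_const (1 : ℝ)) |>.trans (by simp)))
    rw [norm_smul, norm_toEuclideanCLM_permMat, φ.norm_eq_one, mul_one]
    exact norm_average_coeff_le hK.2 g
  linarith

theorem varianceBounds_of_le {ρ : Γ →* Equiv.Perm (Fin N)} (p : MonoidAlgebra ℂ Γ) (a b : ℝ)
    {T : Finset Γ} {K : Matrix (Fin N) (Fin N) ℂ} (hK : IsLocalObservable ρ T K) (η : ℝ) {δ : ℝ}
    (hδ : (2 * T.card : ℝ) ^ 2 ≤ δ) : VarianceBounds ρ p a b T K η δ := by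
  have key : ∀ (s : Finset (Fin N)) (f : Fin N → ℝ), (∀ i ∈ s, f i ≤ (2 * T.card : ℝ) ^ 2) →
      (s.card : ℝ)⁻¹ * ∑ i ∈ s, f i ≤ δ := by
    intro s f hf
    have h1 := Finset.sum_le_sum hf
    rw [Finset.sum_const, nsmul_eq_mul] at h1
    rcases s.eq_empty_or_nonempty with rfl | hs
    · simp only [Finset.sum_empty, mul_zero]
      exact le_trans (by positivity) hδ
    · have : (0 : ℝ) < s.card := by exact_mod_cast hs.card_pos
      rw [inv_mul_le_iff₀ this]
      exact h1.trans (by gcongr)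
  intro φ ev hφ
  refine ⟨fun E₁ _ E₂ _ => key _ _ fun i _ => ?_, key _ _ fun i _ => ?_⟩
  · exact (Finset.sum_le_sum_of_subset_of_nonneg (Finset.subset_univ _)
      fun j _ _ => by positivity).trans (sum_norm_centeredCoeff_sq_le_card hK φ i)
  · exact (Finset.single_le_sum (f := fun j => ‖centeredCoeff ρ T K φ j i‖ ^ 2)
      (fun j _ => by positivity) (Finset.mem_univ i)).trans
      (sum_norm_centeredCoeff_sq_le_card hK φ i)

end Observables

/-! ### From quadratic forms to variances -/

section Variance

open scoped Matrix

/-- A net of mesh `η` in the interval `[a₁, a₂]`. -/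
def energyNet (a₁ a₂ η : ℝ) : Finset ℝ :=
  open Classical in (Finset.range (⌊(a₂ - a₁) / η⌋₊ + 1)).image fun k : ℕ => a₁ + k * η

theorem mem_Icc_of_mem_energyNet {a₁ a₂ η E : ℝ} (ha : a₁ < a₂) (hη : 0 < η)
    (hE : E ∈ energyNet a₁ a₂ η) : E ∈ Set.Icc a₁ a₂ := by
  classical
  obtain ⟨k, hk, rfl⟩ := Finset.mem_image.1 hE
  have h1 : k ≤ ⌊(a₂ - a₁) / η⌋₊ := by
    have := Finset.mem_range.1 hk
    lia
  have h2 : (k : ℝ) ≤ (a₂ - a₁) / η :=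
    (Nat.cast_le.2 h1).trans (Nat.floor_le (div_nonneg (by linarith) hη.le))
  rw [le_div_iff₀ hη] at h2
  exact ⟨le_add_of_nonneg_right (by positivity), by linarith⟩

theorem exists_mem_energyNet {a₁ a₂ η E : ℝ} (hη : 0 < η) (hE : E ∈ Set.Icc a₁ a₂) :
    ∃ E' ∈ energyNet a₁ a₂ η, |E - E'| ≤ η := by
  classical
  have h0 : 0 ≤ (E - a₁) / η := div_nonneg (by linarith [hE.1]) hη.le
  refine ⟨a₁ + ⌊(E - a₁) / η⌋₊ * η, Finset.mem_image.2 ⟨⌊(E - a₁) / η⌋₊, ?_, rfl⟩, ?_⟩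
  · rw [Finset.mem_range, Nat.lt_succ_iff]
    apply Nat.floor_le_floor
    gcongr
    exact hE.2
  · have h1 := Nat.floor_le h0
    have h2 := Nat.lt_floor_add_one ((E - a₁) / η)
    rw [le_div_iff₀ hη] at h1
    rw [div_lt_iff₀ hη] at h2
    rw [abs_le]
    constructor <;> linarith

theorem card_energyNet_le {a₁ a₂ η : ℝ} (ha : a₁ < a₂) (hη : 0 < η) (hη₁ : η ≤ 1) :
    ((energyNet a₁ a₂ η).card : ℝ) ≤ (a₂ - a₁ + 1) / η := by
  classical
  have h1 : ((energyNet a₁ a₂ η).card : ℝ) ≤ ⌊(a₂ - a₁) / η⌋₊ + 1 := by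
    have := Finset.card_image_le (s := Finset.range (⌊(a₂ - a₁) / η⌋₊ + 1))
      (f := fun k : ℕ => a₁ + k * η)
    rw [Finset.card_range] at this
    exact_mod_cast this
  have h2 := Nat.floor_le (div_nonneg (by linarith : 0 ≤ a₂ - a₁) hη.le)
  have h3 : 1 ≤ 1 / η := by rw [le_div_iff₀ hη]; linarith
  rw [add_div]
  linarith

theorem sum_biUnion_le {ι κ : Type*} [DecidableEq κ] (s : Finset ι) (t : ι → Finset κ)
    {f : κ → ℝ} (hf : ∀ i, 0 ≤ f i) : ∑ i ∈ s.biUnion t, f i ≤ ∑ k ∈ s, ∑ i ∈ t k, f i := by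
  classical
  induction s using Finset.induction_on with
  | empty => simp
  | insert a s ha ih =>
    rw [Finset.biUnion_insert, Finset.sum_insert ha]
    have h := Finset.sum_union_inter (s₁ := t a) (s₂ := s.biUnion t) (f := f)
    have h' : 0 ≤ ∑ i ∈ t a ∩ s.biUnion t, f i := Finset.sum_nonneg fun i _ => hf i
    linarith

variable {N : ℕ}

theorem indices_subset {ev : Fin N → ℝ} {J J' : Set ℝ} (h : J ⊆ J') :
    indices ev J ⊆ indices ev J' := fun _ hi => mem_indices.2 (h (mem_indices.1 hi))

theorem window_subset {E E' η : ℝ} (h : |E - E'| ≤ η) :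
    Set.Icc (E - η) (E + η) ⊆ Set.Icc (E' - 2 * η) (E' + 2 * η) := by
  rw [abs_le] at h
  exact Set.Icc_subset_Icc (by linarith) (by linarith)

/-- A window at any energy lies in the doubled window of a net point. For ergodicity, about `1/η`
doubled windows cover `[a₁, a₂]` and their diagonal terms add up to `O(N D)`, while the central
window of half-width `η₀` already provides a multiple of `N` eigenvalues. -/
theorem mixing_ergodicity_le {a₁ a₂ η η₀ c D : ℝ} (ha : a₁ < a₂) (hη : 0 < η) (hη₁ : η ≤ 1)
    (hη₀ : 0 < η₀) (hη₀' : η₀ ≤ (a₂ - a₁) / 2) (hη₀1 : η₀ ≤ 1) (hN : 0 < N) (hc : 0 < c)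
    (hD : 0 ≤ D) {ev : Fin N → ℝ}
    (hcount : ∀ E ∈ Set.Icc a₁ a₂, ∀ s : ℝ, s = η ∨ s = η₀ →
      N * (s * c) ≤ (indices ev (Set.Icc (E - s) (E + s))).card)
    (f : Fin N → Fin N → ℝ) (hf : ∀ i j, 0 ≤ f i j)
    (hwin : ∀ E₁ ∈ energyNet a₁ a₂ η, ∀ E₂ ∈ energyNet a₁ a₂ η,
      ∑ i ∈ indices ev (Set.Icc (E₁ - 2 * η) (E₁ + 2 * η)),
        ∑ j ∈ indices ev (Set.Icc (E₂ - 2 * η) (E₂ + 2 * η)), f i j ≤ N * (η * D)) :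
    (∀ E₁ ∈ Set.Icc a₁ a₂, ∀ E₂ ∈ Set.Icc a₁ a₂,
      ((indices ev (Set.Icc (E₁ - η) (E₁ + η))).card : ℝ)⁻¹ *
        ∑ i ∈ indices ev (Set.Icc (E₁ - η) (E₁ + η)),
          ∑ j ∈ indices ev (Set.Icc (E₂ - η) (E₂ + η)), f i j ≤
        (1 + (a₂ - a₁ + 1) / η₀) / c * D) ∧
    ((indices ev (Set.Icc a₁ a₂)).card : ℝ)⁻¹ * ∑ i ∈ indices ev (Set.Icc a₁ a₂), f i i ≤
      (1 + (a₂ - a₁ + 1) / η₀) / c * D := by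
  classical
  have hN0 : (0 : ℝ) < N := by exact_mod_cast hN
  have hq0 : 0 ≤ (a₂ - a₁ + 1) / η₀ := div_nonneg (by linarith) hη₀.le
  constructor
  · intro E₁ hE₁ E₂ hE₂
    obtain ⟨E₁', hE₁', h1⟩ := exists_mem_energyNet hη hE₁
    obtain ⟨E₂', hE₂', h2⟩ := exists_mem_energyNet hη hE₂
    have hcard := hcount E₁ hE₁ η (Or.inl rfl)
    have hpos : 0 < N * (η * c) := by positivity
    have hsum : ∑ i ∈ indices ev (Set.Icc (E₁ - η) (E₁ + η)),
        ∑ j ∈ indices ev (Set.Icc (E₂ - η) (E₂ + η)), f i j ≤ N * (η * D) := by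
      refine le_trans ?_ (hwin E₁' hE₁' E₂' hE₂')
      refine (Finset.sum_le_sum fun i _ => Finset.sum_le_sum_of_subset_of_nonneg
        (indices_subset (window_subset h2)) fun j _ _ => hf i j).trans ?_
      exact Finset.sum_le_sum_of_subset_of_nonneg (indices_subset (window_subset h1))
        fun i _ _ => Finset.sum_nonneg fun j _ => hf i j
    rw [inv_mul_le_iff₀ (hpos.trans_le hcard)]
    calc _ ≤ N * (η * D) := hsum
      _ = N * (η * c) * (1 / c * D) := by field_simp
      _ ≤ _ := by
        gcongr
        exact le_add_of_nonneg_right hq0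
  · have hmid : (a₁ + a₂) / 2 ∈ Set.Icc a₁ a₂ := ⟨by linarith, by linarith⟩
    have hcard : N * (η₀ * c) ≤ (indices ev (Set.Icc a₁ a₂)).card := by
      refine (hcount _ hmid η₀ (Or.inr rfl)).trans ?_
      have := Finset.card_le_card (indices_subset (ev := ev) (Set.Icc_subset_Icc
        (by linarith : a₁ ≤ (a₁ + a₂) / 2 - η₀) (by linarith : (a₁ + a₂) / 2 + η₀ ≤ a₂)))
      exact_mod_cast this
    have hpos : 0 < N * (η₀ * c) := by positivity
    have hsum : ∑ i ∈ indices ev (Set.Icc a₁ a₂), f i i ≤ (a₂ - a₁ + 1) * (N * D) := by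
      have hsub : indices ev (Set.Icc a₁ a₂) ⊆ (energyNet a₁ a₂ η).biUnion fun E =>
          indices ev (Set.Icc (E - 2 * η) (E + 2 * η)) := by
        intro i hi
        obtain ⟨E', hE', h1⟩ := exists_mem_energyNet hη (mem_indices.1 hi)
        refine Finset.mem_biUnion.2 ⟨E', hE', mem_indices.2 (window_subset h1 ?_)⟩
        exact ⟨by linarith, by linarith⟩
      calc _ ≤ ∑ i ∈ (energyNet a₁ a₂ η).biUnion fun E =>
              indices ev (Set.Icc (E - 2 * η) (E + 2 * η)), f i i :=
            Finset.sum_le_sum_of_subset_of_nonneg hsub fun i _ _ => hf i i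
        _ ≤ ∑ E ∈ energyNet a₁ a₂ η,
              ∑ i ∈ indices ev (Set.Icc (E - 2 * η) (E + 2 * η)), f i i :=
            sum_biUnion_le _ _ fun i => hf i i
        _ ≤ ∑ E ∈ energyNet a₁ a₂ η, N * (η * D) := by
            refine Finset.sum_le_sum fun E hE => le_trans ?_ (hwin E hE E hE)
            exact Finset.sum_le_sum fun i hi =>
              Finset.single_le_sum (f := fun j => f i j) (fun j _ => hf i j) hi
        _ = (energyNet a₁ a₂ η).card * (N * (η * D)) := by
            rw [Finset.sum_const, nsmul_eq_mul]
        _ ≤ (a₂ - a₁ + 1) / η * (N * (η * D)) := by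
            gcongr
            exact card_energyNet_le ha hη hη₁
        _ = _ := by field_simp
    rw [inv_mul_le_iff₀ (hpos.trans_le hcard)]
    calc _ ≤ (a₂ - a₁ + 1) * (N * D) := hsum
      _ = N * (η₀ * c) * (((a₂ - a₁ + 1) / η₀) / c * D) := by field_simp
      _ ≤ _ := by
        gcongr
        linarith

variable {Γ : Type*} [Group Γ]

-- The quadratic-form bound is required at net energies only, so finitely many elements matter. The
-- family `q` is fixed before `N`, `ρ` and `K`, as the exceptional subspace must not depend on the
-- observable.
set_option maxHeartbeats 1000000 in
theorem exists_varianceBounds {S : Finset Γ} (hS : Subgroup.closure (S : Set Γ) = ⊤)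
    {C₁ : ℝ} (hRD : HasRapidDecay Γ C₁) {p : MonoidAlgebra ℂ Γ} (hp : IsSelfAdj p)
    {c d C₀ : ℝ} (hC₀ : 1 ≤ C₀) (hAC : DiagonalBound p c d C₀) {a₁ a₂ : ℝ} (hca : c < a₁)
    (ha : a₁ < a₂) (had : a₂ < d) {κ γ CM : ℝ} (hκ : 2 * C₁ + 1 < κ) (hγ₀ : 0 < γ) (hγ₁ : γ ≤ 1)
    (hCM : 0 < CM) (hmom : FourthMomentBound S p a₁ a₂ κ γ CM) (T : Finset Γ) :
    ∃ (L B n₀ : ℕ) (A Cs CV η₀ : ℝ) (q : ℕ → ℝ → ℝ → MonoidAlgebra ℂ Γ),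
      1 ≤ L ∧ 1 ≤ B ∧ 3 ≤ n₀ ∧ 1 ≤ A ∧ 0 < Cs ∧ 0 < CV ∧ 0 < η₀ ∧ η₀ ≤ 1 ∧
      ∀ n : ℕ, n₀ ≤ n → ∀ η : ℝ, η ≤ η₀ → A * Real.log n ≤ η * n →
        (∀ E₁ ∈ Set.Icc a₁ a₂, ∀ E₂ ∈ Set.Icc a₁ a₂, ∀ g ∈ T,
          ‖leftRegAlg (schurTwist g (q n η E₁) (q n η E₂))‖ ≤ Cs * η ^ ((3 + γ) / 2) ∧
          l1Norm (schurTwist g (q n η E₁) (q n η E₂)) ≤ 4 ∧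
          ∀ k ∈ (schurTwist g (q n η E₁) (q n η E₂)).coeff.support, wordLength S k ≤ L * n) ∧
        ∀ (N : ℕ) (ρ : Γ →* Equiv.Perm (Fin N)) (r : ℕ), 0 < N → L * n ≤ r →
          (bad S ρ r).card * (B : ℝ) ^ n ≤ N → ∀ K : Matrix (Fin N) (Fin N) ℂ,
          IsLocalObservable ρ T K → ∀ Q : ℝ, 0 ≤ Q →
          (∀ E₁ ∈ energyNet a₁ a₂ η, ∀ E₂ ∈ energyNet a₁ a₂ η, ∀ g ∈ T,
            ‖star (centeredVec ρ K g) ⬝ᵥ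
              (permAlg ρ (schurTwist g (q n η E₁) (q n η E₂)) *ᵥ centeredVec ρ K g)‖ ≤
              Q * (N * η ^ ((3 + γ) / 2))) →
          VarianceBounds ρ p a₁ a₂ T K η (CV * (Q + 1) * η ^ ((1 + γ) / 2)) := by
  have hκ0 : 0 < κ := by have := hRD.1; linarith
  have hθ0 : 0 < 1 / (16 * C₀) := by positivity
  have hθ1 : 1 / (16 * C₀) ≤ 1 := by
    rw [div_le_one (by positivity)]; linarith
  obtain ⟨L, B, n₀, A, CW, hL, hB, hn₀, hA, hCW, happ⟩ :=
    exists_isApproximant hS hp hκ0 hC₀ hAC hca had hγ₁ hCM hmom hθ0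
  obtain ⟨Cs, hCs, hschur⟩ := exists_norm_schurTwist_le (p := p) (C₀ := C₀) (γ := γ)
    (θ := 1 / (16 * C₀)) hS hRD hκ hCW T
  have hex : ∀ (n : ℕ) (η E : ℝ), ∃ h : Polynomial ℝ, n₀ ≤ n → η ≤ 1 → A * Real.log n ≤ η * n →
      E ∈ Set.Icc a₁ a₂ → IsApproximant S p L B n C₀ κ γ CW (1 / (16 * C₀)) E η h := by
    intro n η E
    by_cases hcond : n₀ ≤ n ∧ η ≤ 1 ∧ A * Real.log n ≤ η * n ∧ E ∈ Set.Icc a₁ a₂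
    · obtain ⟨h, hh⟩ := happ n hcond.1 η hcond.2.1 hcond.2.2.1 E hcond.2.2.2
      exact ⟨h, fun _ _ _ _ => hh⟩
    · exact ⟨0, fun h1 h2 h3 h4 => absurd ⟨h1, h2, h3, h4⟩ hcond⟩
  choose h hh using hex
  set LT : ℕ := T.sup (wordLength S) with hLT
  set M : ℕ := ⌈256 * C₀ ^ 3⌉₊ with hM
  have hM1 : 256 * C₀ ^ 3 ≤ (M : ℝ) := Nat.le_ceil _
  have hC3 : 1 ≤ C₀ ^ 3 := one_le_pow₀ hC₀
  have hM0 : 1 ≤ M := by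
    have : (1 : ℝ) ≤ M := by linarith
    exact_mod_cast this
  set η₀ : ℝ := min 1 ((a₂ - a₁) / 2) with hη₀
  have hη₀0 : 0 < η₀ := lt_min one_pos (by linarith)
  have hη₀1 : η₀ ≤ 1 := min_le_left _ _
  set D₀ : ℝ := 2 * (T.card : ℝ) ^ 3 + 2 * T.card * (T.card * (25 * 17)) with hD₀
  -- `LT` makes room for the letters of `T`; `4 ^ n ≥ n²` and `M ^ n ≥ 256 C₀³` supply the margin
  -- used in `hbad'`; the factor `8 C₀²` permits approximants at the smaller scale needed by
  -- `le_card_indices`.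
  refine ⟨L + LT, B * 4 * M, n₀, A * (8 * C₀ ^ 2), Cs,
    (1 + (a₂ - a₁ + 1) / η₀) / (1 / (16 * C₀ ^ 3)) * (D₀ + 1), η₀,
    fun n η E => polyAlg Γ p (h n η E), by lia, ?_, hn₀, ?_, hCs, ?_, hη₀0, hη₀1, ?_⟩
  · exact Nat.one_le_iff_ne_zero.2 (by positivity)
  · nlinarith [mul_le_mul hA (one_le_pow₀ hC₀ (n := 2)) zero_le_one (by linarith)]
  · have : 0 ≤ (a₂ - a₁ + 1) / η₀ := div_nonneg (by linarith) hη₀0.le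
    positivity
  intro n hn η hη hAη
  have hn3 : (3 : ℝ) ≤ n := by exact_mod_cast hn₀.trans hn
  have hn0 : (0 : ℝ) < n := by linarith
  have hlog : 1 ≤ Real.log n := by
    rw [Real.le_log_iff_exp_le hn0]
    exact Real.exp_one_lt_d9.le.trans (by linarith)
  have hC2 : 1 ≤ C₀ ^ 2 := one_le_pow₀ hC₀
  have hη1 : η ≤ 1 := hη.trans hη₀1
  have hA8 : 1 ≤ A * (8 * C₀ ^ 2) := by nlinarith
  have hηn : 1 / (n : ℝ) ≤ η := by
    rw [div_le_iff₀ hn0]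
    nlinarith
  have hη0 : 0 < η := lt_of_lt_of_le (by positivity) hηn
  have hAlog : A * Real.log n ≤ η / (8 * C₀ ^ 2) * n := by
    rw [div_mul_eq_mul_div, le_div_iff₀ (by positivity)]
    linarith
  have hdivle : ∀ s : ℝ, 0 ≤ s → s / (8 * C₀ ^ 2) ≤ s := fun s hs =>
    div_le_self hs (by linarith)
  have hAlog1 : A * Real.log n ≤ η * n :=
    hAlog.trans (mul_le_mul_of_nonneg_right (hdivle η hη0.le) hn0.le)
  have happη : ∀ E ∈ Set.Icc a₁ a₂,
      IsApproximant S p L B n C₀ κ γ CW (1 / (16 * C₀)) E η (h n η E) := fun E hE =>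
    hh n η E hn hη1 hAlog1 hE
  refine ⟨fun E₁ hE₁ E₂ hE₂ g hg => ⟨hschur L B n E₁ E₂ η _ _ hη0 (happη E₁ hE₁) (happη E₂ hE₂)
    g hg, ?_, ?_⟩, ?_⟩
  · refine (l1Norm_schurTwist_le _ _ _).trans ?_
    have h1 := (l2Norm_le_norm_leftRegAlg _).trans (happη E₁ hE₁).norm_le
    have h2 := (l2Norm_le_norm_leftRegAlg _).trans (happη E₂ hE₂).norm_le
    calc _ ≤ (2 : ℝ) * 2 := by
          gcongr
          · exact l2Norm_nonneg _
          · exact h1.trans (by linarith)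
          · exact h2.trans (by linarith)
      _ = 4 := by norm_num
  · intro k hk
    refine (wordLength_le_of_mem_support_schurTwist hS (happη E₁ hE₁).wordLength_le k hk).trans ?_
    gcongr
    lia
  intro N ρ r hN hr hbad K hK Q hQ hquad φ ev hφ
  have hn1 : 1 ≤ n := by lia
  have hLn : L * n + LT ≤ r := by nlinarith
  have hN0 : (0 : ℝ) < N := by exact_mod_cast hN
  have hbad' : (bad S ρ r).card * (B : ℝ) ^ n * (n ^ 2 * (256 * C₀ ^ 3)) ≤ N := by
    refine le_trans ?_ hbad
    push_cast
    rw [mul_pow, mul_pow, mul_assoc, mul_assoc (B ^ n : ℝ)]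
    gcongr
    · have : n ≤ 2 ^ n := Nat.lt_two_pow_self.le
      calc (n : ℝ) ^ 2 ≤ ((2 : ℝ) ^ n) ^ 2 := by gcongr; exact_mod_cast this
        _ = 4 ^ n := by rw [← pow_mul, mul_comm, pow_mul]; norm_num
    · exact hM1.trans (le_self_pow₀ (by exact_mod_cast hM0) (by lia))
  set bB : ℝ := (bad S ρ r).card * (B : ℝ) ^ n with hbB
  have hbB0 : 0 ≤ bB := by positivity
  have hn2 : (n : ℝ) ≤ n ^ 2 := by nlinarith
  -- The margin `n²` suffices because `1/n ≤ η` and `(3 + γ)/2 ≤ 2`.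
  have hbη : bB ≤ N * η ^ ((3 + γ) / 2) := by
    have h1 : bB * n ^ 2 ≤ N := by
      refine le_trans ?_ hbad'
      gcongr
      exact le_mul_of_one_le_right (by positivity) (by linarith)
    have h2 : (1 / n : ℝ) ^ 2 ≤ η ^ ((3 + γ) / 2) := by
      calc (1 / n : ℝ) ^ 2 ≤ η ^ 2 := by gcongr
        _ = η ^ (2 : ℝ) := by rw [Real.rpow_two]
        _ ≤ _ := Real.rpow_le_rpow_of_exponent_ge hη0 hη1 (by linarith)
    calc bB = bB * n ^ 2 * (1 / n) ^ 2 := by field_simp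
      _ ≤ N * η ^ ((3 + γ) / 2) := by gcongr
  have hcount : ∀ E ∈ Set.Icc a₁ a₂, ∀ s : ℝ, s = η ∨ s = η₀ →
      N * (s * (1 / (16 * C₀ ^ 3))) ≤ (indices ev (Set.Icc (E - s) (E + s))).card := by
    intro E hE s hs
    have hsη : η ≤ s := by rcases hs with rfl | rfl <;> linarith
    have hs1 : s ≤ 1 := by rcases hs with rfl | rfl <;> linarith
    have hs0 : 0 < s := hη0.trans_le hsη
    have e1 : A * Real.log n ≤ s / (8 * C₀ ^ 2) * n :=
      hAlog.trans (by gcongr)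
    have e2 : A * Real.log n ≤ s * n :=
      e1.trans (mul_le_mul_of_nonneg_right (hdivle s hs0.le) hn0.le)
    rw [mul_one_div]
    refine le_card_indices hC₀ hB hs0 (hh n s E hn hs1 e2 hE)
      (hh n _ E hn ((hdivle s hs0.le).trans hs1) e1 hE) hφ (by lia : L * n ≤ 2 * r) ?_
    have e3 : bB * (256 * C₀ ^ 3) ≤ N * s := by
      have : bB * n * (256 * C₀ ^ 3) ≤ N := by
        refine le_trans ?_ hbad'
        rw [mul_assoc]
        gcongr
      calc bB * (256 * C₀ ^ 3) = bB * n * (256 * C₀ ^ 3) * (1 / n) := by field_simp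
        _ ≤ N * s := by
          gcongr
          exact hηn.trans hsη
    have e4 : N * (1 / (16 * C₀) * (s / (8 * C₀ ^ 2))) = N * s / (128 * C₀ ^ 3) := by
      field_simp
      ring
    rw [e4, le_div_iff₀ (by positivity)]
    calc _ = bB * (256 * C₀ ^ 3) := by rw [hbB]; ring
      _ ≤ _ := e3
  set X : ℝ := N * η ^ ((3 + γ) / 2) with hX
  have hX0 : 0 ≤ X := by positivity
  have hXη : X = N * (η * η ^ ((1 + γ) / 2)) := by
    rw [hX]
    congr 1
    nth_rewrite 2 [← Real.rpow_one η]
    rw [← Real.rpow_add hη0]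
    ring_nf
  have hD₀0 : 0 ≤ D₀ := by positivity
  have hwin : ∀ E₁ ∈ energyNet a₁ a₂ η, ∀ E₂ ∈ energyNet a₁ a₂ η,
      ∑ i ∈ indices ev (Set.Icc (E₁ - 2 * η) (E₁ + 2 * η)),
        ∑ j ∈ indices ev (Set.Icc (E₂ - 2 * η) (E₂ + 2 * η)), ‖centeredCoeff ρ T K φ j i‖ ^ 2 ≤
      N * (η * ((D₀ + 1) * (Q + 1) * η ^ ((1 + γ) / 2))) := by
    intro E₁ hE₁ E₂ hE₂
    have hrT : ∀ g ∈ T, wordLength S g ≤ r := fun g hg => by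
      have : wordLength S g ≤ LT := Finset.le_sup hg
      lia
    refine (sum_norm_centeredCoeff_sq_le hS hK hrT φ _ _).trans ?_
    have e1 : ∀ g ∈ T, ∑ i ∈ indices ev (Set.Icc (E₁ - 2 * η) (E₁ + 2 * η)),
        ∑ j ∈ indices ev (Set.Icc (E₂ - 2 * η) (E₂ + 2 * η)),
        ‖inner ℂ (φ j) (Matrix.toEuclideanCLM (𝕜 := ℂ)
          (permMat ρ g * Matrix.diagonal (centeredVec ρ K g)) (φ i))‖ ^ 2 ≤
        25 * 17 * ((Q + 1) * X) := by
      intro g hg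
      have hgT : wordLength S g ≤ LT := Finset.le_sup hg
      have e2 := sum_window_le hS hθ0.le hθ1 hη0
        (happη E₁ (mem_Icc_of_mem_energyNet ha hη0 hE₁))
        (happη E₂ (mem_Icc_of_mem_energyNet ha hη0 hE₂)) hφ
        (by lia : wordLength S g + L * n ≤ r) (norm_centeredVec_le (ρ := ρ) hK.2 g)
      refine e2.trans ?_
      have e3 := hquad E₁ hE₁ E₂ hE₂ g hg
      have e4 : 0 ≤ Q * X := by positivity
      linarith
    have e5 := Finset.sum_le_sum e1
    rw [Finset.sum_const, nsmul_eq_mul] at e5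
    have e6 : ((bad S ρ r).card : ℝ) ≤ bB :=
      le_mul_of_one_le_right (by positivity) (one_le_pow₀ (by exact_mod_cast hB))
    have e7 : X ≤ (Q + 1) * X := le_mul_of_one_le_left hX0 (by linarith)
    calc _ ≤ 2 * ((Q + 1) * X * (T.card : ℝ) ^ 3) +
          2 * T.card * (T.card * (25 * 17 * ((Q + 1) * X))) := by
          gcongr
          exact (e6.trans hbη).trans e7
      _ = D₀ * (Q + 1) * X := by rw [hD₀]; ring
      _ ≤ (D₀ + 1) * (Q + 1) * X := by gcongr; linarith
      _ = _ := by rw [hXη]; ring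
  have hfin := mixing_ergodicity_le ha hη0 hη1 hη₀0 (min_le_right _ _) hη₀1 hN
    (c := 1 / (16 * C₀ ^ 3)) (by positivity)
    (D := (D₀ + 1) * (Q + 1) * η ^ ((1 + γ) / 2)) (by positivity) hcount
    (fun i j => ‖centeredCoeff ρ T K φ j i‖ ^ 2) (fun i j => by positivity) hwin
  have hconst : (1 + (a₂ - a₁ + 1) / η₀) / (1 / (16 * C₀ ^ 3)) * (D₀ + 1) * (Q + 1) *
      η ^ ((1 + γ) / 2) = (1 + (a₂ - a₁ + 1) / η₀) / (1 / (16 * C₀ ^ 3)) *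
        ((D₀ + 1) * (Q + 1) * η ^ ((1 + γ) / 2)) := by ring
  rw [hconst]
  exact hfin

end Variance

/-! ### Quadratic forms of permutation representations -/

section QuadraticForms

open scoped Matrix

variable {N : ℕ}

theorem star_dotProduct_mulVec_eq_inner (M : Matrix (Fin N) (Fin N) ℂ) (a : Fin N → ℂ) :
    star a ⬝ᵥ (M *ᵥ a) =
      inner ℂ (WithLp.toLp 2 a) (Matrix.toEuclideanCLM (𝕜 := ℂ) M (WithLp.toLp 2 a)) := by
  rw [EuclideanSpace.inner_eq_star_dotProduct, dotProduct_comm]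
  rfl

theorem norm_toLp_sq_le {a : Fin N → ℂ} {α : ℝ} (ha : ∀ x, ‖a x‖ ≤ α) :
    ‖(WithLp.toLp 2 a : EuclideanSpace ℂ (Fin N))‖ ^ 2 ≤ N * α ^ 2 := by
  rw [EuclideanSpace.norm_sq_eq]
  calc _ ≤ ∑ _x : Fin N, α ^ 2 :=
        Finset.sum_le_sum fun x _ => pow_le_pow_left₀ (norm_nonneg _) (ha x) 2
    _ = _ := by simp

theorem norm_star_dotProduct_mulVec_le {M : Matrix (Fin N) (Fin N) ℂ} {a : Fin N → ℂ} {α θ : ℝ}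
    (hθ : 0 ≤ θ) (ha : ∀ x, ‖a x‖ ≤ α)
    (hM : ‖Matrix.toEuclideanCLM (𝕜 := ℂ) M (WithLp.toLp 2 a)‖ ≤
      θ * ‖(WithLp.toLp 2 a : EuclideanSpace ℂ (Fin N))‖) :
    ‖star a ⬝ᵥ (M *ᵥ a)‖ ≤ θ * (N * α ^ 2) := by
  rw [star_dotProduct_mulVec_eq_inner]
  refine (norm_inner_le_norm _ _).trans ?_
  calc _ ≤ ‖(WithLp.toLp 2 a : EuclideanSpace ℂ (Fin N))‖ *
        (θ * ‖(WithLp.toLp 2 a : EuclideanSpace ℂ (Fin N))‖) := by gcongr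
    _ = θ * ‖(WithLp.toLp 2 a : EuclideanSpace ℂ (Fin N))‖ ^ 2 := by ring
    _ ≤ _ := by
      gcongr
      exact norm_toLp_sq_le ha

theorem norm_toEuclideanCLM_le_normOnePerp (M : Matrix (Fin N) (Fin N) ℂ)
    {v : EuclideanSpace ℂ (Fin N)} (hv : v ∈ onePerp N) :
    ‖Matrix.toEuclideanCLM (𝕜 := ℂ) M v‖ ≤ normOnePerp M * ‖v‖ :=
  ((Matrix.toEuclideanCLM (𝕜 := ℂ) M).comp (onePerp N).subtypeL).le_opNorm ⟨v, hv⟩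

-- The subspace is spanned by the right singular vectors with singular value above `θ`; Markov's
-- inequality for the `2m`-th moment bounds their number.
open scoped ComplexOrder in
theorem exists_submodule_singular (M : Matrix (Fin N) (Fin N) ℂ) {θ : ℝ} (hθ : 0 ≤ θ) (m : ℕ) :
    ∃ H : Submodule ℂ (EuclideanSpace ℂ (Fin N)),
      (Module.finrank ℂ H : ℝ) * θ ^ (2 * m) ≤ (((Mᴴ * M) ^ m).trace).re ∧
      ∀ v ∈ Hᗮ, ‖Matrix.toEuclideanCLM (𝕜 := ℂ) M v‖ ≤ θ * ‖v‖ := by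
  classical
  have hpsd : (Mᴴ * M).PosSemidef := Matrix.posSemidef_conjTranspose_mul_self M
  set u := hpsd.isHermitian.eigenvectorBasis with hu
  set e := hpsd.isHermitian.eigenvalues with he
  have he0 : ∀ i, 0 ≤ e i := fun i => hpsd.eigenvalues_nonneg i
  have hY : ∀ i, Matrix.toEuclideanCLM (𝕜 := ℂ) (Mᴴ * M) (u i) = (e i : ℂ) • u i := by
    intro i
    have h1 := hpsd.isHermitian.mulVec_eigenvectorBasis i
    apply PiLp.ext
    intro x
    exact congrFun h1 x
  have hYm : ∀ (k : ℕ) i, Matrix.toEuclideanCLM (𝕜 := ℂ) ((Mᴴ * M) ^ k) (u i) =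
      ((e i ^ k : ℝ) : ℂ) • u i := by
    intro k i
    induction k with
    | zero => simp
    | succ k ih =>
      rw [pow_succ, toEuclideanCLM_mul_apply, hY, map_smul, ih, smul_smul]
      push_cast
      ring_nf
  set s : Finset (Fin N) := Finset.univ.filter fun i => θ ^ 2 < e i with hs
  refine ⟨Submodule.span ℂ (s.image u : Set (EuclideanSpace ℂ (Fin N))), ?_, ?_⟩
  · have h1 : (((Mᴴ * M) ^ m).trace).re = ∑ i, e i ^ m := by
      rw [← sum_inner_eq_trace u, Complex.re_sum]
      refine Finset.sum_congr rfl fun i _ => ?_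
      rw [hYm, inner_smul_right, orthonormal_iff_ite.1 u.orthonormal, if_pos rfl, mul_one,
        Complex.ofReal_re]
    have h2 : Module.finrank ℂ (Submodule.span ℂ (s.image u : Set (EuclideanSpace ℂ (Fin N)))) ≤
        s.card := (finrank_span_finset_le_card _).trans Finset.card_image_le
    rw [h1]
    calc _ ≤ (s.card : ℝ) * θ ^ (2 * m) := by gcongr
      _ = ∑ i ∈ s, (θ ^ 2) ^ m := by rw [Finset.sum_const, nsmul_eq_mul, pow_mul]
      _ ≤ ∑ i ∈ s, e i ^ m := by
        refine Finset.sum_le_sum fun i hi => ?_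
        exact pow_le_pow_left₀ (by positivity) (Finset.mem_filter.1 hi).2.le m
      _ ≤ ∑ i, e i ^ m := Finset.sum_le_sum_of_subset_of_nonneg (Finset.subset_univ _)
        fun i _ _ => pow_nonneg (he0 i) m
  · intro v hv
    have h1 : ‖Matrix.toEuclideanCLM (𝕜 := ℂ) M v‖ ^ 2 =
        ∑ i, e i * ‖inner ℂ (u i) v‖ ^ 2 := by
      have h2 : inner ℂ v (Matrix.toEuclideanCLM (𝕜 := ℂ) (Mᴴ * M) v) =
          ((‖Matrix.toEuclideanCLM (𝕜 := ℂ) M v‖ ^ 2 : ℝ) : ℂ) := by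
        rw [toEuclideanCLM_mul_apply, inner_toEuclideanCLM_conjTranspose,
          inner_self_eq_norm_sq_to_K]
        simp
      have h3 : inner ℂ v (Matrix.toEuclideanCLM (𝕜 := ℂ) (Mᴴ * M) v) =
          ((∑ i, e i * ‖inner ℂ (u i) v‖ ^ 2 : ℝ) : ℂ) := by
        conv_lhs => rw [← u.sum_repr' v, map_sum, u.sum_repr' v, inner_sum]
        push_cast
        refine Finset.sum_congr rfl fun i _ => ?_
        rw [map_smul, hY, inner_smul_right, inner_smul_right, mul_left_comm,
          ← inner_conj_symm v (u i), Complex.mul_conj, Complex.normSq_eq_norm_sq,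
          Complex.ofReal_pow]
      rw [h2] at h3
      exact_mod_cast h3
    have h4 : ‖Matrix.toEuclideanCLM (𝕜 := ℂ) M v‖ ^ 2 ≤ (θ * ‖v‖) ^ 2 := by
      rw [h1, mul_pow, ← u.sum_sq_norm_inner_right v, Finset.mul_sum]
      refine Finset.sum_le_sum fun i _ => ?_
      by_cases hi : θ ^ 2 < e i
      · have h5 : inner ℂ (u i) v = 0 := by
          refine (Submodule.mem_orthogonal _ v).1 hv _ (Submodule.subset_span ?_)
          exact Finset.mem_coe.2 (Finset.mem_image_of_mem u
            (Finset.mem_filter.2 ⟨Finset.mem_univ i, hi⟩))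
        rw [h5, norm_zero]
        simp
      · have := not_lt.1 hi
        gcongr
    exact le_of_sq_le_sq h4 (by positivity)

variable {Γ : Type*} [Group Γ]

theorem centeredVec_mem_onePerp (hN : 0 < N) (ρ : Γ →* Equiv.Perm (Fin N))
    (K : Matrix (Fin N) (Fin N) ℂ) (g : Γ) : WithLp.toLp 2 (centeredVec ρ K g) ∈ onePerp N := by
  have hN0 : (N : ℂ) ≠ 0 := by exact_mod_cast hN.ne'
  rw [onePerp, Submodule.mem_orthogonal_singleton_iff_inner_right,
    EuclideanSpace.inner_eq_star_dotProduct]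
  simp only [dotProduct, centeredVec, Pi.star_apply, star_one, mul_one, Finset.sum_sub_distrib]
  simp [hN0]

/-- Orthogonality to the constants means mean zero. As the exceptional subspace will contain the
constants, the hypothesis on `kernelVec` passes to `centeredVec`. -/
theorem centeredVec_eq_kernelVec {ρ : Γ →* Equiv.Perm (Fin N)}
    {K : Matrix (Fin N) (Fin N) ℂ} {g : Γ} (hK : kernelVec ρ K g ∈ onePerp N) :
    WithLp.toLp 2 (centeredVec ρ K g) = kernelVec ρ K g := by
  rw [onePerp, Submodule.mem_orthogonal_singleton_iff_inner_right,
    EuclideanSpace.inner_eq_star_dotProduct] at hK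
  simp only [dotProduct, kernelVec, Pi.star_apply, star_one, mul_one] at hK
  rw [kernelVec]
  congr 1
  funext x
  rw [centeredVec, hK, mul_zero, sub_zero]

/-! ### Norms and supports of products -/

theorem l1Norm_eq_sum {q : MonoidAlgebra ℂ Γ} {s : Finset Γ} (hs : q.coeff.support ⊆ s) :
    l1Norm q = ∑ g ∈ s, ‖q.coeff g‖ :=
  Finset.sum_subset hs fun g _ hg => by rw [Finsupp.notMem_support_iff.1 hg, norm_zero]

theorem l1Norm_add_le (q q' : MonoidAlgebra ℂ Γ) : l1Norm (q + q') ≤ l1Norm q + l1Norm q' := by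
  classical
  rw [l1Norm_eq_sum (q := q + q') (s := q.coeff.support ∪ q'.coeff.support) Finsupp.support_add,
    l1Norm_eq_sum (q := q) Finset.subset_union_left,
    l1Norm_eq_sum (q := q') Finset.subset_union_right, ← Finset.sum_add_distrib]
  exact Finset.sum_le_sum fun g _ => norm_add_le _ _

theorem l1Norm_sum_le {ι : Type*} (s : Finset ι) (f : ι → MonoidAlgebra ℂ Γ) :
    l1Norm (∑ i ∈ s, f i) ≤ ∑ i ∈ s, l1Norm (f i) := by
  classical
  induction s using Finset.induction_on with
  | empty => simp [l1Norm]
  | insert a s ha ih =>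
    rw [Finset.sum_insert ha, Finset.sum_insert ha]
    exact (l1Norm_add_le _ _).trans (by linarith)

theorem l1Norm_single_le (g : Γ) (z : ℂ) : l1Norm (MonoidAlgebra.single g z) ≤ ‖z‖ := by
  classical
  rw [l1Norm_eq_sum (q := MonoidAlgebra.single g z) (s := {g}) Finsupp.support_single_subset,
    Finset.sum_singleton]
  simp

theorem l1Norm_mul_le (q q' : MonoidAlgebra ℂ Γ) : l1Norm (q * q') ≤ l1Norm q * l1Norm q' := by
  classical
  conv_lhs => rw [← sum_single_coeff q, ← sum_single_coeff q', Finset.sum_mul_sum]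
  rw [l1Norm.eq_1 q, l1Norm.eq_1 q', Finset.sum_mul_sum]
  refine (l1Norm_sum_le _ _).trans (Finset.sum_le_sum fun g _ => ?_)
  refine (l1Norm_sum_le _ _).trans (Finset.sum_le_sum fun h _ => ?_)
  rw [MonoidAlgebra.single_mul_single, ← norm_mul]
  exact l1Norm_single_le _ _

theorem l1Norm_adj_le (q : MonoidAlgebra ℂ Γ) : l1Norm (adj q) ≤ l1Norm q := by
  refine (l1Norm_sum_le _ _).trans (Finset.sum_le_sum fun g _ => ?_)
  exact (l1Norm_single_le _ _).trans (norm_star _).le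

theorem l1Norm_pow_le (q : MonoidAlgebra ℂ Γ) (m : ℕ) : l1Norm (q ^ m) ≤ l1Norm q ^ m := by
  induction m with
  | zero =>
    rw [pow_zero, pow_zero, MonoidAlgebra.one_def]
    exact (l1Norm_single_le _ _).trans (by simp)
  | succ m ih =>
    rw [pow_succ, pow_succ]
    exact (l1Norm_mul_le _ _).trans (mul_le_mul_of_nonneg_right ih (l1Norm_nonneg q))

variable {S : Finset Γ}

theorem wordLength_le_of_mem_support_mul (hS : Subgroup.closure (S : Set Γ) = ⊤)
    {q q' : MonoidAlgebra ℂ Γ} {R R' : ℕ} (hq : ∀ g ∈ q.coeff.support, wordLength S g ≤ R)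
    (hq' : ∀ g ∈ q'.coeff.support, wordLength S g ≤ R') :
    ∀ g ∈ (q * q').coeff.support, wordLength S g ≤ R + R' := by
  classical
  open scoped Pointwise in
  intro g hg
  obtain ⟨a, ha, b, hb, rfl⟩ := Finset.mem_mul.1 (MonoidAlgebra.support_coeff_mul_subset q q' hg)
  exact (wordLength_mul_le hS a b).trans (add_le_add (hq a ha) (hq' b hb))

theorem wordLength_le_of_mem_support_adj (hS : Subgroup.closure (S : Set Γ) = ⊤)
    {q : MonoidAlgebra ℂ Γ} {R : ℕ} (hq : ∀ g ∈ q.coeff.support, wordLength S g ≤ R) :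
    ∀ g ∈ (adj q).coeff.support, wordLength S g ≤ R := by
  intro g hg
  rw [Finsupp.mem_support_iff, coeff_adj, star_ne_zero] at hg
  rw [← wordLength_inv hS]
  exact hq _ (Finsupp.mem_support_iff.2 hg)

theorem wordLength_le_of_mem_support_pow (hS : Subgroup.closure (S : Set Γ) = ⊤)
    {q : MonoidAlgebra ℂ Γ} {R : ℕ} (hq : ∀ g ∈ q.coeff.support, wordLength S g ≤ R) (m : ℕ) :
    ∀ g ∈ (q ^ m).coeff.support, wordLength S g ≤ m * R := by
  classical
  induction m with
  | zero =>
    intro g hg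
    rw [pow_zero, MonoidAlgebra.one_def] at hg
    have := Finset.mem_singleton.1 (Finsupp.support_single_subset hg)
    rw [this, wordLength_one]
    exact Nat.zero_le _
  | succ m ih =>
    rw [pow_succ, Nat.succ_mul]
    exact wordLength_le_of_mem_support_mul hS ih hq

/-- Moment method: the trace of `ρ((q^* q)^m)` is close to `N` times the coefficient of `(q^* q)^m`
at `1`, hence at most `2 N θ^{2m}`. The threshold `2θ` turns this into a gain of `4^m` in the
dimension. -/
theorem exists_submodule_permAlg (hS : Subgroup.closure (S : Set Γ) = ⊤)
    (ρ : Γ →* Equiv.Perm (Fin N)) {q : MonoidAlgebra ℂ Γ} {R r m : ℕ} {θ ℓ : ℝ}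
    (hq : ∀ g ∈ q.coeff.support, wordLength S g ≤ R) (hR : m * R ≤ r) (hθ : 0 < θ)
    (hqθ : ‖leftRegAlg q‖ ≤ θ) (hℓ : l1Norm q ≤ ℓ)
    (hbad : (bad S ρ r).card * (ℓ / θ) ^ (2 * m) ≤ N) :
    ∃ H : Submodule ℂ (EuclideanSpace ℂ (Fin N)),
      (Module.finrank ℂ H : ℝ) ≤ 2 * N / 4 ^ m ∧
      ∀ v ∈ Hᗮ, ‖Matrix.toEuclideanCLM (𝕜 := ℂ) (permAlg ρ q) v‖ ≤ 2 * θ * ‖v‖ := by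
  obtain ⟨H, hH, hH'⟩ := exists_submodule_singular (permAlg ρ q) (θ := 2 * θ) (by positivity) m
  refine ⟨H, ?_, hH'⟩
  set w := (adj q * q) ^ m with hw
  have h1 : ((permAlg ρ q)ᴴ * permAlg ρ q) ^ m = permAlg ρ w := by
    rw [hw, permAlg_pow, permAlg_mul, permAlg_adj]
  have hsupp : ∀ g ∈ w.coeff.support, wordLength S g ≤ 2 * r := by
    intro g hg
    refine (wordLength_le_of_mem_support_pow hS (wordLength_le_of_mem_support_mul hS
      (wordLength_le_of_mem_support_adj hS hq) hq) m g hg).trans ?_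
    nlinarith
  have h2 := norm_trace_permAlg_sub_le (S := S) ρ (r := r) hsupp
  have hw1 : ‖w.coeff 1‖ ≤ θ ^ (2 * m) := by
    refine (norm_coeff_le_norm_leftRegAlg w 1).trans ?_
    rw [hw, ← leftRegAlgHom_apply, map_pow, map_mul, leftRegAlgHom_apply, leftRegAlgHom_apply,
      leftRegAlg_adj, pow_mul]
    rcases Nat.eq_zero_or_pos m with rfl | hm
    · rw [pow_zero, pow_zero]
      exact ContinuousLinearMap.norm_id_le
    refine (norm_pow_le' _ hm).trans ?_
    refine pow_le_pow_left₀ (norm_nonneg _) ?_ m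
    refine (norm_mul_le _ _).trans ?_
    rw [pow_two]
    have : ‖ContinuousLinearMap.adjoint (leftRegAlg q)‖ = ‖leftRegAlg q‖ :=
      ContinuousLinearMap.adjoint.norm_map _
    rw [this]
    gcongr
  have hw2 : l1Norm w ≤ ℓ ^ (2 * m) := by
    rw [hw, pow_mul]
    refine (l1Norm_pow_le _ _).trans (pow_le_pow_left₀ (l1Norm_nonneg _) ?_ m)
    refine (l1Norm_mul_le _ _).trans ?_
    rw [pow_two]
    exact mul_le_mul ((l1Norm_adj_le q).trans hℓ) hℓ (l1Norm_nonneg q)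
      ((l1Norm_nonneg q).trans hℓ)
  have h3 : (permAlg ρ w).trace.re ≤ N * θ ^ (2 * m) + (bad S ρ r).card * ℓ ^ (2 * m) := by
    have e1 := (Complex.re_le_norm _).trans (norm_le_norm_add_norm_sub' (permAlg ρ w).trace
      (N * w.coeff 1))
    rw [norm_mul, Complex.norm_natCast] at e1
    have e2 : (N : ℝ) * ‖w.coeff 1‖ ≤ N * θ ^ (2 * m) := by gcongr
    have e3 : (bad S ρ r).card * l1Norm w ≤ (bad S ρ r).card * ℓ ^ (2 * m) := by gcongr
    linarith
  have h4 : (bad S ρ r).card * ℓ ^ (2 * m) ≤ N * θ ^ (2 * m) := by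
    rw [div_pow, mul_div_assoc', div_le_iff₀ (by positivity)] at hbad
    exact hbad
  rw [h1] at hH
  have h5 : (Module.finrank ℂ H : ℝ) * 4 ^ m * θ ^ (2 * m) ≤ 2 * N * θ ^ (2 * m) := by
    have e4 : (2 * θ) ^ (2 * m) = 4 ^ m * θ ^ (2 * m) := by
      rw [mul_pow, pow_mul]; norm_num
    rw [e4] at hH
    linarith
  rw [le_div_iff₀ (by positivity)]
  exact le_of_mul_le_mul_right h5 (by positivity)

theorem finrank_iSup_finset_le {ι V : Type*} [AddCommGroup V] [Module ℂ V]
    [FiniteDimensional ℂ V] (s : Finset ι) (H : ι → Submodule ℂ V) {D : ℝ}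
    (hH : ∀ i ∈ s, (Module.finrank ℂ (H i) : ℝ) ≤ D) :
    (Module.finrank ℂ (s.sup H : Submodule ℂ V) : ℝ) ≤ s.card * D := by
  classical
  induction s using Finset.induction_on with
  | empty => simp
  | insert a s ha ih =>
    rw [Finset.sup_insert, Finset.card_insert_of_notMem ha]
    have h1 : Module.finrank ℂ (H a ⊔ s.sup H : Submodule ℂ V) ≤
        Module.finrank ℂ (H a) + Module.finrank ℂ (s.sup H : Submodule ℂ V) :=
      Submodule.finrank_add_le_finrank_add_finrank _ _
    have h2 : (Module.finrank ℂ (H a ⊔ s.sup H : Submodule ℂ V) : ℝ) ≤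
        Module.finrank ℂ (H a) + Module.finrank ℂ (s.sup H : Submodule ℂ V) := by
      exact_mod_cast h1
    have h3 := hH a (Finset.mem_insert_self a s)
    have h4 := ih fun i hi => hH i (Finset.mem_insert_of_mem hi)
    push_cast
    linarith

end QuadraticForms

/-! ### Choice of scales -/

section Scales

open Filter

theorem pow_le_exp_of_mul_log_le {B : ℕ} (hB : 1 ≤ B) {n : ℕ} {ε κ X : ℝ} (hX : 0 ≤ X)
    (hn : (n : ℝ) ≤ ε * X) (hε : ε * Real.log B ≤ κ) : (B : ℝ) ^ n ≤ Real.exp (κ * X) := by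
  have hB0 : (0 : ℝ) < B := by exact_mod_cast hB
  have hlogB : 0 ≤ Real.log B := Real.log_nonneg (by exact_mod_cast hB)
  rw [← Real.exp_log hB0, ← Real.exp_nat_mul, Real.exp_le_exp]
  calc (n : ℝ) * Real.log B ≤ ε * X * Real.log B := by gcongr
    _ = ε * Real.log B * X := by ring
    _ ≤ κ * X := by gcongr

theorem exists_pos_le_of_log {α κ M : ℝ} (hα : 0 < α) (hκ : 0 < κ) (hM : 0 < M) {B : ℕ}
    (hB : 1 ≤ B) : ∃ ε : ℝ, 0 < ε ∧ ε ≤ 1 ∧ M * ε ≤ α ∧ ε * Real.log B ≤ κ := by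
  have hlogB : 0 ≤ Real.log B := Real.log_nonneg (by exact_mod_cast hB)
  refine ⟨min 1 (min (α / M) (κ / (Real.log B + 1))), by positivity, min_le_left _ _, ?_, ?_⟩
  · calc _ ≤ M * (α / M) := by
          gcongr
          exact (min_le_right _ _).trans (min_le_left _ _)
      _ = α := by field_simp
  · calc _ ≤ κ / (Real.log B + 1) * Real.log B := by
          gcongr
          exact (min_le_right _ _).trans (min_le_right _ _)
      _ ≤ κ := by
        rw [div_mul_eq_mul_div, div_le_iff₀ (by positivity)]
        nlinarith

/-- The truncation length `n`, of order `X`. -/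
theorem exists_truncation {α β CB A : ℝ} (hα : 0 < α) (hβ : β < 1) (hA : 1 ≤ A)
    {L B : ℕ} (hL : 1 ≤ L) (hB : 1 ≤ B) (n₀ : ℕ) :
    ∃ C X₀ : ℝ, 0 < C ∧ Real.exp 1 ≤ X₀ ∧ ∀ X : ℝ, X₀ ≤ X → ∃ n : ℕ, n₀ ≤ n ∧
      (L * n : ℝ) ≤ α * X ∧ CB * Real.exp (β * X) * B ^ n ≤ Real.exp X ∧
      ∀ η : ℝ, C * Real.log X / X ≤ η → A * Real.log n ≤ η * n := by
  set κ := (1 - β) / 2 with hκ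
  have hκ0 : 0 < κ := by linarith
  obtain ⟨ε, hε0, hε1, hεL, hεB⟩ := exists_pos_le_of_log hα hκ0
    (by exact_mod_cast hL : (0 : ℝ) < L) hB
  -- The exponent `1 - β = 2κ` is shared equally: `e^{κX}` pays for `CB` and `e^{κX}` for `B ^ n`.
  refine ⟨2 * A / ε, max (Real.exp 1) (max ((n₀ + 2) / ε) (CB / κ)), by positivity,
    le_max_left _ _, fun X hX => ⟨⌊ε * X⌋₊, ?_⟩⟩
  have hX1 : Real.exp 1 ≤ X := (le_max_left _ _).trans hX
  have hX2 : (n₀ + 2) / ε ≤ X := (le_max_left _ _).trans ((le_max_right _ _).trans hX)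
  have hX3 : CB / κ ≤ X := (le_max_right _ _).trans ((le_max_right _ _).trans hX)
  have hX0 : 0 < X := (Real.exp_pos 1).trans_le hX1
  rw [div_le_iff₀ hε0] at hX2
  rw [div_le_iff₀ hκ0] at hX3
  have hlogX : 1 ≤ Real.log X := (Real.le_log_iff_exp_le hX0).2 hX1
  have hfl : ((⌊ε * X⌋₊ : ℕ) : ℝ) ≤ ε * X := Nat.floor_le (by positivity)
  have hfl' : ε * X < (⌊ε * X⌋₊ : ℕ) + 1 := Nat.lt_floor_add_one _
  set n : ℕ := ⌊ε * X⌋₊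
  have hn0 : (0 : ℝ) ≤ n₀ := n₀.cast_nonneg
  have hn1 : (1 : ℝ) ≤ n := by linarith
  refine ⟨?_, ?_, ?_, fun η hη => ?_⟩
  · have : (n₀ : ℝ) ≤ n := by linarith
    exact_mod_cast this
  · calc (L * n : ℝ) ≤ L * (ε * X) := by gcongr
      _ = L * ε * X := by ring
      _ ≤ _ := by gcongr
  · calc _ ≤ Real.exp (κ * X) * Real.exp (β * X) * Real.exp (κ * X) := by
          gcongr
          · have := Real.add_one_le_exp (κ * X)
            linarith
          · exact pow_le_exp_of_mul_log_le hB hX0.le hfl hεB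
      _ = Real.exp X := by
        rw [← Real.exp_add, ← Real.exp_add]
        congr 1
        rw [hκ]
        ring
  · have hnX : (n : ℝ) ≤ X := hfl.trans (mul_le_of_le_one_left hX0.le hε1)
    have h1 : Real.log n ≤ Real.log X := Real.log_le_log (by linarith) hnX
    have h2 : ε * X / 2 ≤ n := by linarith
    calc A * Real.log n ≤ A * Real.log X := by gcongr
      _ = 2 * A / ε * Real.log X / X * (ε * X / 2) := by field_simp
      _ ≤ η * n := by
        have : 0 ≤ 2 * A / ε * Real.log X / X := by positivity
        gcongr
        exact this.trans hη

set_option maxHeartbeats 800000 in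
/-- The truncation length `n`, of order `X / log X`, and the power `m`, of order `log X`. -/
theorem exists_truncation_and_power {α β CB A : ℝ} (hα : 0 < α) (hβ : β < 1) (hCB : 0 < CB)
    (hA : 1 ≤ A) {L B : ℕ} (hL : 1 ≤ L) (hB : 1 ≤ B) (n₀ : ℕ) {b c : ℝ} (hb : 0 < b)
    (hc : 0 ≤ c) :
    ∃ C X₀ : ℝ, 0 < C ∧ Real.exp 1 ≤ X₀ ∧ ∀ X : ℝ, X₀ ≤ X → ∃ n m : ℕ, n₀ ≤ n ∧ 1 ≤ m ∧
      (m * (L * n) : ℝ) ≤ α * X ∧ CB * Real.exp (β * X) * B ^ n ≤ Real.exp X ∧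
      (∀ η : ℝ, C * Real.log X ^ 2 / X ≤ η → A * Real.log n ≤ η * n) ∧
      CB * Real.exp (β * X) * (4 * X ^ 2) ^ (2 * m) ≤ Real.exp X ∧
      1 + c * X ^ 2 * (2 * Real.exp X / 4 ^ m) ≤ Real.exp X / X ^ b := by
  set κ := (1 - β) / 2 with hκ
  have hκ0 : 0 < κ := by linarith
  have hL0 : (0 : ℝ) < L := by exact_mod_cast hL
  -- The factor `b + 4` anticipates `m ≤ (b + 4) log X`.
  obtain ⟨ε, hε0, hε1, hεL, hεB⟩ := exists_pos_le_of_log hα hκ0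
    (by positivity : (0 : ℝ) < L * (b + 4)) hB
  have hev : ∀ᶠ X : ℝ in atTop, (n₀ + 2) / ε * Real.log X ≤ X ∧
      -- The term `8 (b + 4)` is for `(4X²)^{2m} ≤ e^{8 m log X}`, and `b` for `2 X^b ≤ e^X`.
      (8 * (b + 4) + b) * Real.log X ^ 2 + (CB + 1) ≤ min κ 1 * X ∧ 4 * c ≤ X ∧
      Real.exp 1 ≤ X := by
    have h1 : ∀ᶠ X : ℝ in atTop, (n₀ + 2) / ε * Real.log X ≤ X := by
      filter_upwards [Real.isLittleO_log_id_atTop.def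
        (by positivity : 0 < ((n₀ + 2) / ε : ℝ)⁻¹), eventually_ge_atTop (1 : ℝ)] with X hX hX1
      rw [id, Real.norm_of_nonneg (Real.log_nonneg hX1), Real.norm_of_nonneg (by linarith)] at hX
      rwa [inv_mul_eq_div, le_div_iff₀' (by positivity)] at hX
    have h2 : ∀ᶠ X : ℝ in atTop, (8 * (b + 4) + b) * Real.log X ^ 2 ≤ min κ 1 / 2 * X := by
      have hpos : 0 < min κ 1 / 2 / (8 * (b + 4) + b) := by positivity
      filter_upwards [(Real.isLittleO_pow_log_id_atTop (n := 2)).def hpos,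
        eventually_ge_atTop (1 : ℝ)] with X hX hX1
      rw [id, Real.norm_of_nonneg (by positivity), Real.norm_of_nonneg (by linarith)] at hX
      rw [div_mul_eq_mul_div, le_div_iff₀' (by positivity)] at hX
      exact hX
    filter_upwards [h1, h2, eventually_ge_atTop ((CB + 1) / (min κ 1 / 2)),
      eventually_ge_atTop (4 * c), eventually_ge_atTop (Real.exp 1)] with X e1 e2 e3 e4 e5
    have hpos : 0 < min κ 1 / 2 := by positivity
    rw [div_le_iff₀ hpos] at e3
    exact ⟨e1, by linarith, e4, e5⟩
  obtain ⟨X₀, hX₀⟩ := eventually_atTop.1 hev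
  refine ⟨2 * A / ε, max (Real.exp 1) X₀, by positivity, le_max_left _ _, fun X hX => ?_⟩
  obtain ⟨h1, h2, h3, h4⟩ := hX₀ X ((le_max_right _ _).trans hX)
  have hX0 : 0 < X := (Real.exp_pos 1).trans_le h4
  have hlog : 1 ≤ Real.log X := (Real.le_log_iff_exp_le hX0).2 h4
  set ℓ := Real.log X with hℓ
  have hℓ0 : 0 < ℓ := by linarith
  have h2κ : (8 * (b + 4) + b) * ℓ ^ 2 + (CB + 1) ≤ κ * X :=
    h2.trans (by gcongr; exact min_le_left _ _)
  have h2X : (8 * (b + 4) + b) * ℓ ^ 2 + (CB + 1) ≤ X :=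
    h2.trans (mul_le_of_le_one_left hX0.le (min_le_right _ _))
  have hℓX : ε * X / ℓ ≤ ε * X := div_le_self (by positivity) hlog
  have hn2 : (n₀ + 2 : ℝ) ≤ ε * X / ℓ := by
    rw [le_div_iff₀ hℓ0]
    rw [div_mul_eq_mul_div, div_le_iff₀ hε0] at h1
    linarith
  have hfl : ((⌊ε * X / ℓ⌋₊ : ℕ) : ℝ) ≤ ε * X / ℓ := Nat.floor_le (by positivity)
  have hfl' : ε * X / ℓ < (⌊ε * X / ℓ⌋₊ : ℕ) + 1 := Nat.lt_floor_add_one _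
  have hm : (b + 3) * ℓ ≤ (⌈(b + 3) * ℓ⌉₊ : ℕ) := Nat.le_ceil _
  have hm' : ((⌈(b + 3) * ℓ⌉₊ : ℕ) : ℝ) < (b + 3) * ℓ + 1 := Nat.ceil_lt_add_one (by positivity)
  refine ⟨⌊ε * X / ℓ⌋₊, ⌈(b + 3) * ℓ⌉₊, ?_⟩
  set n : ℕ := ⌊ε * X / ℓ⌋₊
  set m : ℕ := ⌈(b + 3) * ℓ⌉₊
  have hmℓ : (m : ℝ) ≤ (b + 4) * ℓ := by linarith
  have hn0 : (0 : ℝ) ≤ n₀ := n₀.cast_nonneg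
  have hn1 : (1 : ℝ) ≤ n := by linarith
  have hCBexp : CB ≤ Real.exp (κ * X) := by
    have h5 := Real.add_one_le_exp (κ * X)
    have h6 : 0 ≤ (8 * (b + 4) + b) * ℓ ^ 2 := by positivity
    linarith
  refine ⟨?_, ?_, ?_, ?_, fun η hη => ?_, ?_, ?_⟩
  · have : (n₀ : ℝ) ≤ n := by linarith
    exact_mod_cast this
  · have h5 : (b + 3) * 1 ≤ (b + 3) * ℓ := by gcongr
    have : (1 : ℝ) ≤ m := by linarith
    exact_mod_cast this
  · calc (m * (L * n) : ℝ) ≤ (b + 4) * ℓ * (L * (ε * X / ℓ)) := by gcongr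
      _ = L * (b + 4) * ε * X := by field_simp
      _ ≤ _ := by gcongr
  · calc _ ≤ Real.exp (κ * X) * Real.exp (β * X) * Real.exp (κ * X) := by
          gcongr
          exact pow_le_exp_of_mul_log_le hB hX0.le (hfl.trans hℓX) hεB
      _ = Real.exp X := by
        rw [← Real.exp_add, ← Real.exp_add]
        congr 1
        rw [hκ]
        ring
  · have hnX : (n : ℝ) ≤ X := (hfl.trans hℓX).trans (mul_le_of_le_one_left hX0.le hε1)
    have h5 : Real.log n ≤ ℓ := Real.log_le_log (by linarith) hnX
    have h6 : ε * X / ℓ / 2 ≤ n := by linarith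
    calc A * Real.log n ≤ A * ℓ := by gcongr
      _ = 2 * A / ε * ℓ ^ 2 / X * (ε * X / ℓ / 2) := by field_simp
      _ ≤ η * n := by
        have : 0 ≤ 2 * A / ε * ℓ ^ 2 / X := by positivity
        gcongr
        exact this.trans hη
  · have h5 : 4 * X ^ 2 ≤ Real.exp (4 * ℓ) := by
      have h6 : (4 : ℝ) ≤ X ^ 2 := by
        have : (2 : ℝ) ≤ X := by
          have := Real.add_one_le_exp (1 : ℝ)
          linarith
        exact (by norm_num : (4 : ℝ) = 2 ^ 2).trans_le (by gcongr)
      have h7 : Real.exp (4 * ℓ) = X ^ 2 * X ^ 2 := by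
        have : 4 * ℓ = ((4 : ℕ) : ℝ) * ℓ := by norm_num
        rw [this, Real.exp_nat_mul, hℓ, Real.exp_log hX0]
        ring
      rw [h7]
      gcongr
    calc _ ≤ Real.exp (κ * X) * Real.exp (β * X) * Real.exp (κ * X) := by
          gcongr
          calc (4 * X ^ 2) ^ (2 * m) ≤ Real.exp (4 * ℓ) ^ (2 * m) := by gcongr
            _ = Real.exp (8 * m * ℓ) := by
              rw [← Real.exp_nat_mul]
              push_cast
              ring_nf
            _ ≤ Real.exp (κ * X) := by
              rw [Real.exp_le_exp]
              have : 8 * m * ℓ ≤ 8 * ((b + 4) * ℓ) * ℓ := by gcongr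
              have h6 : 0 ≤ b * ℓ ^ 2 := by positivity
              have h7 : (8 * (b + 4) + b) * ℓ ^ 2 = 8 * ((b + 4) * ℓ) * ℓ + b * ℓ ^ 2 := by ring
              linarith
      _ = Real.exp X := by
        rw [← Real.exp_add, ← Real.exp_add]
        congr 1
        rw [hκ]
        ring
  · have hXb : 0 < X ^ b := Real.rpow_pos_of_pos hX0 b
    -- Of the three powers of `X` beyond `X^b`, two pay for the pairs of net energies and one for
    -- the constant `4c`.
    have h5 : X ^ b * X ^ 3 ≤ 4 ^ m := by
      calc X ^ b * X ^ 3 = Real.exp ((b + 3) * ℓ) := by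
            rw [mul_comm (b + 3), hℓ, ← Real.rpow_def_of_pos hX0, Real.rpow_add hX0]
            norm_cast
        _ ≤ Real.exp m := Real.exp_le_exp.2 hm
        _ = Real.exp 1 ^ m := by rw [← Real.exp_nat_mul, mul_one]
        _ ≤ 4 ^ m := by
          gcongr
          linarith [Real.exp_one_lt_d9]
    have h6 : 2 * X ^ b ≤ Real.exp X := by
      have h7 : 2 ≤ Real.exp 1 := by
        have := Real.add_one_le_exp (1 : ℝ)
        linarith
      calc 2 * X ^ b ≤ Real.exp 1 * X ^ b := by gcongr
        _ = Real.exp (1 + ℓ * b) := by rw [Real.exp_add, hℓ, ← Real.rpow_def_of_pos hX0]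
        _ ≤ Real.exp X := by
          rw [Real.exp_le_exp]
          have h8 : ℓ * b ≤ b * ℓ ^ 2 := by
            rw [mul_comm]
            gcongr
            exact le_self_pow₀ hlog two_ne_zero
          have h9 : 0 ≤ 8 * (b + 4) * ℓ ^ 2 := by positivity
          linarith
    have h7 : c * X ^ 2 * (2 * Real.exp X / 4 ^ m) ≤ Real.exp X / X ^ b / 2 := by
      calc _ ≤ c * X ^ 2 * (2 * Real.exp X / (X ^ b * X ^ 3)) := by gcongr
        _ = 4 * c * (Real.exp X / X ^ b / 2 / X) := by
          field_simp
          ring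
        _ ≤ X * (Real.exp X / X ^ b / 2 / X) := by gcongr
        _ = _ := by field_simp
    have h8 : 1 ≤ Real.exp X / X ^ b / 2 := by
      rw [le_div_iff₀ two_pos, le_div_iff₀ hXb]
      linarith
    linarith

end Scales

/-! ### The two variance bounds -/

section Main

open scoped Matrix

variable {Γ : Type*} [Group Γ] {N : ℕ}

theorem le_rpow_of_le {x y e : ℝ} (hx : 0 < x) (hx₁ : x ≤ 1) (hxy : x ≤ y) (he : 0 ≤ e)
    (he₁ : e ≤ 1) : x ≤ y ^ e :=
  calc x = x ^ (1 : ℝ) := (Real.rpow_one x).symm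
    _ ≤ x ^ e := Real.rpow_le_rpow_of_exponent_ge hx hx₁ he₁
    _ ≤ y ^ e := Real.rpow_le_rpow hx.le hxy he

theorem VarianceBounds.mono {ρ : Γ →* Equiv.Perm (Fin N)} {p : MonoidAlgebra ℂ Γ} {a b : ℝ}
    {T : Finset Γ} {K : Matrix (Fin N) (Fin N) ℂ} {η δ δ' : ℝ}
    (h : VarianceBounds ρ p a b T K η δ) (hδ : δ ≤ δ') : VarianceBounds ρ p a b T K η δ' :=
  fun φ ev hφ => ⟨fun E₁ h₁ E₂ h₂ => ((h φ ev hφ).1 E₁ h₁ E₂ h₂).trans hδ,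
    (h φ ev hφ).2.trans hδ⟩

/-- The trivial bound suffices as soon as `η` is bounded below. Since `η` may exceed `1`, the
comparison goes through `η₀ ≤ η₀^e ≤ η^e`. -/
theorem varianceBounds_of_le_scale {ρ : Γ →* Equiv.Perm (Fin N)} (p : MonoidAlgebra ℂ Γ)
    (a b : ℝ) {T : Finset Γ} {K : Matrix (Fin N) (Fin N) ℂ} (hK : IsLocalObservable ρ T K)
    {η η₀ C e : ℝ} (hη₀ : 0 < η₀) (hη₀' : η₀ ≤ 1) (hη : η₀ ≤ η) (he : 0 ≤ e) (he₁ : e ≤ 1)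
    (hC : (2 * T.card : ℝ) ^ 2 / η₀ ≤ C) : VarianceBounds ρ p a b T K η (C * η ^ e) := by
  refine varianceBounds_of_le p a b hK η ?_
  rw [div_le_iff₀ hη₀] at hC
  have hC0 : 0 ≤ C := by
    by_contra h
    have : C * η₀ < 0 := mul_neg_of_neg_of_pos (not_le.1 h) hη₀
    linarith [sq_nonneg (2 * T.card : ℝ)]
  exact hC.trans (mul_le_mul_of_nonneg_left (le_rpow_of_le hη₀ hη₀' hη he he₁) hC0)

theorem bad_card_mul_le {S : Finset Γ} {ρ : Γ →* Equiv.Perm (Fin N)} (hN : 0 < N) {r : ℕ}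
    {CB β Y : ℝ} (hY : 0 ≤ Y) (hbad : ((bad S ρ r).card : ℝ) ≤ CB * (N : ℝ) ^ β)
    (h : CB * Real.exp (β * Real.log N) * Y ≤ Real.exp (Real.log N)) :
    (bad S ρ r).card * Y ≤ N := by
  have hN0 : (0 : ℝ) < N := by exact_mod_cast hN
  rw [Real.exp_log hN0, mul_comm β, ← Real.rpow_def_of_pos hN0] at h
  exact (mul_le_mul_of_nonneg_right hbad hY).trans h

theorem norm_quadraticForm_le_of_strongBound {S : Finset Γ} {ρ : Γ →* Equiv.Perm (Fin N)}
    (hN : 0 < N) {r R : ℕ} (hρ : StrongBound S ρ r) {T : Finset Γ}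
    {K : Matrix (Fin N) (Fin N) ℂ} (hK : IsLocalObservable ρ T K) {q : MonoidAlgebra ℂ Γ}
    (hq : ∀ k ∈ q.coeff.support, wordLength S k ≤ R) (hR : R ≤ r) (g : Γ) {θ : ℝ}
    (hθ : ‖leftRegAlg q‖ ≤ θ) :
    ‖star (centeredVec ρ K g) ⬝ᵥ (permAlg ρ q *ᵥ centeredVec ρ K g)‖ ≤ 2 * θ * (N * 2 ^ 2) := by
  have hθ0 : 0 ≤ θ := (norm_nonneg _).trans hθ
  refine norm_star_dotProduct_mulVec_le (by positivity) (norm_centeredVec_le hK.2 g) ?_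
  refine (norm_toEuclideanCLM_le_normOnePerp _ (centeredVec_mem_onePerp hN ρ K g)).trans ?_
  gcongr
  exact (hρ q fun k hk => (hq k hk).trans hR).trans (by gcongr)

/-- A subspace, of controlled dimension, off which finitely many operators `ρ(q)` are bounded in
terms of `λ(q)`. -/
theorem exists_submodule_forall_permAlg {S : Finset Γ} (hS : Subgroup.closure (S : Set Γ) = ⊤)
    (ρ : Γ →* Equiv.Perm (Fin N)) {ι : Type*} (s : Finset ι) {q : ι → MonoidAlgebra ℂ Γ}
    {R r m : ℕ} {θ ℓ : ℝ} (hq : ∀ i ∈ s, ∀ g ∈ (q i).coeff.support, wordLength S g ≤ R)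
    (hR : m * R ≤ r) (hθ : 0 < θ) (hqθ : ∀ i ∈ s, ‖leftRegAlg (q i)‖ ≤ θ)
    (hℓ : ∀ i ∈ s, l1Norm (q i) ≤ ℓ) (hbad : (bad S ρ r).card * (ℓ / θ) ^ (2 * m) ≤ N) :
    ∃ H : Submodule ℂ (EuclideanSpace ℂ (Fin N)),
      (Module.finrank ℂ H : ℝ) ≤ 1 + s.card * (2 * N / 4 ^ m) ∧ Hᗮ ≤ onePerp N ∧
      ∀ i ∈ s, ∀ v ∈ Hᗮ,
        ‖Matrix.toEuclideanCLM (𝕜 := ℂ) (permAlg ρ (q i)) v‖ ≤ 2 * θ * ‖v‖ := by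
  have hex : ∀ i, ∃ H : Submodule ℂ (EuclideanSpace ℂ (Fin N)), i ∈ s →
      (Module.finrank ℂ H : ℝ) ≤ 2 * N / 4 ^ m ∧
      ∀ v ∈ Hᗮ, ‖Matrix.toEuclideanCLM (𝕜 := ℂ) (permAlg ρ (q i)) v‖ ≤ 2 * θ * ‖v‖ := by
    intro i
    by_cases hi : i ∈ s
    · obtain ⟨H, hH⟩ := exists_submodule_permAlg hS ρ (hq i hi) hR hθ (hqθ i hi) (hℓ i hi) hbad
      exact ⟨H, fun _ => hH⟩
    · exact ⟨⊥, fun h => absurd h hi⟩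
  choose H hH using hex
  refine ⟨Submodule.span ℂ {WithLp.toLp 2 fun _ : Fin N => (1 : ℂ)} ⊔ s.sup H, ?_,
    Submodule.orthogonal_le le_sup_left, fun i hi v hv => ?_⟩
  · have h1 : Module.finrank ℂ (Submodule.span ℂ {WithLp.toLp 2 fun _ : Fin N => (1 : ℂ)} ⊔
        s.sup H : Submodule ℂ (EuclideanSpace ℂ (Fin N))) ≤ 1 + Module.finrank ℂ (s.sup H :
          Submodule ℂ (EuclideanSpace ℂ (Fin N))) :=
      (Submodule.finrank_add_le_finrank_add_finrank _ _).trans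
        (add_le_add_left ((finrank_span_le_card _).trans (by simp)) _)
    have h2 := finrank_iSup_finset_le s H fun i hi => (hH i hi).1
    calc _ ≤ ((1 + Module.finrank ℂ (s.sup H : Submodule ℂ (EuclideanSpace ℂ (Fin N))) : ℕ) : ℝ) :=
          Nat.cast_le.2 h1
      _ ≤ _ := by
        push_cast
        linarith
  · exact (hH i hi).2 v (Submodule.orthogonal_le ((Finset.le_sup hi).trans le_sup_right) hv)

theorem one_lt_log_three : 1 < Real.log 3 :=
  (Real.lt_log_iff_exp_lt (by norm_num)).2 (Real.exp_one_lt_d9.trans (by norm_num))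

theorem log_three_le_log (hN : 3 ≤ N) : Real.log 3 ≤ Real.log N :=
  Real.log_le_log (by norm_num) (by exact_mod_cast hN)

theorem log_log_three_pos : 0 < Real.log (Real.log 3) :=
  Real.log_pos one_lt_log_three

theorem log_log_three_le (hN : 3 ≤ N) : Real.log (Real.log 3) ≤ Real.log (Real.log N) :=
  Real.log_le_log (by linarith [one_lt_log_three]) (log_three_le_log hN)

theorem exists_varianceBounds_of_strongBound (S : Finset Γ) (hS : Subgroup.closure (S : Set Γ) = ⊤)
    {C₁ : ℝ} (hRD : HasRapidDecay Γ C₁) (𝒩 : Set ℕ) (ρ : ∀ N : ℕ, Γ →* Equiv.Perm (Fin N))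
    {α β CB : ℝ} (hα : 0 < α) (hβ₁ : β < 1)
    (hbad : ∀ N ∈ 𝒩, ((bad S (ρ N) ⌈α * Real.log N⌉₊).card : ℝ) ≤ CB * (N : ℝ) ^ β)
    {p : MonoidAlgebra ℂ Γ} (hp : IsSelfAdj p) {c d C₀ : ℝ} (hC₀ : 1 ≤ C₀)
    (hAC : DiagonalBound p c d C₀) {a₁ a₂ : ℝ} (hca : c < a₁) (ha : a₁ < a₂) (had : a₂ < d)
    {C₁' γ CM : ℝ} (hC₁' : 2 * C₁ + 1 < C₁') (hγ₀ : 0 < γ) (hγ₁ : γ ≤ 1) (hCM : 0 < CM)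
    (hmom : FourthMomentBound S p a₁ a₂ C₁' γ CM) (T : Finset Γ)
    (hstrong : ∀ N ∈ 𝒩, StrongBound S (ρ N) ⌈α * Real.log N⌉₊) :
    ∃ C : ℝ, 0 < C ∧ ∀ N ∈ 𝒩, 3 ≤ N →
      ∀ η : ℝ, η = C * Real.log (Real.log N) / Real.log N →
      ∀ K : Matrix (Fin N) (Fin N) ℂ, IsLocalObservable (ρ N) T K →
        VarianceBounds (ρ N) p a₁ a₂ T K η (C * η ^ ((1 + γ) / 2)) := by
  obtain ⟨L, B, n₀, A, Cs, CV, η₀, q, hL, hB, -, hA, hCs, hCV, hη₀, hη₀', hmain⟩ :=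
    exists_varianceBounds hS hRD hp hC₀ hAC hca ha had hC₁' hγ₀ hγ₁ hCM hmom T
  have he : 0 ≤ (1 + γ) / 2 := by linarith
  have he₁ : (1 + γ) / 2 ≤ 1 := by linarith
  have hlam0 := log_log_three_pos
  obtain ⟨C', X₀, hC', hX₀, hscale⟩ := exists_truncation (CB := CB) hα hβ₁ hA hL hB n₀
  have hX₀0 : 0 < X₀ := (Real.exp_pos 1).trans_le hX₀
  -- In order: the truncation, the final variance constant, the trivial bound when `η ≥ η₀`, and a
  -- term forcing `η ≥ 1` when `log N < X₀`.
  set C : ℝ := C' + CV * (8 * Cs + 1) + (2 * T.card : ℝ) ^ 2 / η₀ +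
    X₀ / Real.log (Real.log 3) with hC
  have hp1 : 0 < CV * (8 * Cs + 1) := by positivity
  have hp2 : 0 ≤ (2 * T.card : ℝ) ^ 2 / η₀ := by positivity
  have hp3 : 0 < X₀ / Real.log (Real.log 3) := by positivity
  refine ⟨C, by linarith, fun N hN hN3 η hη K hK => ?_⟩
  have hX : 0 < Real.log N := by linarith [one_lt_log_three, log_three_le_log hN3]
  have hℓ : 0 < Real.log (Real.log 3) ∧ Real.log (Real.log 3) ≤ Real.log (Real.log N) :=
      ⟨hlam0, log_log_three_le hN3⟩
  rcases le_or_gt η₀ η with hη' | hη'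
  · exact varianceBounds_of_le_scale p a₁ a₂ hK hη₀ hη₀' hη' he he₁ (by linarith)
  have hXX₀ : X₀ ≤ Real.log N := by
    by_contra h
    have h1 : 1 ≤ η := by
      rw [hη, le_div_iff₀ hX, one_mul]
      calc Real.log N ≤ X₀ := (not_le.1 h).le
        _ = X₀ / Real.log (Real.log 3) * Real.log (Real.log 3) := by field_simp
        _ ≤ C * Real.log (Real.log N) := by
          have := hℓ.2
          gcongr
          linarith
    linarith
  obtain ⟨n, hn, hLn, hBn, hηn⟩ := hscale _ hXX₀
  have hC'η : C' * Real.log (Real.log N) / Real.log N ≤ η := by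
    rw [hη]
    gcongr
    · exact hℓ.1.le.trans hℓ.2
    · linarith
  have hη0 : 0 < η := lt_of_lt_of_le
    (div_pos (mul_pos hC' (hℓ.1.trans_le hℓ.2)) hX) hC'η
  obtain ⟨hq, hvar⟩ := hmain n hn η hη'.le (hηn η hC'η)
  have hr : L * n ≤ ⌈α * Real.log N⌉₊ := by
    have : ((L * n : ℕ) : ℝ) ≤ ⌈α * Real.log N⌉₊ := by
      push_cast
      exact hLn.trans (Nat.le_ceil _)
    exact_mod_cast this
  refine (hvar N (ρ N) _ (by lia) hr
    (bad_card_mul_le (by lia) (by positivity) (hbad N hN) hBn) K hK (8 * Cs) (by positivity)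
    fun E₁ hE₁ E₂ hE₂ g hg => ?_).mono ?_
  · obtain ⟨h1, -, h2⟩ := hq E₁ (mem_Icc_of_mem_energyNet ha hη0 hE₁) E₂
      (mem_Icc_of_mem_energyNet ha hη0 hE₂) g hg
    refine (norm_quadraticForm_le_of_strongBound (by lia) (hstrong N hN) hK h2 hr g h1).trans
      (le_of_eq ?_)
    ring
  · gcongr
    linarith

set_option maxHeartbeats 800000 in
theorem exists_submodule_varianceBounds (S : Finset Γ) (hS : Subgroup.closure (S : Set Γ) = ⊤)
    {C₁ : ℝ} (hRD : HasRapidDecay Γ C₁) (𝒩 : Set ℕ) (ρ : ∀ N : ℕ, Γ →* Equiv.Perm (Fin N))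
    {α β CB : ℝ} (hα : 0 < α) (hβ₁ : β < 1) (hCB : 0 < CB)
    (hbad : ∀ N ∈ 𝒩, ((bad S (ρ N) ⌈α * Real.log N⌉₊).card : ℝ) ≤ CB * (N : ℝ) ^ β)
    {p : MonoidAlgebra ℂ Γ} (hp : IsSelfAdj p) {c d C₀ : ℝ} (hC₀ : 1 ≤ C₀)
    (hAC : DiagonalBound p c d C₀) {a₁ a₂ : ℝ} (hca : c < a₁) (ha : a₁ < a₂) (had : a₂ < d)
    {C₁' γ CM : ℝ} (hC₁' : 2 * C₁ + 1 < C₁') (hγ₀ : 0 < γ) (hγ₁ : γ ≤ 1) (hCM : 0 < CM)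
    (hmom : FourthMomentBound S p a₁ a₂ C₁' γ CM) (T : Finset Γ) {b : ℝ} (hb : 0 < b) :
    ∃ C : ℝ, 0 < C ∧ ∃ H : ∀ N : ℕ, Submodule ℂ (EuclideanSpace ℂ (Fin N)),
      ∀ N ∈ 𝒩, 3 ≤ N →
        (Module.finrank ℂ (H N) : ℝ) ≤ N / Real.log N ^ b ∧
        ∀ η : ℝ, η = C * Real.log (Real.log N) ^ 2 / Real.log N →
        ∀ K : Matrix (Fin N) (Fin N) ℂ, IsLocalObservable (ρ N) T K →
          (∀ g ∈ T, kernelVec (ρ N) K g ∈ (H N)ᗮ) →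
          VarianceBounds (ρ N) p a₁ a₂ T K η (C * η ^ ((1 + γ) / 2)) := by
  obtain ⟨L, B, n₀, A, Cs, CV, η₀, q, hL, hB, -, hA, hCs, hCV, hη₀, hη₀', hmain⟩ :=
    exists_varianceBounds hS hRD hp hC₀ hAC hca ha had hC₁' hγ₀ hγ₁ hCM hmom T
  have he : 0 ≤ (1 + γ) / 2 := by linarith
  have he₁ : (1 + γ) / 2 ≤ 1 := by linarith
  have hlam0 := log_log_three_pos
  set c₂ : ℝ := T.card * (a₂ - a₁ + 1) ^ 2 with hc₂
  obtain ⟨C', X₀, hC', hX₀, hscale⟩ := exists_truncation_and_power hα hβ₁ hCB hA hL hB n₀ hb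
    (by positivity : 0 ≤ c₂)
  have hX₀0 : 0 < X₀ := (Real.exp_pos 1).trans_le hX₀
  -- The extra `1` yields `η ≥ 1 / log N`, which keeps the net of size `O(log N)`.
  set C : ℝ := C' + 1 + CV * (8 * max Cs 1 + 1) + (2 * T.card : ℝ) ^ 2 / η₀ +
    X₀ / Real.log (Real.log 3) ^ 2 with hC
  have hp1 : 0 < CV * (8 * max Cs 1 + 1) := by positivity
  have hp2 : 0 ≤ (2 * T.card : ℝ) ^ 2 / η₀ := by positivity
  have hp3 : 0 < X₀ / Real.log (Real.log 3) ^ 2 := by positivity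
  have hC0 : 0 < C := by linarith
  have hex : ∀ N : ℕ, ∃ H : Submodule ℂ (EuclideanSpace ℂ (Fin N)), N ∈ 𝒩 → 3 ≤ N →
      (Module.finrank ℂ H : ℝ) ≤ N / Real.log N ^ b ∧
      ∀ η : ℝ, η = C * Real.log (Real.log N) ^ 2 / Real.log N →
      ∀ K : Matrix (Fin N) (Fin N) ℂ, IsLocalObservable (ρ N) T K →
        (∀ g ∈ T, kernelVec (ρ N) K g ∈ Hᗮ) →
        VarianceBounds (ρ N) p a₁ a₂ T K η (C * η ^ ((1 + γ) / 2)) := by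
    intro N
    by_cases hN : N ∈ 𝒩 ∧ 3 ≤ N
    swap
    · exact ⟨⊥, fun h1 h2 => absurd ⟨h1, h2⟩ hN⟩
    obtain ⟨hN, hN3⟩ := hN
    have hX : 0 < Real.log N := by linarith [one_lt_log_three, log_three_le_log hN3]
    have hℓ : 0 < Real.log (Real.log 3) ∧ Real.log (Real.log 3) ≤ Real.log (Real.log N) :=
      ⟨hlam0, log_log_three_le hN3⟩
    have hN0 : (0 : ℝ) < N := by
      have : 0 < N := by lia
      exact_mod_cast this
    set η : ℝ := C * Real.log (Real.log N) ^ 2 / Real.log N with hη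
    rcases le_or_gt η₀ η with hη' | hη'
    · refine ⟨⊥, fun _ _ => ⟨?_, ?_⟩⟩
      · rw [finrank_bot]
        push_cast
        positivity
      · rintro _ rfl K hK -
        exact varianceBounds_of_le_scale p a₁ a₂ hK hη₀ hη₀' hη' he he₁ (by linarith)
    have hXX₀ : X₀ ≤ Real.log N := by
      by_contra h
      have h1 : 1 ≤ η := by
        rw [hη, le_div_iff₀ hX, one_mul]
        calc Real.log N ≤ X₀ := (not_le.1 h).le
          _ = X₀ / Real.log (Real.log 3) ^ 2 * Real.log (Real.log 3) ^ 2 := by field_simp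
          _ ≤ C * Real.log (Real.log N) ^ 2 := by
            have := hℓ.2
            gcongr
            linarith
      linarith
    obtain ⟨n, m, hn, hm, hLn, hBn, hηn, hpow, hdim⟩ := hscale _ hXX₀
    have hloglog : 1 ≤ Real.log (Real.log N) :=
      (Real.le_log_iff_exp_le hX).2 (hX₀.trans hXX₀)
    have hC'η : C' * Real.log (Real.log N) ^ 2 / Real.log N ≤ η := by
      rw [hη]
      gcongr
      linarith
    have hηX : 1 / Real.log N ≤ η := by
      rw [hη]
      gcongr
      exact one_le_mul_of_one_le_of_one_le (by linarith) (one_le_pow₀ hloglog)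
    have hη0 : 0 < η := (by positivity : 0 < 1 / Real.log N).trans_le hηX
    have hη1 : η ≤ 1 := hη'.le.trans hη₀'
    obtain ⟨hq, hvar⟩ := hmain n hn η hη'.le (hηn η hC'η)
    have hr' : m * (L * n) ≤ ⌈α * Real.log N⌉₊ := by
      have : ((m * (L * n) : ℕ) : ℝ) ≤ ⌈α * Real.log N⌉₊ := by
        push_cast
        exact hLn.trans (Nat.le_ceil _)
      exact_mod_cast this
    have hr : L * n ≤ ⌈α * Real.log N⌉₊ := (Nat.le_mul_of_pos_left _ hm).trans hr'
    -- The maximum with `1` bounds `θ` below by `(log N)^{-2}`, so that the ratio `4 / θ` raised to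
    -- the power `2m` stays within the budget of `hpow`.
    set θ : ℝ := max Cs 1 * η ^ ((3 + γ) / 2) with hθ
    have hθ0 : 0 < θ := by positivity
    have hθX : 4 / θ ≤ 4 * Real.log N ^ 2 := by
      have h1 : η ^ (2 : ℝ) ≤ η ^ ((3 + γ) / 2) :=
        Real.rpow_le_rpow_of_exponent_ge hη0 hη1 (by linarith)
      have h2 : (1 / Real.log N) ^ 2 ≤ θ := by
        calc (1 / Real.log N) ^ 2 ≤ η ^ 2 := by gcongr
          _ = η ^ (2 : ℝ) := (Real.rpow_two η).symm
          _ ≤ 1 * η ^ ((3 + γ) / 2) := by rw [one_mul]; exact h1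
          _ ≤ θ := by
            rw [hθ]
            gcongr
            exact le_max_right _ _
      calc 4 / θ ≤ 4 / (1 / Real.log N) ^ 2 := by gcongr
        _ = 4 * Real.log N ^ 2 := by field_simp
    have hqs : ∀ i ∈ energyNet a₁ a₂ η ×ˢ energyNet a₁ a₂ η ×ˢ T,
        ‖leftRegAlg (schurTwist i.2.2 (q n η i.1) (q n η i.2.1))‖ ≤ Cs * η ^ ((3 + γ) / 2) ∧
        l1Norm (schurTwist i.2.2 (q n η i.1) (q n η i.2.1)) ≤ 4 ∧
        ∀ k ∈ (schurTwist i.2.2 (q n η i.1) (q n η i.2.1)).coeff.support,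
          wordLength S k ≤ L * n := by
      intro i hi
      rw [Finset.mem_product, Finset.mem_product] at hi
      exact hq _ (mem_Icc_of_mem_energyNet ha hη0 hi.1) _
        (mem_Icc_of_mem_energyNet ha hη0 hi.2.1) _ hi.2.2
    obtain ⟨H, hHdim, hHone, hH⟩ := exists_submodule_forall_permAlg hS (ρ N)
      (energyNet a₁ a₂ η ×ˢ energyNet a₁ a₂ η ×ˢ T)
      (q := fun i => schurTwist i.2.2 (q n η i.1) (q n η i.2.1)) (m := m) (θ := θ) (ℓ := 4)
      (fun i hi => (hqs i hi).2.2) hr' hθ0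
      (fun i hi => (hqs i hi).1.trans (by rw [hθ]; gcongr; exact le_max_left _ _))
      (fun i hi => (hqs i hi).2.1)
      ((mul_le_mul_of_nonneg_left (pow_le_pow_left₀ (by positivity) hθX _)
        (Nat.cast_nonneg _)).trans
        (bad_card_mul_le (by lia) (by positivity) (hbad N hN) hpow))
    refine ⟨H, fun _ _ => ⟨?_, ?_⟩⟩
    · have hnet : ((energyNet a₁ a₂ η).card : ℝ) ≤ (a₂ - a₁ + 1) * Real.log N := by
        refine (card_energyNet_le ha hη0 hη1).trans ?_
        rw [div_le_iff₀ hη0, mul_assoc]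
        rw [div_le_iff₀ hX, mul_comm] at hηX
        exact le_mul_of_one_le_right (by linarith) hηX
      rw [Real.exp_log hN0] at hdim
      refine (hHdim.trans ?_).trans hdim
      rw [Finset.card_product, Finset.card_product]
      push_cast
      refine add_le_add le_rfl (mul_le_mul_of_nonneg_right ?_ (by positivity))
      calc _ ≤ (a₂ - a₁ + 1) * Real.log N * ((a₂ - a₁ + 1) * Real.log N * T.card) := by
            gcongr
        _ = _ := by rw [hc₂]; ring
    · rintro _ rfl K hK hker
      refine (hvar N (ρ N) _ (by lia) hr
        (bad_card_mul_le (by lia) (by positivity) (hbad N hN) hBn) K hK (8 * max Cs 1)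
        (by positivity) fun E₁ hE₁ E₂ hE₂ g hg => ?_).mono ?_
      · have h1 := hH (E₁, E₂, g) (by simp [hE₁, hE₂, hg]) _ (hker g hg)
        rw [← centeredVec_eq_kernelVec (hHone (hker g hg))] at h1
        refine (norm_star_dotProduct_mulVec_le (by positivity)
          (norm_centeredVec_le hK.2 g) h1).trans (le_of_eq ?_)
        rw [hθ]
        ring
      · gcongr
        linarith
  choose H hH using hex
  exact ⟨C, hC0, H, hH⟩

end Main

end QuantumMixing

end

theorem theoremt {Γ : Type*} [Group Γ] (S : Finset Γ) (hS : Subgroup.closure (S : Set Γ) = ⊤)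
    (C₁ : ℝ) (hRD : QuantumMixing.HasRapidDecay Γ C₁)
    -- the permutation representations, for `N` in a set of integers
    (𝒩 : Set ℕ) (ρ : ∀ N : ℕ, Γ →* Equiv.Perm (Fin N))
    (α β CB : ℝ) (hα : 0 < α) (hβ₀ : 0 ≤ β) (hβ₁ : β < 1) (hCB : 0 < CB)
    (hbad : ∀ N ∈ 𝒩,
      ((QuantumMixing.bad S (ρ N) ⌈α * Real.log N⌉₊).card : ℝ) ≤ CB * (N : ℝ) ^ β)
    -- the operator, and the spectral interval `I₀ = [c, d]`
    (p : MonoidAlgebra ℂ Γ) (hp : QuantumMixing.IsSelfAdj p)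
    (c d C₀ : ℝ) (hC₀ : 1 ≤ C₀) (hAC : QuantumMixing.DiagonalBound p c d C₀)
    -- the interval `I = [a₁, a₂]` in the interior of `I₀`
    (a₁ a₂ : ℝ) (hca : c < a₁) (ha : a₁ < a₂) (had : a₂ < d)
    (C₁' γ CM : ℝ) (hC₁' : 2 * C₁ + 1 < C₁') (hγ₀ : 0 < γ) (hγ₁ : γ ≤ 1) (hCM : 0 < CM)
    (hmom : QuantumMixing.FourthMomentBound S p a₁ a₂ C₁' γ CM)
    (T : Finset Γ) :
    -- under quantitative strong convergence
    ((∀ N ∈ 𝒩, QuantumMixing.StrongBound S (ρ N) ⌈α * Real.log N⌉₊) →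
      ∃ C : ℝ, 0 < C ∧ ∀ N ∈ 𝒩, 3 ≤ N →
        ∀ η : ℝ, η = C * Real.log (Real.log N) / Real.log N →
        ∀ K : Matrix (Fin N) (Fin N) ℂ, QuantumMixing.IsLocalObservable (ρ N) T K →
          QuantumMixing.VarianceBounds (ρ N) p a₁ a₂ T K η (C * η ^ ((1 + γ) / 2))) ∧
    -- without strong convergence
    (∀ b : ℝ, 0 < b →
      ∃ C : ℝ, 0 < C ∧ ∃ H : ∀ N : ℕ, Submodule ℂ (EuclideanSpace ℂ (Fin N)),
        ∀ N ∈ 𝒩, 3 ≤ N →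
          (Module.finrank ℂ (H N) : ℝ) ≤ N / Real.log N ^ b ∧
          ∀ η : ℝ, η = C * Real.log (Real.log N) ^ 2 / Real.log N →
          ∀ K : Matrix (Fin N) (Fin N) ℂ, QuantumMixing.IsLocalObservable (ρ N) T K →
            (∀ g ∈ T, QuantumMixing.kernelVec (ρ N) K g ∈ (H N)ᗮ) →
            QuantumMixing.VarianceBounds (ρ N) p a₁ a₂ T K η (C * η ^ ((1 + γ) / 2))) := by
  exact ⟨QuantumMixing.exists_varianceBounds_of_strongBound S hS hRD 𝒩 ρ hα hβ₁ hbad hp hC₀ hAC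
      hca ha had hC₁' hγ₀ hγ₁ hCM hmom T,
    fun b hb => QuantumMixing.exists_submodule_varianceBounds S hS hRD 𝒩 ρ hα hβ₁ hCB hbad hp hC₀
      hAC hca ha had hC₁' hγ₀ hγ₁ hCM hmom T hb⟩
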